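/- All varieties and algebraic groups are over $\mathbb{C}$. For an algebraic group $S$ and an $S$-variety $Y$ let $K_S(Y)$ denote the Grothendieck ring of $S$-equivariant algebraic vector bundles of finite rank on $Y$: the free abelian group on such bundles modulo the relations $[E]=[E']+[E'']$ for all short exact sequences $0\to E'\to E\to E''\to 0$, with product induced by the tensor product. Put $R(S)=K_S(\mathrm{pt})$, let $X^*(S)$ be the character group of $S$, and for $\chi\in X^*(S)$ let $e^\chi\in R(S)$ be the class of the corresponding one-dimensional representation. The structure morphism of $Y$ gives a ring homomorphism $R(S)\to K_S(Y)$, and a homomorphism $T\to S$ gives ring homomorphisms $R(S)\to R(T)$ and $K_S(Y)\to K_T(Y)$. **Proposition.** Let $$1\longrightarrow T_H\longrightarrow T\longrightarrow T/T_H\longrightarrow 1$$ be an exact sequence of algebraic tori and let $Y$ be an irreducible $T/T_H$-variety, on which $T$ acts through $T\to T/T_H$. (For instance, let $G/H$ with $H=G^\theta$ be an adjoint symmetric space of minimal rank, $T$ a $\theta$-stable maximal torus contained in a $\theta$-stable Borel subgroup of $G$, $T_H=T^\theta$, and $Y$ the closure of $T/T_H$ in a regular compactification of $G/H$.) Then the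 restriction homomorphism $X^*(T)\to X^*(T_H)$ has a splitting (a homomorphism that is a section of it), and there are the following isomorphisms of rings. (i) $K_{T/T_H}(Y)\otimes_{\mathbb{Z}}R(T_H)\;\simeq\;K_T(Y)$. More precisely, for every splitting $s:X^*(T_H)\to X^*(T)$ there is a ring isomorphism from the left-hand side to the right-hand side that maps $x\otimes 1$ to the image of $x$ under $K_{T/T_H}(Y)\to K_T(Y)$, and $1\otimes e^{\chi}$ to the image of $e^{s(\chi)}$ under $R(T)\to K_T(Y)$, for all $\chi\in X^*(T_H)$. Its inverse is given by isotypic decomposition: every $T$-equivariant vector bundle $E$ on $Y$ is the direct sum, over a finite set $S$ of characters $\chi$ of $T_H$, of the subbundles $E_\chi$ whose fibres are the $\chi$-eigenspaces of the (fibrewise) action of $T_H$; for each $\chi\in S$ one has $E_\chi\simeq e^{s(\chi)}\otimes E^{\chi}$ for a $T/T_H$-equivariant vector bundle $E^\chi$ on $Y$; and, for suitable such bundles, the inverse maps $[E]$ to $\sum_{\chi\in S}[E^\chi]\otimes e^{\chi}$. (ii) $K_{T/T_H}(Y)\otimes_{R(T/T_H)}R(T)\;\simeq\;K_T(Y)$,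 where $x\otimes r$ is mapped to the product of the images of $x$ and $r$ in $K_T(Y)$. -/

import Mathlib

open CategoryTheory MonoidalCategory CartesianMonoidalCategory AlgebraicGeometry MonObj
open scoped TensorProduct

noncomputable section

namespace EquivariantK

/-! ### Complex points and regular functions

Varieties over `ℂ` are schemes over `Spec ℂ`. As usual for varieties over an algebraically closed
field, functions and vector bundles are handled through the `ℂ`-points. -/

/-- `Spec ℂ`. -/
abbrev Base : Scheme.{0} := Spec (.of ℂ)

/-- The set `X(ℂ)` of complex points. If `G` is a group object acting on `Y`, then `Pt G` is a
group acting on `Pt Y`, by the instances of Mathlib. -/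
abbrev Pt (X : Over Base) : Type := 𝟙_ (Over Base) ⟶ X

/-- The complex point `x` lies in the open set `U`. -/
def In {X : Over Base} (x : Pt X) (U : X.left.Opens) : Prop := ⊤ ≤ x.left ⁻¹ᵁ U

/-- The value at the complex point `x` of a section of the structure sheaf. -/
def evalAt {X : Over Base} (x : Pt X) (U : X.left.Opens) (h : In x U) : Γ(X.left, U) →+* ℂ :=
  (x.left.appLE U ⊤ h ≫ (Scheme.ΓSpecIso (.of ℂ)).hom).hom

/-- A complex valued function on the complex points of the open set `U` is regular if it is locally
given by sections of the structure sheaf. -/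
def RegularOn {X : Over Base} (U : X.left.Opens) (F : ∀ x : Pt X, In x U → ℂ) : Prop :=
  ∀ (x : Pt X) (_ : In x U), ∃ (V : X.left.Opens) (hVU : V ≤ U) (_ : In x V) (f : Γ(X.left, V)),
    ∀ (z : Pt X) (hz : In z V), F z (le_trans hz (fun _ h => hVU h)) = evalAt z V hz f

section basics

variable {X X' : Over Base}

lemma In.mono {x : Pt X} {U V : X.left.Opens} (h : In x U) (hUV : U ≤ V) : In x V :=
  le_trans h (fun _ hh => hUV hh)

lemma In.inf {x : Pt X} {U V : X.left.Opens} (h : In x U) (h' : In x V) : In x (U ⊓ V) :=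
  fun _ hp => ⟨h hp, h' hp⟩

lemma In.left {x : Pt X} {U V : X.left.Opens} (h : In x (U ⊓ V)) : In x U := h.mono inf_le_left

lemma In.right {x : Pt X} {U V : X.left.Opens} (h : In x (U ⊓ V)) : In x V := h.mono inf_le_right

lemma In.top (x : Pt X) : In x ⊤ := fun _ _ => trivial

lemma in_comp_iff (f : X ⟶ X') (x : Pt X) (U : X'.left.Opens) :
    In (x ≫ f) U ↔ In x (f.left ⁻¹ᵁ U) := by
  simp only [In, Over.comp_left]
  rfl

lemma evalAt_res (x : Pt X) {U V : X.left.Opens} (hUV : V ≤ U) (h : In x V) (f : Γ(X.left, U)) :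
    evalAt x V h (X.left.presheaf.map (homOfLE hUV).op f) = evalAt x U (h.mono hUV) f := by
  have := Scheme.Hom.map_appLE x.left (U := V) (V := ⊤) h (homOfLE hUV).op
  simp only [evalAt, ← this]
  rfl

lemma evalAt_comp (f : X ⟶ X') (x : Pt X) (U : X'.left.Opens) (h : In (x ≫ f) U)
    (s : Γ(X'.left, U)) :
    evalAt (x ≫ f) U h s = evalAt x (f.left ⁻¹ᵁ U) ((in_comp_iff f x U).1 h) (f.left.app U s) := by
  have := Scheme.Hom.comp_appLE x.left f.left U ⊤ h
  simp only [evalAt, Over.comp_left]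
  rw [this]
  rfl

lemma RegularOn.congr {U : X.left.Opens} {F F' : ∀ x : Pt X, In x U → ℂ} (h : RegularOn U F)
    (e : ∀ x hx, F' x hx = F x hx) : RegularOn U F' := by
  have : F' = F := by ext x hx; exact e x hx
  rwa [this]

lemma RegularOn.mono {U V : X.left.Opens} {F : ∀ x : Pt X, In x U → ℂ} (h : RegularOn U F)
    (hVU : V ≤ U) : RegularOn V (fun x hx => F x (hx.mono hVU)) := by
  intro x hx
  obtain ⟨W, hW, hxW, f, hf⟩ := h x (hx.mono hVU)
  refine ⟨W ⊓ V, inf_le_right, hxW.inf hx,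
    X.left.presheaf.map (homOfLE (inf_le_left : W ⊓ V ≤ W)).op f, fun z hz => ?_⟩
  rw [evalAt_res]
  exact hf z hz.left

lemma RegularOn.of_local {U : X.left.Opens} {F : ∀ x : Pt X, In x U → ℂ}
    (h : ∀ (x : Pt X) (_ : In x U), ∃ (V : X.left.Opens) (_ : In x V),
      RegularOn (U ⊓ V) (fun z hz => F z hz.left)) : RegularOn U F := by
  intro x hx
  obtain ⟨V, hxV, hV⟩ := h x hx
  obtain ⟨W, hW, hxW, f, hf⟩ := hV x (hx.inf hxV)
  exact ⟨W, hW.trans inf_le_left, hxW, f, hf⟩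

lemma RegularOn.const (U : X.left.Opens) (c : ℤ) : RegularOn U (fun _ _ => (c : ℂ)) :=
  fun _ hx => ⟨U, le_rfl, hx, c, fun _ _ => by simp⟩

lemma RegularOn.add {U : X.left.Opens} {F F' : ∀ x : Pt X, In x U → ℂ} (h : RegularOn U F)
    (h' : RegularOn U F') : RegularOn U (fun x hx => F x hx + F' x hx) := by
  intro x hx
  obtain ⟨W, hW, hxW, f, hf⟩ := h x hx
  obtain ⟨W', hW', hxW', f', hf'⟩ := h' x hx
  refine ⟨W ⊓ W', inf_le_left.trans hW, hxW.inf hxW',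
    X.left.presheaf.map (homOfLE (inf_le_left : W ⊓ W' ≤ W)).op f +
      X.left.presheaf.map (homOfLE (inf_le_right : W ⊓ W' ≤ W')).op f', fun z hz => ?_⟩
  rw [map_add, evalAt_res, evalAt_res, ← hf z hz.left, ← hf' z hz.right]

lemma RegularOn.mul {U : X.left.Opens} {F F' : ∀ x : Pt X, In x U → ℂ} (h : RegularOn U F)
    (h' : RegularOn U F') : RegularOn U (fun x hx => F x hx * F' x hx) := by
  intro x hx
  obtain ⟨W, hW, hxW, f, hf⟩ := h x hx
  obtain ⟨W', hW', hxW', f', hf'⟩ := h' x hx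
  refine ⟨W ⊓ W', inf_le_left.trans hW, hxW.inf hxW',
    X.left.presheaf.map (homOfLE (inf_le_left : W ⊓ W' ≤ W)).op f *
      X.left.presheaf.map (homOfLE (inf_le_right : W ⊓ W' ≤ W')).op f', fun z hz => ?_⟩
  rw [map_mul, evalAt_res, evalAt_res, ← hf z hz.left, ← hf' z hz.right]

lemma RegularOn.sum {I : Type} (s : Finset I) {U : X.left.Opens}
    {F : I → ∀ x : Pt X, In x U → ℂ} (h : ∀ i, RegularOn U (F i)) :
    RegularOn U (fun x hx => ∑ i ∈ s, F i x hx) := by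
  classical
  induction s using Finset.induction_on with
  | empty => simpa using RegularOn.const U 0
  | insert a s ha ih =>
    refine ((h a).add ih).congr fun x hx => ?_
    rw [Finset.sum_insert ha]

lemma RegularOn.comp (f : X ⟶ X') {U : X'.left.Opens} {F : ∀ x : Pt X', In x U → ℂ}
    (h : RegularOn U F) :
    RegularOn (f.left ⁻¹ᵁ U) (fun x hx => F (x ≫ f) ((in_comp_iff f x U).2 hx)) := by
  intro x hx
  obtain ⟨W, hW, hxW, s, hs⟩ := h (x ≫ f) ((in_comp_iff f x U).2 hx)
  refine ⟨f.left ⁻¹ᵁ W, fun p hp => hW hp, (in_comp_iff f x W).1 hxW, f.left.app W s,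
    fun z hz => ?_⟩
  rw [← evalAt_comp f z W ((in_comp_iff f z W).2 hz)]
  exact hs (z ≫ f) _

end basics

/-- For families of vector spaces `A`, `B` over the points of `X`, with bases over the open set `W`:
the family of linear maps `φ` has a matrix whose entries are regular functions on `W`. -/
def LinReg {X : Over Base} (W : X.left.Opens) {A B : Pt X → Type}
    [∀ x, AddCommGroup (A x)] [∀ x, Module ℂ (A x)]
    [∀ x, AddCommGroup (B x)] [∀ x, Module ℂ (B x)] {I J : Type}
    (a : ∀ x, In x W → Module.Basis I ℂ (A x)) (b : ∀ x, In x W → Module.Basis J ℂ (B x))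
    (φ : ∀ x, A x →ₗ[ℂ] B x) : Prop :=
  ∀ i j, RegularOn W (fun x hx => (b x hx).repr (φ x (a x hx i)) j)

section LinReg

variable {X : Over Base} {W : X.left.Opens} {A B C A' B' : Pt X → Type}
    [∀ x, AddCommGroup (A x)] [∀ x, Module ℂ (A x)]
    [∀ x, AddCommGroup (B x)] [∀ x, Module ℂ (B x)]
    [∀ x, AddCommGroup (C x)] [∀ x, Module ℂ (C x)]
    [∀ x, AddCommGroup (A' x)] [∀ x, Module ℂ (A' x)]
    [∀ x, AddCommGroup (B' x)] [∀ x, Module ℂ (B' x)] {I J L I' J' : Type}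
    {a : ∀ x, In x W → Module.Basis I ℂ (A x)} {b : ∀ x, In x W → Module.Basis J ℂ (B x)}
    {c : ∀ x, In x W → Module.Basis L ℂ (C x)}
    {a' : ∀ x, In x W → Module.Basis I' ℂ (A' x)} {b' : ∀ x, In x W → Module.Basis J' ℂ (B' x)}
    {φ : ∀ x, A x →ₗ[ℂ] B x} {ψ : ∀ x, B x →ₗ[ℂ] C x} {φ' : ∀ x, A' x →ₗ[ℂ] B' x}

lemma LinReg.mono (h : LinReg W a b φ) {V : X.left.Opens} (hVW : V ≤ W) :
    LinReg V (fun x hx => a x (hx.mono hVW)) (fun x hx => b x (hx.mono hVW)) φ :=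
  fun i j => (h i j).mono hVW

lemma LinReg.comp [Fintype J] (h : LinReg W a b φ) (h' : LinReg W b c ψ) :
    LinReg W a c (fun x => ψ x ∘ₗ φ x) := by
  intro i j
  refine (RegularOn.sum Finset.univ fun k => (h i k).mul (h' k j)).congr fun x hx => ?_
  conv_lhs => rw [LinearMap.comp_apply, ← (b x hx).sum_repr (φ x (a x hx i))]
  simp only [map_sum, map_smul, Finsupp.coe_finsetSum, Finset.sum_apply, Finsupp.smul_apply,
    smul_eq_mul]

lemma LinReg.tensor (h : LinReg W a b φ) (h' : LinReg W a' b' φ') :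
    LinReg W (fun x hx => (a x hx).tensorProduct (a' x hx))
      (fun x hx => (b x hx).tensorProduct (b' x hx))
      (fun x => TensorProduct.map (φ x) (φ' x)) := by
  rintro ⟨i, i'⟩ ⟨j, j'⟩
  refine ((h i j).mul (h' i' j')).congr fun x hx => ?_
  simp [Module.Basis.tensorProduct_apply, mul_comm]

end LinReg

section entries

variable {A B C : Type} [AddCommGroup A] [Module ℂ A] [AddCommGroup B] [Module ℂ B]
  [AddCommGroup C] [Module ℂ C] {I I' J J' L L' : Type}
  (a : Module.Basis I ℂ A) (a' : Module.Basis I' ℂ A) (b : Module.Basis J ℂ B)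
  (b' : Module.Basis J' ℂ B) (c : Module.Basis L ℂ C) (c' : Module.Basis L' ℂ C)

lemma comm_entry (i : I) (i' : I') (j : J) (j' : J') :
    (b'.tensorProduct a').repr (TensorProduct.comm ℂ A B (a.tensorProduct b (i, j))) (j', i') =
      a'.repr (a i) i' * b'.repr (b j) j' := by
  simp [Module.Basis.tensorProduct_apply]

lemma assoc_entry (i : I) (i' : I') (j : J) (j' : J') (l : L) (l' : L') :
    (a'.tensorProduct (b'.tensorProduct c')).repr
        (TensorProduct.assoc ℂ A B C ((a.tensorProduct b).tensorProduct c ((i, j), l)))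
        (i', (j', l')) =
      a'.repr (a i) i' * (b'.repr (b j) j' * c'.repr (c l) l') := by
  simp [Module.Basis.tensorProduct_apply]
  ring

lemma assoc_symm_entry (i : I) (i' : I') (j : J) (j' : J') (l : L) (l' : L') :
    ((a.tensorProduct b).tensorProduct c).repr
        ((TensorProduct.assoc ℂ A B C).symm (a'.tensorProduct (b'.tensorProduct c') (i', (j', l'))))
        ((i, j), l) =
      a.repr (a' i') i * (b.repr (b' j') j * c.repr (c' l') l) := by
  simp [Module.Basis.tensorProduct_apply]
  ring

lemma lid_entry (u : Unit) (i : I) (i' : I') :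
    a'.repr (TensorProduct.lid ℂ A (((Module.Basis.singleton Unit ℂ).tensorProduct a) (u, i))) i' =
      a'.repr (a i) i' := by
  simp [Module.Basis.tensorProduct_apply]

lemma lid_symm_entry (u : Unit) (i : I) (i' : I') :
    ((Module.Basis.singleton Unit ℂ).tensorProduct a').repr
      ((TensorProduct.lid ℂ A).symm (a i)) (u, i') = a'.repr (a i) i' := by
  simp

lemma one_entry (u u' : Unit) :
    ((1 : ℤ) : ℂ) = (Module.Basis.singleton Unit ℂ).repr (Module.Basis.singleton Unit ℂ u) u' := by
  simp

lemma smul_entry (u u' : Unit) (z : ℂ) :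
    (Module.Basis.singleton Unit ℂ).repr (z • Module.Basis.singleton Unit ℂ u) u' = z := by
  simp

lemma lid_act (φ : A →ₗ[ℂ] B) (v : ℂ ⊗[ℂ] A) :
    TensorProduct.lid ℂ B (TensorProduct.map LinearMap.id φ v) =
      φ (TensorProduct.lid ℂ A v) := by
  induction v using TensorProduct.induction_on with
  | zero => simp
  | tmul a v => simp
  | add v w hv hw => simp only [map_add, hv, hw]

lemma assoc_symm_act {A' B' C' : Type} [AddCommGroup A'] [Module ℂ A'] [AddCommGroup B']
    [Module ℂ B'] [AddCommGroup C'] [Module ℂ C'] (φ : A →ₗ[ℂ] A') (ψ : B →ₗ[ℂ] B')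
    (χ : C →ₗ[ℂ] C') (v : A ⊗[ℂ] (B ⊗[ℂ] C)) :
    (TensorProduct.assoc ℂ A' B' C').symm (TensorProduct.map φ (TensorProduct.map ψ χ) v) =
      TensorProduct.map (TensorProduct.map φ ψ) χ ((TensorProduct.assoc ℂ A B C).symm v) := by
  rw [LinearEquiv.symm_apply_eq, ← TensorProduct.map_map_assoc, LinearEquiv.apply_symm_apply]

end entries

/-! ### Equivariant vector bundles -/

/-- A frame over an open set `dom` of a family of vector spaces over `Y(ℂ)`: a basis of each of the
vector spaces over the points of `dom`. -/
structure Frame (Y : Over Base) (E : Pt Y → Type)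
    [∀ y, AddCommGroup (E y)] [∀ y, Module ℂ (E y)] where
  dom : Y.left.Opens
  I : Type
  [fin : Fintype I]
  basis : ∀ y, In y dom → Module.Basis I ℂ (E y)

attribute [instance] Frame.fin

lemma fst_smul_snd {G Y : Over Base} [GrpObj G] [ModObj G Y] (p : Pt (G ⊗ Y)) :
    (p ≫ fst G Y) • (p ≫ snd G Y) = p ≫ γ[G, Y] := by
  rw [Hom.smul_def, ← comp_lift, lift_fst_snd, Category.comp_id]

/-- A `G`-equivariant algebraic vector bundle of finite rank on a reduced `ℂ`-scheme `Y` of finite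
type with an action of a reduced algebraic group `G`:
a family of vector spaces over the points of `Y`, locally trivialised by frames whose transition
matrices are regular, with linear maps `act g : E_y → E_{g y}` that form an action and are regular,
that is, the matrix of `(g, y) ↦ (act g : E_y → E_{g y})` in the frames is regular on
`{(g, y) ∈ G × Y | y ∈ dom b, g y ∈ dom c}`. The map `act g h` has an argument `h : g • y = z`,
so that its target can be given as the fibre over `z`. -/
structure EqBundle (G Y : Over Base) [GrpObj G] [ModObj G Y] where
  fiber : Pt Y → Type
  [acg : ∀ y, AddCommGroup (fiber y)]
  [mod : ∀ y, Module ℂ (fiber y)]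
  atlas : Set (Frame Y fiber)
  cover : ∀ y, ∃ b ∈ atlas, In y b.dom
  transition : ∀ b ∈ atlas, ∀ c ∈ atlas, LinReg (b.dom ⊓ c.dom)
    (fun y hy => b.basis y hy.left) (fun y hy => c.basis y hy.right) (fun _ => LinearMap.id)
  act : ∀ (g : Pt G) {y z : Pt Y}, g • y = z → (fiber y →ₗ[ℂ] fiber z)
  act_one : ∀ (y : Pt Y) (h : (1 : Pt G) • y = y) (v : fiber y), act 1 h v = v
  act_mul : ∀ (g g' : Pt G) {x y z : Pt Y} (h' : g' • x = y) (h : g • y = z)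
    (hh : (g * g') • x = z) (v : fiber x), act (g * g') hh v = act g h (act g' h' v)
  act_regular : ∀ b ∈ atlas, ∀ c ∈ atlas,
    LinReg (X := G ⊗ Y)
      ((snd G Y).left ⁻¹ᵁ b.dom ⊓ (γ[G, Y] : G ⊗ Y ⟶ Y).left ⁻¹ᵁ c.dom)
      (fun p hp => b.basis (p ≫ snd G Y) ((in_comp_iff _ _ _).2 hp.left))
      (fun p hp => c.basis (p ≫ γ[G, Y]) ((in_comp_iff (X := G ⊗ Y) _ _ _).2 hp.right))
      (fun p => act (p ≫ fst G Y) (fst_smul_snd p))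

attribute [instance] EqBundle.acg EqBundle.mod

section bundles

variable {G Y : Over Base} [GrpObj G] [ModObj G Y]

/-- Morphisms of `G`-equivariant vector bundles: families of linear maps of the fibres that are
regular in the frames and commute with the action. -/
structure IsHom (E F : EqBundle G Y) (φ : ∀ y, E.fiber y →ₗ[ℂ] F.fiber y) : Prop where
  regular : ∀ b ∈ E.atlas, ∀ c ∈ F.atlas, LinReg (b.dom ⊓ c.dom)
    (fun y hy => b.basis y hy.left) (fun y hy => c.basis y hy.right) φ
  equivariant : ∀ (g : Pt G) {y z : Pt Y} (h : g • y = z) (v : E.fiber y),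
    φ z (E.act g h v) = F.act g h (φ y v)

/-- `E` and `F` are isomorphic. -/
def IsIsom (E F : EqBundle G Y) : Prop :=
  ∃ e : ∀ y, E.fiber y ≃ₗ[ℂ] F.fiber y,
    IsHom E F (fun y => (e y).toLinearMap) ∧ IsHom F E (fun y => (e y).symm.toLinearMap)

/-- There is a short exact sequence `0 → E' → E → E'' → 0` of equivariant vector bundles.
Exactness of a sequence of vector bundles is exactness on all fibres. -/
def IsShortExact (E' E E'' : EqBundle G Y) : Prop :=
  ∃ (f : ∀ y, E'.fiber y →ₗ[ℂ] E.fiber y) (g : ∀ y, E.fiber y →ₗ[ℂ] E''.fiber y),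
    IsHom E' E f ∧ IsHom E E'' g ∧
      ∀ y, Function.Injective (f y) ∧ Function.Exact (f y) (g y) ∧ Function.Surjective (g y)

lemma IsHom.id (E : EqBundle G Y) : IsHom E E (fun _ => LinearMap.id) :=
  ⟨E.transition, fun _ _ _ _ _ => rfl⟩

lemma IsHom.comp {E F K : EqBundle G Y} {φ : ∀ y, E.fiber y →ₗ[ℂ] F.fiber y}
    {ψ : ∀ y, F.fiber y →ₗ[ℂ] K.fiber y} (h : IsHom E F φ) (h' : IsHom F K ψ) :
    IsHom E K (fun y => ψ y ∘ₗ φ y) := by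
  refine ⟨fun b hb d hd i j => RegularOn.of_local fun x _ => ?_, fun g y z hh v => ?_⟩
  · obtain ⟨c, hc, hxc⟩ := F.cover x
    refine ⟨c.dom, hxc, ?_⟩
    have h1 := (h.regular b hb c hc).mono
      (V := (b.dom ⊓ d.dom) ⊓ c.dom) (le_inf (inf_le_left.trans inf_le_left) inf_le_right)
    have h2 := (h'.regular c hc d hd).mono
      (V := (b.dom ⊓ d.dom) ⊓ c.dom) (le_inf inf_le_right (inf_le_left.trans inf_le_right))
    exact h1.comp h2 i j
  · simp [h.equivariant g hh v, h'.equivariant g hh]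

lemma IsIsom.refl (E : EqBundle G Y) : IsIsom E E :=
  ⟨fun _ => LinearEquiv.refl ℂ _, IsHom.id E, IsHom.id E⟩

lemma IsIsom.symm {E F : EqBundle G Y} (h : IsIsom E F) : IsIsom F E := by
  obtain ⟨e, h1, h2⟩ := h
  exact ⟨fun y => (e y).symm, h2, h1⟩

lemma IsIsom.trans {E F K : EqBundle G Y} (h : IsIsom E F) (h' : IsIsom F K) : IsIsom E K := by
  obtain ⟨e, h1, h2⟩ := h
  obtain ⟨e', h1', h2'⟩ := h'
  exact ⟨fun y => (e y).trans (e' y), h1.comp h1', h2'.comp h2⟩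

/-- The tensor product of two frames, over the intersection of their domains. -/
def Frame.tensor {E F : Pt Y → Type} [∀ y, AddCommGroup (E y)] [∀ y, Module ℂ (E y)]
    [∀ y, AddCommGroup (F y)] [∀ y, Module ℂ (F y)] (b : Frame Y E) (c : Frame Y F) :
    Frame Y (fun y => E y ⊗[ℂ] F y) where
  dom := b.dom ⊓ c.dom
  I := b.I × c.I
  basis y hy := (b.basis y hy.left).tensorProduct (c.basis y hy.right)

/-- The tensor product of equivariant vector bundles. -/
def EqBundle.tensor (E F : EqBundle G Y) : EqBundle G Y where
  fiber y := E.fiber y ⊗[ℂ] F.fiber y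
  atlas := {d | ∃ b ∈ E.atlas, ∃ c ∈ F.atlas, d = b.tensor c}
  cover y := by
    obtain ⟨b, hb, hyb⟩ := E.cover y
    obtain ⟨c, hc, hyc⟩ := F.cover y
    exact ⟨b.tensor c, ⟨b, hb, c, hc, rfl⟩, hyb.inf hyc⟩
  transition := by
    rintro _ ⟨b, hb, c, hc, rfl⟩ _ ⟨b', hb', c', hc', rfl⟩
    have h1 := (E.transition b hb b' hb').mono (V := (b.tensor c).dom ⊓ (b'.tensor c').dom)
      (inf_le_inf inf_le_left inf_le_left)
    have h2 := (F.transition c hc c' hc').mono (V := (b.tensor c).dom ⊓ (b'.tensor c').dom)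
      (inf_le_inf inf_le_right inf_le_right)
    have h3 := h1.tensor h2
    simp only [TensorProduct.map_id] at h3
    exact h3
  act g _ _ h := TensorProduct.map (E.act g h) (F.act g h)
  act_one y h v := by
    have h1 : E.act 1 h = LinearMap.id := LinearMap.ext (E.act_one y h)
    have h2 : F.act 1 h = LinearMap.id := LinearMap.ext (F.act_one y h)
    rw [h1, h2, TensorProduct.map_id]; rfl
  act_mul g g' _ _ _ h' h hh v := by
    have h1 : E.act (g * g') hh = E.act g h ∘ₗ E.act g' h' :=
      LinearMap.ext (E.act_mul g g' h' h hh)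
    have h2 : F.act (g * g') hh = F.act g h ∘ₗ F.act g' h' :=
      LinearMap.ext (F.act_mul g g' h' h hh)
    rw [h1, h2, TensorProduct.map_comp]; rfl
  act_regular := by
    rintro _ ⟨b, hb, c, hc, rfl⟩ _ ⟨b', hb', c', hc', rfl⟩
    have h1 := (E.act_regular b hb b' hb').mono
      (V := (snd G Y).left ⁻¹ᵁ (b.tensor c).dom ⊓
        (γ[G, Y] : G ⊗ Y ⟶ Y).left ⁻¹ᵁ (b'.tensor c').dom)
      (inf_le_inf (fun _ h => h.1) (fun _ h => h.1))
    have h2 := (F.act_regular c hc c' hc').mono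
      (V := (snd G Y).left ⁻¹ᵁ (b.tensor c).dom ⊓
        (γ[G, Y] : G ⊗ Y ⟶ Y).left ⁻¹ᵁ (b'.tensor c').dom)
      (inf_le_inf (fun _ h => h.2) (fun _ h => h.2))
    exact h1.tensor h2

lemma IsHom.tensor {E F E' F' : EqBundle G Y} {φ : ∀ y, E.fiber y →ₗ[ℂ] F.fiber y}
    {φ' : ∀ y, E'.fiber y →ₗ[ℂ] F'.fiber y} (h : IsHom E F φ) (h' : IsHom E' F' φ') :
    IsHom (E.tensor E') (F.tensor F') (fun y => TensorProduct.map (φ y) (φ' y)) := by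
  refine ⟨?_, fun g y z hh v => ?_⟩
  · rintro _ ⟨b, hb, c, hc, rfl⟩ _ ⟨b', hb', c', hc', rfl⟩
    have h1 := (h.regular b hb b' hb').mono (V := (b.tensor c).dom ⊓ (b'.tensor c').dom)
      (inf_le_inf inf_le_left inf_le_left)
    have h2 := (h'.regular c hc c' hc').mono (V := (b.tensor c).dom ⊓ (b'.tensor c').dom)
      (inf_le_inf inf_le_right inf_le_right)
    exact h1.tensor h2
  · have h1 : φ z ∘ₗ E.act g hh = F.act g hh ∘ₗ φ y := LinearMap.ext (h.equivariant g hh)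
    have h2 : φ' z ∘ₗ E'.act g hh = F'.act g hh ∘ₗ φ' y := LinearMap.ext (h'.equivariant g hh)
    change (TensorProduct.map (φ z) (φ' z) ∘ₗ TensorProduct.map (E.act g hh) (E'.act g hh)) v =
      (TensorProduct.map (F.act g hh) (F'.act g hh) ∘ₗ TensorProduct.map (φ y) (φ' y)) v
    rw [← TensorProduct.map_comp, ← TensorProduct.map_comp, h1, h2]

lemma IsShortExact.tensor_left (F : EqBundle G Y) {E' E E'' : EqBundle G Y}
    (h : IsShortExact E' E E'') :
    IsShortExact (F.tensor E') (F.tensor E) (F.tensor E'') := by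
  obtain ⟨f, g, hf, hg, hex⟩ := h
  refine ⟨fun y => TensorProduct.map LinearMap.id (f y),
    fun y => TensorProduct.map LinearMap.id (g y), (IsHom.id F).tensor hf, (IsHom.id F).tensor hg,
    fun y => ⟨?_, ?_, ?_⟩⟩
  · exact Module.Flat.lTensor_preserves_injective_linearMap (M := F.fiber y) (f y) (hex y).1
  · exact lTensor_exact (F.fiber y) (hex y).2.1 (hex y).2.2
  · exact LinearMap.lTensor_surjective (F.fiber y) (hex y).2.2

lemma isIsom_tensor {E F E' F' : EqBundle G Y} (h : IsIsom E F) (h' : IsIsom E' F') :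
    IsIsom (E.tensor E') (F.tensor F') := by
  obtain ⟨e, h1, h2⟩ := h
  obtain ⟨e', h1', h2'⟩ := h'
  exact ⟨fun y => TensorProduct.congr (e y) (e' y), h1.tensor h1', h2.tensor h2'⟩

lemma isIsom_comm (E F : EqBundle G Y) : IsIsom (E.tensor F) (F.tensor E) := by
  have key : ∀ E F : EqBundle G Y, IsHom (E.tensor F) (F.tensor E)
      (fun y => (TensorProduct.comm ℂ (E.fiber y) (F.fiber y)).toLinearMap) := by
    intro E F
    refine ⟨?_, fun g y z h v => ?_⟩
    · rintro _ ⟨b, hb, c, hc, rfl⟩ _ ⟨c', hc', b', hb', rfl⟩ ⟨i, k⟩ ⟨k', i'⟩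
      have h1 := (E.transition b hb b' hb').mono (V := (b.tensor c).dom ⊓ (c'.tensor b').dom)
        (inf_le_inf inf_le_left inf_le_right) i i'
      have h2 := (F.transition c hc c' hc').mono (V := (b.tensor c).dom ⊓ (c'.tensor b').dom)
        (inf_le_inf inf_le_right inf_le_left) k k'
      exact (h1.mul h2).congr fun y hy => comm_entry _ _ _ _ i i' k k'
    · exact (TensorProduct.map_comm (F.act g h) (E.act g h) v).symm
  exact ⟨fun y => TensorProduct.comm ℂ _ _, key E F, key F E⟩

lemma isIsom_assoc (E F K : EqBundle G Y) :
    IsIsom ((E.tensor F).tensor K) (E.tensor (F.tensor K)) := by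
  refine ⟨fun y => TensorProduct.assoc ℂ _ _ _, ⟨?_, fun g y z h v => ?_⟩,
    ⟨?_, fun g y z h v => ?_⟩⟩
  · rintro _ ⟨_, ⟨b, hb, c, hc, rfl⟩, d, hd, rfl⟩ _ ⟨b', hb', _, ⟨c', hc', d', hd', rfl⟩, rfl⟩
      ⟨⟨i, k⟩, l⟩ ⟨i', k', l'⟩
    let V := ((b.tensor c).tensor d).dom ⊓ (b'.tensor (c'.tensor d')).dom
    have h1 := (E.transition b hb b' hb').mono (V := V)
      (fun _ h => ⟨h.1.1.1, h.2.1⟩) i i'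
    have h2 := (F.transition c hc c' hc').mono (V := V)
      (fun _ h => ⟨h.1.1.2, h.2.2.1⟩) k k'
    have h3 := (K.transition d hd d' hd').mono (V := V)
      (fun _ h => ⟨h.1.2, h.2.2.2⟩) l l'
    exact (h1.mul (h2.mul h3)).congr fun y hy => assoc_entry _ _ _ _ _ _ i i' k k' l l'
  · exact (TensorProduct.map_map_assoc (E.act g h) (F.act g h) (K.act g h) v).symm
  · rintro _ ⟨b', hb', _, ⟨c', hc', d', hd', rfl⟩, rfl⟩ _ ⟨_, ⟨b, hb, c, hc, rfl⟩, d, hd, rfl⟩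
      ⟨i', k', l'⟩ ⟨⟨i, k⟩, l⟩
    let V := (b'.tensor (c'.tensor d')).dom ⊓ ((b.tensor c).tensor d).dom
    have h1 := (E.transition b' hb' b hb).mono (V := V)
      (fun _ h => ⟨h.1.1, h.2.1.1⟩) i' i
    have h2 := (F.transition c' hc' c hc).mono (V := V)
      (fun _ h => ⟨h.1.2.1, h.2.1.2⟩) k' k
    have h3 := (K.transition d' hd' d hd).mono (V := V)
      (fun _ h => ⟨h.1.2.2, h.2.2⟩) l' l
    exact (h1.mul (h2.mul h3)).congr fun y hy => assoc_symm_entry _ _ _ _ _ _ i i' k k' l l'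
  · exact assoc_symm_act (E.act g h) (F.act g h) (K.act g h) v

/-- The frame of the family of vector spaces with constant fibre `ℂ` given by `1`. -/
def Frame.one (Y : Over Base) : Frame Y (fun _ => ℂ) where
  dom := ⊤
  I := Unit
  basis _ _ := Module.Basis.singleton Unit ℂ

variable (G Y) in
/-- The trivial line bundle with trivial action. -/
def EqBundle.unit : EqBundle G Y where
  fiber _ := ℂ
  atlas := {Frame.one Y}
  cover y := ⟨Frame.one Y, rfl, In.top y⟩
  transition := by
    rintro _ rfl _ rfl i j
    exact (RegularOn.const _ 1).congr fun y hy => (one_entry i j).symm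
  act _ _ _ _ := LinearMap.id
  act_one _ _ _ := rfl
  act_mul _ _ _ _ _ _ _ _ _ := rfl
  act_regular := by
    rintro _ rfl _ rfl i j
    exact (RegularOn.const _ 1).congr fun y hy => (one_entry i j).symm

lemma isIsom_unit_tensor (E : EqBundle G Y) : IsIsom ((EqBundle.unit G Y).tensor E) E := by
  refine ⟨fun y => TensorProduct.lid ℂ _, ⟨?_, fun g y z h v => ?_⟩, ⟨?_, fun g y z h v => ?_⟩⟩
  · rintro _ ⟨_, rfl, b, hb, rfl⟩ c hc ⟨_, i⟩ j
    exact ((E.transition b hb c hc).mono (V := ((Frame.one Y).tensor b).dom ⊓ c.dom)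
      (fun _ h => ⟨h.1.2, h.2⟩) i j).congr fun y hy => lid_entry _ _ _ i j
  · exact lid_act (E.act g h) v
  · rintro b hb _ ⟨_, rfl, c, hc, rfl⟩ i ⟨_, j⟩
    exact ((E.transition b hb c hc).mono (V := b.dom ⊓ ((Frame.one Y).tensor c).dom)
      (fun _ h => ⟨h.1, h.2.2⟩) i j).congr fun y hy => lid_symm_entry _ _ _ i j
  · change (1 : ℂ) ⊗ₜ[ℂ] (E.act g h v) =
      TensorProduct.map LinearMap.id (E.act g h) ((1 : ℂ) ⊗ₜ[ℂ] v)
    simp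

/-! ### The equivariant Grothendieck ring -/

variable (G Y) in
/-- Isomorphism of equivariant vector bundles as an equivalence relation. -/
def isomSetoid : Setoid (EqBundle G Y) where
  r := IsIsom
  iseqv := ⟨IsIsom.refl, IsIsom.symm, IsIsom.trans⟩

variable (G Y) in
/-- The set of isomorphism classes of equivariant vector bundles. -/
def BundleClass : Type 1 := Quotient (isomSetoid G Y)

/-- The isomorphism class of an equivariant vector bundle. -/
def EqBundle.isoClass (E : EqBundle G Y) : BundleClass G Y := Quotient.mk (isomSetoid G Y) E

lemma isoClass_eq {E F : EqBundle G Y} (h : IsIsom E F) : E.isoClass = F.isoClass :=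
  Quotient.sound (s := isomSetoid G Y) h

/-- Isomorphism classes form a commutative monoid under the tensor product. -/
instance : CommMonoid (BundleClass G Y) where
  mul := Quotient.map₂ EqBundle.tensor fun _ _ h _ _ h' => isIsom_tensor h h'
  one := (EqBundle.unit G Y).isoClass
  mul_assoc := by
    rintro ⟨E⟩ ⟨F⟩ ⟨K⟩
    exact isoClass_eq (isIsom_assoc E F K)
  mul_comm := by
    rintro ⟨E⟩ ⟨F⟩
    exact isoClass_eq (isIsom_comm E F)
  one_mul := by
    rintro ⟨E⟩
    exact isoClass_eq (isIsom_unit_tensor E)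
  mul_one := by
    rintro ⟨E⟩
    exact isoClass_eq ((isIsom_comm E _).trans (isIsom_unit_tensor E))

lemma isoClass_mul (E F : EqBundle G Y) : E.isoClass * F.isoClass = (E.tensor F).isoClass := rfl

lemma isoClass_one : (1 : BundleClass G Y) = (EqBundle.unit G Y).isoClass := rfl

variable (G Y) in
/-- The relations `[E] = [E'] + [E'']` for all short exact sequences `0 → E' → E → E'' → 0`. -/
def exactRelations : Set (FreeAbelianGroup (BundleClass G Y)) :=
  {x | ∃ E' E E'' : EqBundle G Y, IsShortExact E' E E'' ∧
    x = FreeAbelianGroup.of E.isoClass - FreeAbelianGroup.of E'.isoClass -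
      FreeAbelianGroup.of E''.isoClass}

lemma mul_mem_exactRelations (c : BundleClass G Y) {x : FreeAbelianGroup (BundleClass G Y)}
    (hx : x ∈ exactRelations G Y) : FreeAbelianGroup.of c * x ∈ exactRelations G Y := by
  obtain ⟨F, rfl⟩ : ∃ F : EqBundle G Y, F.isoClass = c := Quotient.exists_rep c
  obtain ⟨E', E, E'', h, rfl⟩ := hx
  refine ⟨_, _, _, h.tensor_left F, ?_⟩
  rw [mul_sub, mul_sub, FreeAbelianGroup.of_mul_of, FreeAbelianGroup.of_mul_of,
    FreeAbelianGroup.of_mul_of]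
  rfl

variable (G Y) in
/-- The additive subgroup generated by the relations of short exact sequences. It is an ideal for
the multiplication given by the tensor product. -/
def exactIdeal : Ideal (FreeAbelianGroup (BundleClass G Y)) where
  __ := AddSubgroup.closure (exactRelations G Y)
  smul_mem' c x hx := by
    change x ∈ AddSubgroup.closure (exactRelations G Y) at hx
    change c * x ∈ AddSubgroup.closure (exactRelations G Y)
    induction c using FreeAbelianGroup.induction_on with
    | zero => simp
    | of c =>
      induction hx using AddSubgroup.closure_induction with
      | mem x hx => exact AddSubgroup.subset_closure (mul_mem_exactRelations c hx)
      | zero => simp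
      | add x y _ _ hx hy => rw [mul_add]; exact add_mem hx hy
      | neg x _ hx => rw [mul_neg]; exact neg_mem hx
    | neg c hc => rw [neg_mul]; exact neg_mem hc
    | add c c' hc hc' => rw [add_mul]; exact add_mem hc hc'

variable (G Y) in
/-- The `G`-equivariant Grothendieck ring `K_G(Y)` of vector bundles: the free abelian group on
equivariant vector bundles modulo short exact sequences, with the tensor product. -/
def KRing : Type 1 := FreeAbelianGroup (BundleClass G Y) ⧸ exactIdeal G Y

instance : CommRing (KRing G Y) :=
  inferInstanceAs (CommRing (FreeAbelianGroup (BundleClass G Y) ⧸ exactIdeal G Y))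

/-- The class `[E]` in `K_G(Y)`. -/
def EqBundle.cl (E : EqBundle G Y) : KRing G Y :=
  Ideal.Quotient.mk (exactIdeal G Y) (FreeAbelianGroup.of E.isoClass)

end bundles

/-! ### Pullback -/

section pullback

variable {H G Y Z : Over Base} [GrpObj H] [GrpObj G] [ModObj H Y] [ModObj G Z]

/-- The morphism `f : Y ⟶ Z` is equivariant along the homomorphism `ρ : H ⟶ G`. -/
def IsEquivariant (ρ : H ⟶ G) (f : Y ⟶ Z) : Prop := (ρ ⊗ₘ f) ≫ γ[G, Z] = γ[H, Y] ≫ f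

variable {ρ : H ⟶ G} {f : Y ⟶ Z}

lemma IsEquivariant.smul (hf : IsEquivariant ρ f) {g : Pt H} {y z : Pt Y} (h : g • y = z) :
    (g ≫ ρ) • (y ≫ f) = z ≫ f := by
  rw [← h, Hom.smul_def, Hom.smul_def, Category.assoc]
  erw [← hf]
  rw [← Category.assoc, lift_map]

/-- The pullback of a frame. -/
def Frame.pull (f : Y ⟶ Z) {E : Pt Z → Type} [∀ z, AddCommGroup (E z)] [∀ z, Module ℂ (E z)]
    (b : Frame Z E) : Frame Y (fun y => E (y ≫ f)) where
  dom := f.left ⁻¹ᵁ b.dom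
  I := b.I
  basis y hy := b.basis (y ≫ f) ((in_comp_iff f y b.dom).2 hy)

lemma EqBundle.entry_congr (E : EqBundle G Z) (b c : Frame Z E.fiber) (i : b.I) (j : c.I)
    {g g' : Pt G} {y y' z z' : Pt Z} (hg : g = g') (hy : y = y') (hz : z = z')
    (h : g • y = z) (h' : g' • y' = z') (yb : In y b.dom) (yb' : In y' b.dom)
    (zc : In z c.dom) (zc' : In z' c.dom) :
    (c.basis z zc).repr (E.act g h (b.basis y yb i)) j =
      (c.basis z' zc').repr (E.act g' h' (b.basis y' yb' i)) j := by
  subst hg hy hz; rfl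

/-- The pullback `f^* E`, with `H` acting through `ρ`. -/
def EqBundle.pull [IsMonHom ρ] (hf : IsEquivariant ρ f) (E : EqBundle G Z) : EqBundle H Y where
  fiber y := E.fiber (y ≫ f)
  atlas := Frame.pull f '' E.atlas
  cover y := by
    obtain ⟨b, hb, hy⟩ := E.cover (y ≫ f)
    exact ⟨_, ⟨b, hb, rfl⟩, (in_comp_iff f y b.dom).1 hy⟩
  transition := by
    rintro _ ⟨b, hb, rfl⟩ _ ⟨c, hc, rfl⟩ i j
    exact (E.transition b hb c hc i j).comp f
  act g _ _ h := E.act (g ≫ ρ) (hf.smul h)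
  act_one y h v := by
    have h1 : (1 : Pt H) ≫ ρ = 1 := MonObj.one_comp ρ
    have aux : ∀ (g : Pt G) (hg : g • (y ≫ f) = y ≫ f), g = 1 → E.act g hg v = v := by
      rintro g hg rfl
      exact E.act_one _ _ _
    exact aux _ _ h1
  act_mul g g' x y z h' h hh v := by
    have h1 : (g * g') ≫ ρ = (g ≫ ρ) * (g' ≫ ρ) := MonObj.mul_comp _ _ ρ
    have aux : ∀ (k : Pt G) (hk : k • (x ≫ f) = z ≫ f), k = (g ≫ ρ) * (g' ≫ ρ) →
        E.act k hk v = E.act (g ≫ ρ) (hf.smul h) (E.act (g' ≫ ρ) (hf.smul h') v) := by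
      rintro k hk rfl
      exact E.act_mul _ _ _ _ _ _
    exact aux _ _ h1
  act_regular := by
    rintro _ ⟨b, hb, rfl⟩ _ ⟨c, hc, rfl⟩ i j
    have h1 := (E.act_regular b hb c hc i j).comp (ρ ⊗ₘ f)
    have e2 : (ρ ⊗ₘ f) ≫ snd G Z = snd H Y ≫ f := by simp
    have e3 : (ρ ⊗ₘ f) ≫ (γ[G, Z] : G ⊗ Z ⟶ Z) = (γ[H, Y] : H ⊗ Y ⟶ Y) ≫ f := hf
    refine (h1.mono (V := (snd H Y).left ⁻¹ᵁ (b.pull f).dom ⊓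
        (γ[H, Y] : H ⊗ Y ⟶ Y).left ⁻¹ᵁ (c.pull f).dom) ?_).congr fun p hp => ?_
    · intro p hp
      have e2' := congrArg (fun q => q.left p) e2
      have e3' := congrArg (fun q => q.left p) e3
      refine ⟨?_, ?_⟩
      · change ((ρ ⊗ₘ f) ≫ snd G Z).left p ∈ b.dom
        rw [e2]; exact hp.1
      · change ((ρ ⊗ₘ f) ≫ (γ[G, Z] : G ⊗ Z ⟶ Z)).left p ∈ c.dom
        rw [e3]; exact hp.2
    · apply EqBundle.entry_congr
      · simp
      · simp
      · rw [Category.assoc, Category.assoc]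
        exact congrArg (p ≫ ·) e3.symm

lemma IsHom.pull [IsMonHom ρ] (hf : IsEquivariant ρ f) {E F : EqBundle G Z}
    {φ : ∀ z, E.fiber z →ₗ[ℂ] F.fiber z} (h : IsHom E F φ) :
    IsHom (E.pull hf) (F.pull hf) (fun y => φ (y ≫ f)) := by
  refine ⟨?_, fun g y z hh v => h.equivariant _ _ _⟩
  rintro _ ⟨b, hb, rfl⟩ _ ⟨c, hc, rfl⟩ i j
  exact (h.regular b hb c hc i j).comp f

lemma isIsom_pull [IsMonHom ρ] (hf : IsEquivariant ρ f) {E F : EqBundle G Z} (h : IsIsom E F) :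
    IsIsom (E.pull hf) (F.pull hf) := by
  obtain ⟨e, h1, h2⟩ := h
  exact ⟨fun y => e (y ≫ f), h1.pull hf, h2.pull hf⟩

lemma IsShortExact.pull [IsMonHom ρ] (hf : IsEquivariant ρ f) {E' E E'' : EqBundle G Z}
    (h : IsShortExact E' E E'') : IsShortExact (E'.pull hf) (E.pull hf) (E''.pull hf) := by
  obtain ⟨a, b, ha, hb, hex⟩ := h
  exact ⟨fun y => a (y ≫ f), fun y => b (y ≫ f), ha.pull hf, hb.pull hf, fun y => hex (y ≫ f)⟩

lemma isIsom_pull_tensor [IsMonHom ρ] (hf : IsEquivariant ρ f) (E F : EqBundle G Z) :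
    IsIsom ((E.tensor F).pull hf) ((E.pull hf).tensor (F.pull hf)) := by
  refine ⟨fun y => LinearEquiv.refl ℂ _, ⟨?_, fun _ _ _ _ _ => rfl⟩,
    ⟨?_, fun _ _ _ _ _ => rfl⟩⟩
  · rintro _ ⟨_, ⟨b, hb, c, hc, rfl⟩, rfl⟩ _ ⟨_, ⟨b', hb', rfl⟩, _, ⟨c', hc', rfl⟩, rfl⟩ i j
    exact ((E.tensor F).transition _ ⟨b, hb, c, hc, rfl⟩ _ ⟨b', hb', c', hc', rfl⟩ i j).comp f
  · rintro _ ⟨_, ⟨b', hb', rfl⟩, _, ⟨c', hc', rfl⟩, rfl⟩ _ ⟨_, ⟨b, hb, c, hc, rfl⟩, rfl⟩ i j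
    exact ((E.tensor F).transition _ ⟨b', hb', c', hc', rfl⟩ _ ⟨b, hb, c, hc, rfl⟩ i j).comp f

lemma isIsom_pull_unit [IsMonHom ρ] (hf : IsEquivariant ρ f) :
    IsIsom ((EqBundle.unit G Z).pull hf) (EqBundle.unit H Y) := by
  refine ⟨fun y => LinearEquiv.refl ℂ _, ⟨?_, fun _ _ _ _ _ => rfl⟩,
    ⟨?_, fun _ _ _ _ _ => rfl⟩⟩
  · rintro _ ⟨_, rfl, rfl⟩ _ rfl i j
    exact (RegularOn.const _ 1).congr fun y hy => (one_entry i j).symm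
  · rintro _ rfl _ ⟨_, rfl, rfl⟩ i j
    exact (RegularOn.const _ 1).congr fun y hy => (one_entry i j).symm

/-- Pullback of isomorphism classes. -/
def pullClass [IsMonHom ρ] (hf : IsEquivariant ρ f) : BundleClass G Z →* BundleClass H Y where
  toFun := Quotient.map (EqBundle.pull hf) fun _ _ h => isIsom_pull hf h
  map_one' := isoClass_eq (isIsom_pull_unit hf)
  map_mul' := by
    rintro ⟨E⟩ ⟨F⟩
    exact isoClass_eq (isIsom_pull_tensor hf E F)

/-- The pullback homomorphism `f^* : K_G(Z) → K_H(Y)`, `[E] ↦ [f^* E]`. -/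
def pullK [IsMonHom ρ] (hf : IsEquivariant ρ f) : KRing G Z →+* KRing H Y :=
  Ideal.quotientMap (exactIdeal H Y)
    (FreeAbelianGroup.liftMonoid (FreeAbelianGroup.ofMulHom.comp (pullClass hf))) (by
      intro x hx
      change x ∈ AddSubgroup.closure (exactRelations G Z) at hx
      change FreeAbelianGroup.liftMonoid _ x ∈ AddSubgroup.closure (exactRelations H Y)
      induction hx using AddSubgroup.closure_induction with
      | mem x hx =>
        obtain ⟨E', E, E'', h, rfl⟩ := hx
        refine AddSubgroup.subset_closure ⟨_, _, _, h.pull hf, ?_⟩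
        simp only [map_sub, FreeAbelianGroup.liftMonoid_coe, FreeAbelianGroup.lift_apply_of]
        rfl
      | zero => rw [map_zero]; exact zero_mem _
      | add x y _ _ hx hy => rw [map_add]; exact add_mem hx hy
      | neg x _ hx => rw [map_neg]; exact neg_mem hx)

lemma pullK_cl [IsMonHom ρ] (hf : IsEquivariant ρ f) (E : EqBundle G Z) :
    pullK hf E.cl = (E.pull hf).cl := by
  simp only [pullK, EqBundle.cl]
  erw [Ideal.quotientMap_mk]

end pullback

/-! ### Representation rings and characters -/

/-- Every group acts trivially on the point `Spec ℂ`. -/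
instance pointAction (G : Over Base) [GrpObj G] : ModObj G (𝟙_ (Over Base)) :=
  ModObj.trivialAction G _

section reps

variable (G Y : Over Base) [GrpObj G] [ModObj G Y]

/-- The representation ring `R(G) = K_G(pt)`. -/
abbrev RepRing : Type 1 := KRing G (𝟙_ (Over Base))

lemma isEquivariant_toUnit : IsEquivariant (𝟙 G) (toUnit Y) := toUnit_unique _ _

/-- The homomorphism `R(G) → K_G(Y)` given by the structure morphism `Y → Spec ℂ`. -/
def structureHom : RepRing G →+* KRing G Y := pullK (isEquivariant_toUnit G Y)

variable {G} in
lemma isEquivariant_point {H : Over Base} [GrpObj H] (ρ : H ⟶ G) :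
    IsEquivariant ρ (𝟙 (𝟙_ (Over Base))) := toUnit_unique _ _

variable {G} in
/-- The homomorphism `R(G) → R(H)` given by a homomorphism `ρ : H ⟶ G`. -/
def resRep {H : Over Base} [GrpObj H] (ρ : H ⟶ G) [IsMonHom ρ] : RepRing G →+* RepRing H :=
  pullK (isEquivariant_point ρ)

/-- The homomorphism `χ : G(ℂ) → ℂˣ` is a regular function. -/
def IsRegularChar {G : Over Base} [GrpObj G] (χ : Pt G →* ℂˣ) : Prop :=
  RegularOn (X := G) ⊤ (fun g _ => (χ g : ℂ))

/-- The character group `X^*(G)`: the homomorphisms `G(ℂ) → ℂˣ` that are regular functions. -/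
def Characters : Subgroup (Pt G →* ℂˣ) where
  carrier := {χ | IsRegularChar χ}
  one_mem' := by
    change IsRegularChar _
    exact (RegularOn.const _ 1).congr fun g _ => by simp
  mul_mem' {χ χ'} h h' := by
    change IsRegularChar _ at h h' ⊢
    exact (RegularOn.mul h h').congr fun g _ => by simp
  inv_mem' {χ} h := by
    change IsRegularChar _ at h ⊢
    refine (RegularOn.comp (GrpObj.inv (X := G)) h).congr fun g _ => ?_
    rw [MonoidHom.inv_apply, ← map_inv, Hom.inv_def]

variable {G}

lemma character_regular (χ : Characters G) :
    RegularOn (X := G) ⊤ (fun g _ => (χ.1 g : ℂ)) := χ.2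

/-- Restriction of characters along a homomorphism `ρ : H ⟶ G`. -/
def Characters.res {H : Over Base} [GrpObj H] (ρ : H ⟶ G) [IsMonHom ρ] :
    Characters G →* Characters H where
  toFun χ := ⟨χ.1.comp (IsMonHom.monoidHom ρ _), (character_regular χ).comp ρ⟩
  map_one' := rfl
  map_mul' _ _ := rfl

/-- The one-dimensional representation of `G` given by the character `χ`. -/
def charBundle (χ : Characters G) : EqBundle G (𝟙_ (Over Base)) where
  fiber _ := ℂ
  atlas := {Frame.one _}
  cover y := ⟨Frame.one _, rfl, In.top y⟩
  transition := (EqBundle.unit G (𝟙_ (Over Base))).transition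
  act g _ _ _ := (χ.1 g : ℂ) • LinearMap.id
  act_one y h v := by simp
  act_mul g g' _ _ _ _ _ _ v := by
    simp only [map_mul, Units.val_mul, mul_smul, LinearMap.smul_apply, LinearMap.id_apply]
  act_regular := by
    rintro _ rfl _ rfl i j
    have h1 := ((character_regular χ).comp (fst G (𝟙_ (Over Base)))).mono
      (V := (snd G (𝟙_ (Over Base))).left ⁻¹ᵁ (Frame.one (𝟙_ (Over Base))).dom ⊓
      (γ[G, 𝟙_ (Over Base)] : G ⊗ 𝟙_ (Over Base) ⟶ 𝟙_ (Over Base)).left ⁻¹ᵁ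
        (Frame.one (𝟙_ (Over Base))).dom) (fun _ _ => trivial)
    exact h1.congr fun y hy => smul_entry i j _

/-- The element `e^χ` of the representation ring. -/
def expChar (χ : Characters G) : RepRing G := (charBundle χ).cl

variable {Y}

/-- The `χ`-isotypic subspace of the fibre `E_y`, for a character `χ` of a group `H` that is
mapped to `G` by `i`: the vectors on which each `t ∈ H` with `i(t) y = y` acts by `χ(t)`. -/
def isotypic {H : Over Base} [GrpObj H] (i : H ⟶ G) (E : EqBundle G Y) (χ : Characters H)
    (y : Pt Y) : Submodule ℂ (E.fiber y) where
  carrier := {v | ∀ (t : Pt H) (h : (t ≫ i) • y = y), E.act (t ≫ i) h v = (χ.1 t : ℂ) • v}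
  zero_mem' t h := by simp
  add_mem' hv hw t h := by rw [map_add, hv t h, hw t h, smul_add]
  smul_mem' a v hv t h := by rw [map_smul, hv t h, smul_comm]

end reps

/-! ### Tori -/

/-- `T` is an algebraic torus: it is isomorphic, as a group scheme over `ℂ`, to `𝔾ₘⁿ`, the spectrum
of the group algebra of `ℤⁿ`. -/
def IsTorus (T : Over Base) [GrpObj T] : Prop :=
  ∃ (n : ℕ) (e : T ≅ (Spec (.of (AddMonoidAlgebra ℂ (Fin n → ℤ)))).asOver Base), IsMonHom e.hom

/-- `1 → H → G → Q → 1` is an exact sequence of algebraic groups: `i` is the kernel of `π`, and `π`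
is surjective. -/
structure IsExactSeq {H G Q : Over Base} [GrpObj H] [GrpObj G] [GrpObj Q]
    (i : H ⟶ G) (π : G ⟶ Q) : Prop where
  kernel : IsPullback i (toUnit H) π η[Q]
  surjective : Surjective π.left

end EquivariantK

end

open EquivariantK

noncomputable section

namespace EquivariantK

/-! ### Complex points of open sets -/

section points

variable {X : Over Base}

/-! Write H for the subtorus and Q for the quotient torus. A splitting s of the restriction of
characters dualises to a product decomposition of T (`IsExactSeq.exists_decomposition`). There is a
retraction r : T → H inducing s and a section σ of π on whose image the characters s(χ) are trivial,
and every point satisfies t = σ(π(t)) i(r(t)). The dictionary between tori and lattices behind this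
rests on two facts: the regular functions on a torus are the combinations of its characters, and
every homomorphism from the character group to `ℂˣ` is evaluation at a point.

H acts trivially on Y, so it acts linearly on each fibre of a T-bundle E. The matrix coefficients
are regular, hence combinations of characters, so each fibre splits into eigenspaces. Two things
make this splitting global. First, the same finite set S of characters serves all fibres: the trace
of a point of finite order is a regular function with finitely many values, so it is locally
constant, so it is constant because Y is irreducible; traces at points of finite order determine the
multiplicities of the characters (`trace_fibAct_eq`, `exists_finset_characters`). Second, linear
independence of characters gives one fixed combination of points of H that acts in every fibre as
the projection onto the χ-eigenspace (`exists_isotypicProj`). These projections are equivariant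
because T is commutative, and an idempotent endomorphism has a vector bundle as its image because it
is locally conjugate to a constant matrix (`IsIdem.exists_frame`).

Projections commute with morphisms, so taking χ-parts is exact and defines an additive map on K_T(Y)
(`exists_isotypicPart`). A bundle on which H acts by χ is the pullback along π of its restriction
along σ, twisted by s(χ) (`isIsom_twist`). Hence the products of π^*a with e^{s(χ)} generate K_T(Y),
and the χ-part followed by σ^* recovers the coefficient a (`exists_coefficient`): K_T(Y) is free
over K_Q(Y) on the elements e^{s(χ)}. Both isomorphisms follow from one algebraic criterion
(`exists_tensor_ringEquiv`), since R(H) is spanned over `ℤ` by the e^χ, and R(T) over R(Q) by the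
e^{s(χ)}, the latter being the generation statement for Y a point. -/

/-- The unique point of `Spec ℂ`. -/
def basePoint : (Base : Scheme.{0}) := IsLocalRing.closedPoint ℂ

lemma eq_basePoint (p : (Base : Scheme.{0})) : p = basePoint :=
  Subsingleton.elim (α := PrimeSpectrum ℂ) _ _

lemma in_iff {x : Pt X} {U : X.left.Opens} : In x U ↔ x.left basePoint ∈ U := by
  constructor
  · intro h
    exact h (show basePoint ∈ (⊤ : Base.Opens) from trivial)
  · intro h p _
    have := eq_basePoint p
    subst this
    exact h

/-- A scheme locally of finite type over a field is Jacobson, so Z contains a closed point of X, and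
over `ℂ` closed points are rational by the Nullstellensatz. All later density arguments for complex
points come from here. -/
lemma exists_pt_of_isLocallyClosed [LocallyOfFiniteType X.hom] {Z : Set X.left}
    (hZ : Z.Nonempty) (hZ' : IsLocallyClosed Z) : ∃ x : Pt X, x.left basePoint ∈ Z := by
  have : JacobsonSpace X.left := LocallyOfFiniteType.jacobsonSpace X.hom
  obtain ⟨p, hp, hc⟩ := nonempty_inter_closedPoints hZ hZ'
  rw [mem_closedPoints_iff] at hc
  refine ⟨Over.homMk (pointOfClosedPoint X.hom p hc) (pointOfClosedPoint_comp X.hom p hc), ?_⟩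
  have := pointOfClosedPoint_apply X.hom p hc basePoint
  rw [← this] at hp
  exact hp

lemma exists_pt [LocallyOfFiniteType X.hom] (U : X.left.Opens) (hU : (U : Set X.left).Nonempty) :
    ∃ x : Pt X, In x U := by
  obtain ⟨x, hx⟩ := exists_pt_of_isLocallyClosed hU U.isOpen.isLocallyClosed
  exact ⟨x, in_iff.2 hx⟩

lemma exists_in_of_in [LocallyOfFiniteType X.hom] [IrreducibleSpace X.left] {x y : Pt X}
    {U V : X.left.Opens} (hx : In x U) (hy : In y V) : ∃ z : Pt X, In z U ∧ In z V := by
  obtain ⟨z, hz⟩ := exists_pt (U ⊓ V) (nonempty_preirreducible_inter U.isOpen V.isOpen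
    ⟨_, in_iff.1 hx⟩ ⟨_, in_iff.1 hy⟩)
  exact ⟨z, hz.left, hz.right⟩

/-- The pullback of f to `Spec ℂ` is an element of a field: it is zero or a unit, and its basic open
set is accordingly empty or everything. -/
lemma in_basicOpen {x : Pt X} {U : X.left.Opens} (h : In x U) (f : Γ(X.left, U)) :
    In x (X.left.basicOpen f) ↔ evalAt x U h f ≠ 0 := by
  have h1 := Scheme.basicOpen_appLE x.left ⊤ U h f
  set s := x.left.appLE U ⊤ h f with hs
  have h2 : evalAt x U h f = (Scheme.ΓSpecIso (.of ℂ)).hom s := rfl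
  rw [h2]
  constructor
  · intro hx h0
    have h3 : s = 0 := (ConcreteCategory.bijective_of_isIso
      (Scheme.ΓSpecIso (.of ℂ)).hom).1 (by rw [h0, map_zero])
    rw [h3, Scheme.basicOpen_zero] at h1
    have : basePoint ∈ (⊥ : Base.Opens) := by
      rw [h1]; exact ⟨trivial, in_iff.1 hx⟩
    exact this
  · intro h0
    have h3 : IsUnit s := by
      have h4 : IsUnit ((Scheme.ΓSpecIso (.of ℂ)).hom s) := IsUnit.mk0 _ h0
      have h5 := h4.map (Scheme.ΓSpecIso (.of ℂ)).inv.hom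
      simpa using h5
    rw [Scheme.basicOpen_of_isUnit _ h3] at h1
    rw [in_iff]
    have : basePoint ∈ (⊤ : Base.Opens) := trivial
    rw [h1] at this
    exact this.2

/-- The constant section of the structure sheaf. -/
def constSection (X : Over Base) (c : ℂ) : Γ(X.left, ⊤) :=
  X.hom.app ⊤ ((Scheme.ΓSpecIso (.of ℂ)).inv c)

lemma evalAt_constSection (x : Pt X) (c : ℂ) :
    evalAt x ⊤ (In.top x) (constSection X c) = c := by
  have h0 : x.left ≫ X.hom = 𝟙 _ := Over.w x
  have h1 := Scheme.Hom.comp_appLE x.left X.hom ⊤ ⊤ le_top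
  rw [constSection, evalAt]
  change ((X.hom.app ⊤ ≫ x.left.appLE _ ⊤ _) ≫ (Scheme.ΓSpecIso (.of ℂ)).hom)
    ((Scheme.ΓSpecIso (.of ℂ)).inv c) = c
  erw [← h1]
  have h2 : ∀ (f : Base ⟶ Base) (_ : f = 𝟙 _) (e), f.appLE ⊤ ⊤ e = 𝟙 _ := by
    rintro _ rfl e
    simp only [Scheme.Hom.appLE, Scheme.Hom.id_app]
    exact Base.presheaf.map_id _
  erw [h2 _ h0]
  rw [Category.id_comp]
  erw [← CommRingCat.comp_apply, Iso.inv_hom_id]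
  rfl

/-- The isotypic projections have complex coefficients, so the integral constants of
`RegularOn.const` do not suffice. -/
lemma RegularOn.constC (U : X.left.Opens) (c : ℂ) : RegularOn U (fun _ _ => c) := by
  intro x hx
  refine ⟨U, le_rfl, hx, X.left.presheaf.map (homOfLE le_top).op (constSection X c), ?_⟩
  intro z hz
  rw [evalAt_res, evalAt_constSection]

lemma RegularOn.sub {U : X.left.Opens} {F F' : ∀ x : Pt X, In x U → ℂ} (h : RegularOn U F)
    (h' : RegularOn U F') : RegularOn U (fun x hx => F x hx - F' x hx) :=
  (h.add ((RegularOn.const U (-1)).mul h')).congr fun x hx => by push_cast; ring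

lemma RegularOn.prod {I : Type} (s : Finset I) {U : X.left.Opens}
    {F : I → ∀ x : Pt X, In x U → ℂ} (h : ∀ i ∈ s, RegularOn U (F i)) :
    RegularOn U (fun x hx => ∏ i ∈ s, F i x hx) := by
  classical
  induction s using Finset.induction_on with
  | empty => simpa using RegularOn.const U 1
  | insert a s ha ih =>
    refine ((h a (Finset.mem_insert_self _ _)).mul
      (ih fun i hi => h i (Finset.mem_insert_of_mem hi))).congr fun x hx => ?_
    rw [Finset.prod_insert ha]

/-- A regular function is invertible, with regular inverse, near each point where it does not
vanish. -/
lemma RegularOn.exists_inv {U : X.left.Opens} {F : ∀ x : Pt X, In x U → ℂ} (h : RegularOn U F)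
    (x : Pt X) (hx : In x U) (h0 : F x hx ≠ 0) :
    ∃ (V : X.left.Opens) (hVU : V ≤ U), In x V ∧ (∀ z (hz : In z V), F z (hz.mono hVU) ≠ 0) ∧
      RegularOn V (fun z hz => (F z (hz.mono hVU))⁻¹) := by
  obtain ⟨W, hWU, hxW, f, hf⟩ := h x hx
  have hVW : X.left.basicOpen f ≤ W := X.left.basicOpen_le f
  have hne : ∀ z (hz : In z (X.left.basicOpen f)), F z ((hz.mono hVW).mono hWU) ≠ 0 := by
    intro z hz
    have := (in_basicOpen (hz.mono hVW) f).1 hz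
    rwa [← hf] at this
  refine ⟨X.left.basicOpen f, hVW.trans hWU, (in_basicOpen hxW f).2 (by rwa [← hf]), hne, ?_⟩
  intro z hz
  obtain ⟨g, hg⟩ := (RingedSpace.isUnit_res_basicOpen X.left.toRingedSpace f).exists_right_inv
  change Γ(X.left, X.left.basicOpen f) at g
  have hg' : X.left.presheaf.map (homOfLE hVW).op f * g = 1 := hg
  refine ⟨X.left.basicOpen f, le_rfl, hz, g, fun w hw => ?_⟩
  have h1 : evalAt w _ hw (X.left.presheaf.map (homOfLE hVW).op f * g) = 1 := by
    rw [hg', map_one]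
  rw [map_mul, evalAt_res, ← hf] at h1
  exact inv_eq_of_mul_eq_one_right h1

/-- A regular function with finitely many values is locally constant. -/
lemma RegularOn.locally_constant {U : X.left.Opens} {F : ∀ x : Pt X, In x U → ℂ}
    (h : RegularOn U F) {S : Set ℂ} (hS : S.Finite) (hF : ∀ x hx, F x hx ∈ S)
    (x : Pt X) (hx : In x U) :
    ∃ (V : X.left.Opens) (hVU : V ≤ U), In x V ∧
      ∀ z (hz : In z V), F z (hz.mono hVU) = F x hx := by
  classical
  -- The product of F - c over the values c other than F(x) does not vanish at x. Where it does not
  -- vanish, F can only take the value F(x).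
  have h1 : RegularOn U (fun z hz => ∏ c ∈ hS.toFinset.erase (F x hx), (F z hz - c)) :=
    RegularOn.prod _ fun c _ => h.sub (RegularOn.constC U c)
  obtain ⟨V, hVU, hxV, hne, -⟩ := h1.exists_inv x hx (by
    rw [Finset.prod_ne_zero_iff]
    intro c hc
    exact sub_ne_zero.2 (Finset.ne_of_mem_erase hc).symm)
  refine ⟨V, hVU, hxV, fun z hz => ?_⟩
  by_contra hzx
  exact hne z hz (Finset.prod_eq_zero (Finset.mem_erase.2
    ⟨hzx, hS.mem_toFinset.2 (hF z (hz.mono hVU))⟩) (sub_self _))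

/-- On a reduced scheme, sections are determined by their values. -/
lemma section_eq_of_evalAt [LocallyOfFiniteType X.hom] [IsReduced X.left] {U : X.left.Opens}
    {f g : Γ(X.left, U)} (h : ∀ (x : Pt X) (hx : In x U), evalAt x U hx f = evalAt x U hx g) :
    f = g := by
  -- On a reduced scheme a section is zero once its basic open set is empty, and a nonempty open set
  -- would contain a complex point where f - g does not vanish.
  rw [← sub_eq_zero, ← basicOpen_eq_bot_iff]
  by_contra hne
  obtain ⟨x, hx⟩ := exists_pt (X.left.basicOpen (f - g))
    (by rwa [← TopologicalSpace.Opens.ne_bot_iff_nonempty])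
  have hU : In x U := hx.mono (X.left.basicOpen_le _)
  rw [in_basicOpen hU, map_sub, h, sub_self] at hx
  exact hx rfl

/-- On a reduced scheme, regular functions are sections of the structure sheaf. -/
lemma RegularOn.exists_section [LocallyOfFiniteType X.hom] [IsReduced X.left] {U : X.left.Opens}
    {F : ∀ x : Pt X, In x U → ℂ} (h : RegularOn U F) :
    ∃ f : Γ(X.left, U), ∀ (x : Pt X) (hx : In x U), F x hx = evalAt x U hx f := by
  choose V hVU hxV f hf using h
  let J := {x : Pt X // In x U}
  let V' : J → X.left.Opens := fun x => V x.1 x.2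
  -- The sets chosen at complex points already cover U: the rest of U is locally closed and has no
  -- complex point.
  have hcov : U ≤ ⨆ x, V' x := by
    intro p hp
    by_contra hpV
    obtain ⟨x, hx⟩ := exists_pt_of_isLocallyClosed (Z := (U : Set X.left) \ ((⨆ x, V' x :
      X.left.Opens) : Set X.left)) ⟨p, hp, hpV⟩
      (U.isOpen.isLocallyClosed.inter (⨆ x, V' x).isOpen.isClosed_compl.isLocallyClosed)
    exact hx.2 (le_iSup V' ⟨x, in_iff.2 hx.1⟩ (in_iff.1 (hxV x (in_iff.2 hx.1))))
  obtain ⟨s, hs, -⟩ := X.left.sheaf.existsUnique_gluing' V' U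
    (fun x => homOfLE (hVU x.1 x.2)) hcov (fun x => f x.1 x.2) (by
      intro x y
      apply section_eq_of_evalAt
      intro z hz
      refine (evalAt_res z (inf_le_left : V' x ⊓ V' y ≤ V' x) hz (f x.1 x.2)).trans ?_
      refine Eq.trans ?_ (evalAt_res z (inf_le_right : V' x ⊓ V' y ≤ V' y) hz (f y.1 y.2)).symm
      rw [← hf x.1 x.2 z hz.left, ← hf y.1 y.2 z hz.right])
  refine ⟨s, fun x hx => ?_⟩
  rw [hf x hx x (hxV x hx), ← evalAt_res x (hVU x hx) (hxV x hx) s]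
  exact congrArg _ (hs ⟨x, hx⟩).symm

end points

/-! ### The standard torus -/

section stdTorus

/-- The group algebra of `ℤⁿ`. -/
abbrev CharAlg (n : ℕ) : Type := AddMonoidAlgebra ℂ (Fin n → ℤ)

/-- The torus `𝔾ₘⁿ`. -/
abbrev stdTorus (n : ℕ) : Over Base := (Spec (.of (CharAlg n))).asOver Base

/-- The two ways to view `Spec ℂ` as a scheme over itself. -/
def unitIso : 𝟙_ (Over Base) ≅ (Spec (.of ℂ)).asOver Base :=
  Over.isoMk (Iso.refl _) (by simp [specOverSpec_over]; rfl)

/-- Points of the standard torus are homomorphisms of algebras. -/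
def ptMulEquiv (n : ℕ) : Pt (stdTorus n) ≃* WithConv (CharAlg n →ₐ[ℂ] ℂ) where
  toFun p := Spec.mapMulEquiv.symm (unitIso.inv ≫ p)
  invFun f := unitIso.hom ≫ Spec.mapMulEquiv f
  left_inv p := by simp
  right_inv f := by simp
  map_mul' p q := by rw [comp_mul, map_mul]

lemma ptMulEquiv_symm_left {n : ℕ} (f : WithConv (CharAlg n →ₐ[ℂ] ℂ)) :
    ((ptMulEquiv n).symm f).left = Spec.map (CommRingCat.ofHom f.ofConv.toRingHom) := by
  change (unitIso.hom ≫ Spec.mapMulEquiv f).left = _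
  rw [Over.comp_left]
  exact Category.id_comp _

lemma evalAt_stdTorus {n : ℕ} (p : Pt (stdTorus n)) (a : CharAlg n) :
    evalAt p ⊤ (In.top p) ((Scheme.ΓSpecIso (.of (CharAlg n))).inv a) =
      (ptMulEquiv n p).ofConv a := by
  obtain ⟨f, rfl⟩ := (ptMulEquiv n).symm.surjective p
  rw [MulEquiv.apply_symm_apply]
  have h2 : ∀ (g : Base ⟶ Spec (.of (CharAlg n)))
      (_ : g = Spec.map (CommRingCat.ofHom f.ofConv.toRingHom)) (e),
      (g.appLE ⊤ ⊤ e ≫ (Scheme.ΓSpecIso (.of ℂ)).hom).hom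
        ((Scheme.ΓSpecIso (.of (CharAlg n))).inv a) = f.ofConv a := by
    rintro _ rfl e
    have h3 := Scheme.ΓSpecIso_naturality (CommRingCat.ofHom f.ofConv.toRingHom)
    have h4 : (Spec.map (CommRingCat.ofHom f.ofConv.toRingHom)).appLE ⊤ ⊤ e =
        (Spec.map (CommRingCat.ofHom f.ofConv.toRingHom)).appTop := by
      rw [Scheme.Hom.appTop, Scheme.Hom.app_eq_appLE]
      rfl
    rw [h4, h3]
    simp
  exact h2 _ (ptMulEquiv_symm_left f) _

/-- Points of the standard torus are characters of the lattice `ℤⁿ`. -/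
def stdPt (n : ℕ) : Pt (stdTorus n) ≃* (Multiplicative (Fin n → ℤ) →* ℂˣ) where
  toFun p := ((AddMonoidAlgebra.lift ℂ ℂ (Fin n → ℤ)).symm (ptMulEquiv n p).ofConv).toHomUnits
  invFun c := (ptMulEquiv n).symm
    (.toConv (AddMonoidAlgebra.lift ℂ ℂ (Fin n → ℤ) ((Units.coeHom ℂ).comp c)))
  left_inv p := by
    rw [MulEquiv.symm_apply_eq]
    apply WithConv.ofConv_injective
    rw [WithConv.ofConv_toConv, ← Equiv.eq_symm_apply]
    rfl
  right_inv c := by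
    ext m
    simp
  map_mul' p q := by
    ext m
    rw [map_mul]
    simp [AlgHom.convMul_apply]

lemma coe_stdPt {n : ℕ} (p : Pt (stdTorus n)) (m : Multiplicative (Fin n → ℤ)) :
    (stdPt n p m : ℂ) = (ptMulEquiv n p).ofConv (AddMonoidAlgebra.single m.toAdd 1) := by
  simp [stdPt]

lemma regularOn_stdPt {n : ℕ} (m : Multiplicative (Fin n → ℤ)) :
    RegularOn (X := stdTorus n) ⊤ (fun p _ => (stdPt n p m : ℂ)) := by
  intro p hp
  refine ⟨⊤, le_rfl, hp, (Scheme.ΓSpecIso (.of (CharAlg n))).inv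
    (AddMonoidAlgebra.single m.toAdd 1), fun z hz => ?_⟩
  refine (coe_stdPt z m).trans ?_
  exact (evalAt_stdTorus z _).symm

instance isIntegral_stdTorus (n : ℕ) : IsIntegral (stdTorus n).left :=
  inferInstanceAs (IsIntegral (Spec (.of (CharAlg n))))

instance locallyOfFiniteType_stdTorus (n : ℕ) : LocallyOfFiniteType (stdTorus n).hom :=
  inferInstanceAs (LocallyOfFiniteType (Spec (.of (CharAlg n)) ↘ Base))

instance isAffineHom_stdTorus (n : ℕ) : IsAffineHom (stdTorus n).hom :=
  inferInstanceAs (IsAffineHom (Spec.map (CommRingCat.ofHom (algebraMap ℂ (CharAlg n)))))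

/-- The torus is reduced, so F is a global section, that is, an element of the group algebra; its
monomials evaluate to the coordinates of the point. -/
lemma RegularOn.exists_stdPt {n : ℕ} {F : ∀ p : Pt (stdTorus n), In p ⊤ → ℂ}
    (h : RegularOn ⊤ F) : ∃ a : (Multiplicative (Fin n → ℤ)) →₀ ℂ,
      ∀ p, F p (In.top p) = a.sum fun m c => c * stdPt n p m := by
  obtain ⟨f, hf⟩ := h.exists_section
  obtain ⟨a, rfl⟩ : ∃ a, (Scheme.ΓSpecIso (.of (CharAlg n))).inv a = f :=
    (ConcreteCategory.bijective_of_isIso (Scheme.ΓSpecIso (.of (CharAlg n))).inv).2 f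
  change CharAlg n at a
  have key : ∀ a : CharAlg n, ∃ b : (Multiplicative (Fin n → ℤ)) →₀ ℂ, ∀ p,
      (ptMulEquiv n p).ofConv a = b.sum fun m c => c * stdPt n p m := by
    intro a
    induction a using AddMonoidAlgebra.induction_linear with
    | zero => exact ⟨0, fun p => by simp⟩
    | add a a' h h' =>
      obtain ⟨b, hb⟩ := h
      obtain ⟨b', hb'⟩ := h'
      refine ⟨b + b', fun p => ?_⟩
      rw [map_add, hb, hb', Finsupp.sum_add_index' (by simp) (by intros; ring)]
    | single m c =>
      refine ⟨Finsupp.single (Multiplicative.ofAdd m) c, fun p => ?_⟩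
      rw [Finsupp.sum_single_index (by simp), coe_stdPt, toAdd_ofAdd, ← smul_eq_mul c, ← map_smul]
      simp
  obtain ⟨b, hb⟩ := key a
  exact ⟨b, fun p => by rw [hf p (In.top p), ← hb, ← evalAt_stdTorus]⟩

/-- The homomorphism of tori given by a homomorphism of lattices. -/
lemma exists_stdTorus_hom {n n' : ℕ} (ψ : (Fin n' → ℤ) →+ (Fin n → ℤ)) :
    ∃ f : stdTorus n ⟶ stdTorus n', IsMonHom f ∧
      ∀ p m, stdPt n' (p ≫ f) m = stdPt n p (AddMonoidHom.toMultiplicative ψ m) := by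
  let φ := AddMonoidAlgebra.mapDomainBialgHom ℂ ψ
  obtain ⟨g, hg, hl⟩ : ∃ g : stdTorus n ⟶ stdTorus n', IsMonHom g ∧
      g.left = Spec.map (CommRingCat.ofHom (φ : CharAlg n' →ₐ[ℂ] CharAlg n).toRingHom) :=
    ⟨((bialgSpec (.of ℂ)).map (.op (CommBialgCat.ofHom φ))).hom,
      ((bialgSpec (.of ℂ)).map (.op (CommBialgCat.ofHom φ))).isMonHom_hom, rfl⟩
  refine ⟨g, hg, fun p m => ?_⟩
  obtain ⟨f, rfl⟩ := (ptMulEquiv n).symm.surjective p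
  have h1 : (ptMulEquiv n).symm f ≫ g =
      (ptMulEquiv n').symm (.toConv (f.ofConv.comp (φ : CharAlg n' →ₐ[ℂ] CharAlg n))) := by
    apply Over.OverMorphism.ext
    rw [Over.comp_left, ptMulEquiv_symm_left, ptMulEquiv_symm_left, hl]
    exact (Spec.map_comp (CommRingCat.ofHom (φ : CharAlg n' →ₐ[ℂ] CharAlg n).toRingHom)
      (CommRingCat.ofHom f.ofConv.toRingHom)).symm
  apply Units.ext
  rw [h1, coe_stdPt, coe_stdPt, MulEquiv.apply_symm_apply, MulEquiv.apply_symm_apply]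
  simp [φ]

end stdTorus

/-! ### Characters of tori -/

section torus

/-- A nontrivial element of the lattice is detected by a character of finite order. -/
lemma exists_torsion_hom {n : ℕ} {m : Multiplicative (Fin n → ℤ)} (hm : m ≠ 1) :
    ∃ c : Multiplicative (Fin n → ℤ) →* ℂˣ, (∃ N : ℕ, 0 < N ∧ c ^ N = 1) ∧ c m ≠ 1 := by
  obtain ⟨j, hj⟩ : ∃ j, m.toAdd j ≠ 0 := by
    by_contra! h
    exact hm (Multiplicative.toAdd.injective (funext h))
  -- The coordinate m_j is nonzero and smaller in absolute value than N, so N does not divide it and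
  -- a primitive N-th root of unity raised to m_j is not 1.
  set N := (m.toAdd j).natAbs + 1 with hN
  have hN0 : N ≠ 0 := Nat.succ_ne_zero _
  have hζ := Complex.isPrimitiveRoot_exp N hN0
  set ζ : ℂˣ := (hζ.isUnit hN0).unit with hζu
  have hζ' : IsPrimitiveRoot ζ N := hζ.isUnit_unit hN0
  refine ⟨(zpowersHom ℂˣ ζ).comp (AddMonoidHom.toMultiplicative
    (Pi.evalAddMonoidHom (fun _ : Fin n => ℤ) j)), ⟨N, Nat.pos_of_ne_zero hN0, ?_⟩, ?_⟩
  · refine MonoidHom.ext fun x => ?_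
    simp only [MonoidHom.pow_apply, MonoidHom.comp_apply, zpowersHom_apply, ← zpow_natCast,
      ← zpow_mul]
    rw [mul_comm, zpow_mul, zpow_natCast, hζ'.pow_eq_one, one_zpow]
    rfl
  · simp only [MonoidHom.comp_apply, zpowersHom_apply]
    change ζ ^ (m.toAdd j) ≠ 1
    rw [Ne, hζ'.zpow_eq_one_iff_dvd]
    intro h
    have := Int.le_of_dvd (by positivity) (h.trans (self_dvd_abs _))
    rw [hN, Int.abs_eq_natAbs] at this
    omega

variable {T : Over Base} [GrpObj T]

lemma coe_char_injective {χ ψ : Characters T} (h : ∀ t, (χ.1 t : ℂ) = ψ.1 t) : χ = ψ :=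
  Subtype.ext (MonoidHom.ext fun t => Units.ext (h t))

/-- Distinct characters are linearly independent as functions. -/
lemma linearIndependent_characters (T : Over Base) [GrpObj T] :
    LinearIndependent ℂ (fun (χ : Characters T) (t : Pt T) => (χ.1 t : ℂ)) :=
  (linearIndependent_monoidHom (Pt T) ℂ).comp
    (fun χ : Characters T => (Units.coeHom ℂ).comp χ.1)
    (fun _ _ h => coe_char_injective fun t => DFunLike.congr_fun h t)

lemma exists_ptEquiv {n : ℕ} (e : T ≅ stdTorus n) [IsMonHom e.hom] :
    ∃ θ : Pt T ≃* (Multiplicative (Fin n → ℤ) →* ℂˣ), ∀ p, θ p = stdPt n (p ≫ e.hom) :=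
  ⟨MulEquiv.trans
    { toFun p := p ≫ e.hom
      invFun p := p ≫ e.inv
      left_inv p := by simp
      right_inv p := by simp
      map_mul' p q := MonObj.mul_comp p q e.hom } (stdPt n), fun _ => rfl⟩

lemma RegularOn.exists_coord {X : Over Base} {n : ℕ} (e : X ≅ stdTorus n)
    {F : ∀ p : Pt X, In p ⊤ → ℂ}
    (hF : RegularOn ⊤ F) : ∃ a : (Multiplicative (Fin n → ℤ)) →₀ ℂ,
      ∀ p, F p (In.top p) = a.sum fun m c => c * stdPt n (p ≫ e.hom) m := by
  obtain ⟨a, ha⟩ := (hF.comp e.inv).exists_stdPt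
  refine ⟨a, fun p => ?_⟩
  have := ha (p ≫ e.hom)
  simp only [Category.assoc, Iso.hom_inv_id, Category.comp_id] at this
  exact this

/-- The characters of a torus are the monomials in the coordinates. -/
lemma exists_charEquiv {n : ℕ} (e : T ≅ stdTorus n) [IsMonHom e.hom] :
    ∃ κ : Multiplicative (Fin n → ℤ) ≃* Characters T,
      ∀ m p, (κ m).1 p = stdPt n (p ≫ e.hom) m := by
  obtain ⟨θ, hθ⟩ := exists_ptEquiv e
  have hreg : ∀ m, RegularOn (X := T) ⊤ (fun p _ => (θ p m : ℂ)) := by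
    intro m
    simp only [hθ]
    exact (regularOn_stdPt m).comp e.hom
  let κ : Multiplicative (Fin n → ℤ) →* Characters T :=
    { toFun m := ⟨(MonoidHom.eval m).comp θ.toMonoidHom, by exact hreg m⟩
      map_one' := by ext p; simp
      map_mul' m m' := by ext p; simp }
  have hκ : ∀ m p, (κ m).1 p = θ p m := fun m p => rfl
  have hinj : Function.Injective κ := by
    rw [injective_iff_map_eq_one]
    intro m hm
    by_contra hm1
    obtain ⟨c, -, hc⟩ := exists_torsion_hom hm1
    apply hc
    rw [← θ.apply_symm_apply c, ← hκ, hm]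
    rfl
  have hsurj : Function.Surjective κ := by
    intro χ
    obtain ⟨a, ha⟩ := (character_regular χ).exists_coord e
    -- The character χ is a regular function, hence a combination of monomials, which are themselves
    -- characters. By linear independence χ has to be one of them.
    have h1 : Finsupp.linearCombination ℂ (fun (χ : Characters T) (t : Pt T) => (χ.1 t : ℂ))
        (Finsupp.single χ 1) =
        Finsupp.linearCombination ℂ (fun (χ : Characters T) (t : Pt T) => (χ.1 t : ℂ))
        (a.mapDomain κ) := by
      ext t
      rw [Finsupp.linearCombination_single, Finsupp.linearCombination_mapDomain,
        Finsupp.linearCombination_apply, Finsupp.sum, Finset.sum_apply, one_smul, ha t]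
      simp only [← hθ]
      rfl
    have h2 := linearIndependent_characters T h1
    have h3 : χ ∈ (a.mapDomain κ).support := by rw [← h2]; simp
    classical
    obtain ⟨m, -, hm⟩ := Finset.mem_image.1 (Finsupp.mapDomain_support h3)
    exact ⟨m, hm⟩
  refine ⟨MulEquiv.ofBijective κ ⟨hinj, hsurj⟩, fun m p => ?_⟩
  rw [← hθ]
  rfl

/-- The character group of a torus is free abelian of finite rank. -/
lemma IsTorus.exists_lattice (hT : IsTorus T) :
    ∃ n : ℕ, Nonempty (Multiplicative (Fin n → ℤ) ≃* Characters T) := by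
  obtain ⟨n, e, he⟩ := hT
  change T ≅ stdTorus n at e
  change IsMonHom e.hom at he
  obtain ⟨κ, -⟩ := exists_charEquiv e
  exact ⟨n, ⟨κ⟩⟩

/-- Every homomorphism from the character group to `ℂˣ` is the evaluation at a point. -/
lemma IsTorus.exists_pt_eval (hT : IsTorus T) (c : Characters T →* ℂˣ) :
    ∃ t : Pt T, ∀ χ : Characters T, χ.1 t = c χ := by
  obtain ⟨n, e, he⟩ := hT
  change T ≅ stdTorus n at e
  change IsMonHom e.hom at he
  obtain ⟨κ, hκ⟩ := exists_charEquiv e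
  obtain ⟨θ, hθ⟩ := exists_ptEquiv e
  refine ⟨θ.symm (c.comp κ), fun χ => ?_⟩
  obtain ⟨m, rfl⟩ := κ.surjective χ
  rw [hκ, ← hθ, θ.apply_symm_apply]
  rfl

/-- The characters of a torus separate its points. -/
lemma IsTorus.pt_ext (hT : IsTorus T) {t t' : Pt T} (h : ∀ χ : Characters T, χ.1 t = χ.1 t') :
    t = t' := by
  obtain ⟨n, e, he⟩ := hT
  change T ≅ stdTorus n at e
  change IsMonHom e.hom at he
  obtain ⟨κ, hκ⟩ := exists_charEquiv e
  obtain ⟨θ, hθ⟩ := exists_ptEquiv e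
  apply θ.injective
  refine MonoidHom.ext fun m => ?_
  rw [hθ, hθ, ← hκ, ← hκ, h]

/-- The characters of a torus span the space of regular functions. -/
lemma IsTorus.exists_sum_characters (hT : IsTorus T) {F : ∀ p : Pt T, In p ⊤ → ℂ}
    (hF : RegularOn ⊤ F) :
    ∃ a : Characters T →₀ ℂ, ∀ p, F p (In.top p) = a.sum fun χ c => c * χ.1 p := by
  obtain ⟨n, e, he⟩ := hT
  change T ≅ stdTorus n at e
  change IsMonHom e.hom at he
  obtain ⟨κ, hκ⟩ := exists_charEquiv e
  obtain ⟨a, ha⟩ := hF.exists_coord e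
  refine ⟨a.mapDomain κ, fun p => ?_⟩
  rw [Finsupp.sum_mapDomain_index (by simp) (by intros; ring), ha p]
  simp only [hκ]

/-- A nontrivial character of a torus is nontrivial at some point of finite order. -/
lemma IsTorus.exists_torsion (hT : IsTorus T) {χ : Characters T} (hχ : χ ≠ 1) :
    ∃ t : Pt T, (∃ N : ℕ, 0 < N ∧ t ^ N = 1) ∧ χ.1 t ≠ 1 := by
  obtain ⟨n, ⟨κ⟩⟩ := hT.exists_lattice
  obtain ⟨c, ⟨N, hN, hcN⟩, hc⟩ := exists_torsion_hom (m := κ.symm χ) (by simpa using hχ)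
  obtain ⟨t, ht⟩ := hT.exists_pt_eval (c.comp κ.symm.toMonoidHom)
  refine ⟨t, ⟨N, hN, hT.pt_ext fun ψ => ?_⟩, by rw [ht]; exact hc⟩
  rw [map_pow, ht, map_one, ← MonoidHom.pow_apply]
  change (c ^ N) _ = 1
  rw [hcN]
  rfl

/-- Every homomorphism of character groups of tori is given by a homomorphism of tori. -/
lemma IsTorus.exists_hom {T' : Over Base} [GrpObj T'] (hT : IsTorus T) (hT' : IsTorus T')
    (φ : Characters T' →* Characters T) :
    ∃ (f : T ⟶ T') (_ : IsMonHom f), ∀ χ, Characters.res f χ = φ χ := by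
  obtain ⟨n, e, he⟩ := hT
  obtain ⟨n', e', he'⟩ := hT'
  change T ≅ stdTorus n at e
  change IsMonHom e.hom at he
  change T' ≅ stdTorus n' at e'
  change IsMonHom e'.hom at he'
  obtain ⟨κ, hκ⟩ := exists_charEquiv e
  obtain ⟨κ', hκ'⟩ := exists_charEquiv e'
  obtain ⟨g, hg, hgm⟩ := exists_stdTorus_hom (AddMonoidHom.toMultiplicative.symm
    ((κ.symm.toMonoidHom.comp φ).comp κ'.toMonoidHom))
  refine ⟨e.hom ≫ g ≫ e'.inv, inferInstance, fun χ => Subtype.ext (MonoidHom.ext fun p => ?_)⟩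
  obtain ⟨m, rfl⟩ := κ'.surjective χ
  change (κ' m).1 (p ≫ e.hom ≫ g ≫ e'.inv) = _
  rw [hκ']
  simp only [Category.assoc, Iso.inv_hom_id, Category.comp_id]
  rw [← Category.assoc, hgm, ← hκ]
  simp

lemma IsTorus.isIntegral (hT : IsTorus T) : IsIntegral T.left := by
  obtain ⟨n, e, -⟩ := hT
  have : IsIso e.inv.left := inferInstanceAs (IsIso ((Over.forget Base).map e.inv))
  have : IsIso e.hom.left := inferInstanceAs (IsIso ((Over.forget Base).map e.hom))
  have h := isIntegral_stdTorus n
  have : Nonempty T.left := ⟨e.inv.left (Classical.choice inferInstance)⟩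
  exact isIntegral_of_isOpenImmersion e.hom.left

lemma IsTorus.isAffineHom (hT : IsTorus T) : IsAffineHom T.hom := by
  obtain ⟨n, e, -⟩ := hT
  have : IsIso e.hom.left := inferInstanceAs (IsIso ((Over.forget Base).map e.hom))
  have h := isAffineHom_stdTorus n
  rw [← Over.w e.hom]
  infer_instance

lemma IsTorus.locallyOfFiniteType (hT : IsTorus T) : LocallyOfFiniteType T.hom := by
  obtain ⟨n, e, -⟩ := hT
  have : IsIso e.hom.left := inferInstanceAs (IsIso ((Over.forget Base).map e.hom))
  have h := locallyOfFiniteType_stdTorus n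
  rw [← Over.w e.hom]
  infer_instance

/-- Morphisms of tori are determined by their values at the complex points. -/
lemma IsTorus.hom_ext {T' : Over Base} [GrpObj T'] (hT : IsTorus T) (hT' : IsTorus T')
    {f g : T ⟶ T'} (h : ∀ t : Pt T, t ≫ f = t ≫ g) : f = g := by
  have := hT.isIntegral
  have := hT.locallyOfFiniteType
  have := hT'.isAffineHom
  have := hT'.locallyOfFiniteType
  apply Over.OverMorphism.ext
  have hw : f.left ≫ T'.hom = T.hom := Over.w f
  have : LocallyOfFiniteType (f.left ≫ T'.hom) := by rwa [hw]
  refine ext_of_apply_eq T'.hom Set.univ isOpen_univ.isLocallyClosed dense_univ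
    (fun x _ hx => ?_) (hw.trans (Over.w g).symm)
  obtain ⟨t, ht⟩ := exists_pt_of_isLocallyClosed (X := T) (Z := {x}) (Set.singleton_nonempty x)
    hx.isLocallyClosed
  obtain rfl : t.left basePoint = x := ht
  have := congrArg (fun u : Pt T' => u.left basePoint) (h t)
  simpa using this

end torus

/-! ### Exact sequences of tori -/

/-- Characters with values in `ℂˣ` separate the elements of an abelian group. -/
lemma exists_hom_units_ne_one {A : Type} [CommGroup A] {a : A} (ha : a ≠ 1) :
    ∃ c : A →* ℂˣ, c a ≠ 1 := by
  -- Characters with values in `ℚ/ℤ` separate elements because `ℚ/ℤ` is an injective cogenerator; q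
  -- ↦ exp(2πiq) then embeds `ℚ/ℤ` into `ℂˣ`.
  obtain ⟨c, hc⟩ := CharacterModule.exists_character_apply_ne_zero_of_ne_zero
    (A := Additive A) (a := Additive.ofMul a) (by simpa using ha)
  have hper : ∀ q : ℚ, Complex.exp (2 * Real.pi * Complex.I * q) = 1 ↔ ∃ n : ℤ, q = n := by
    intro q
    rw [Complex.exp_eq_one_iff]
    refine exists_congr fun n => ?_
    rw [mul_comm (n : ℂ), mul_right_inj' Complex.two_pi_I_ne_zero]
    exact_mod_cast Iff.rfl
  let f : ℚ →+ Additive ℂˣ :=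
    { toFun q := Additive.ofMul (Units.mk0 (Complex.exp (2 * Real.pi * Complex.I * q))
        (Complex.exp_ne_zero _))
      map_zero' := by
        apply Additive.toMul.injective
        ext; simp
      map_add' p q := by
        apply Additive.toMul.injective
        ext; simp [mul_add, Complex.exp_add] }
  have hf : ∀ q, f q = 0 ↔ ∃ n : ℤ, q = n := by
    intro q
    rw [← hper]
    constructor
    · intro h
      exact congrArg (fun x : Additive ℂˣ => ((x.toMul : ℂˣ) : ℂ)) h
    · intro h
      apply Additive.toMul.injective
      exact Units.ext h
  let F : AddCircle (1 : ℚ) →+ Additive ℂˣ := QuotientAddGroup.lift _ f (by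
    rintro _ ⟨n, rfl⟩
    exact (hf _).2 ⟨n, by simp⟩)
  refine ⟨AddMonoidHom.toMultiplicativeLeft (F.comp c), fun h => hc ?_⟩
  obtain ⟨q, hq⟩ := QuotientAddGroup.mk_surjective (c (Additive.ofMul a))
  have h1 : F (c (Additive.ofMul a)) = 0 := h
  rw [← hq] at h1 ⊢
  obtain ⟨n, rfl⟩ := (hf q).1 h1
  exact (QuotientAddGroup.eq_zero_iff _).2 ⟨n, by simp⟩

section exact

variable {H T Q : Over Base} [GrpObj H] [GrpObj T] [GrpObj Q]
  {i : H ⟶ T} {π : T ⟶ Q}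

lemma res_apply {G K : Over Base} [GrpObj G] [GrpObj K] (ρ : G ⟶ K) [IsMonHom ρ]
    (χ : Characters K) (g : Pt G) : (Characters.res ρ χ).1 g = χ.1 (g ≫ ρ) := rfl

lemma IsExactSeq.comp_eq_one (hex : IsExactSeq i π) (h : Pt H) : h ≫ i ≫ π = 1 := by
  rw [hex.kernel.w, ← Category.assoc, toUnit_unique (h ≫ toUnit H) (toUnit _)]
  rfl

lemma IsExactSeq.exists_of_eq_one (hex : IsExactSeq i π) {t : Pt T} (ht : t ≫ π = 1) :
    ∃ h : Pt H, h ≫ i = t :=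
  ⟨hex.kernel.lift t (𝟙 _) (by
    rw [ht, Hom.one_def]
    congr 1), hex.kernel.lift_fst _ _ _⟩

lemma IsExactSeq.pt_injective (hex : IsExactSeq i π) {h h' : Pt H} (e : h ≫ i = h' ≫ i) :
    h = h' :=
  hex.kernel.hom_ext e (toUnit_unique _ _)

/-- By duality: a nontrivial `ℂˣ`-valued homomorphism on the cokernel is evaluation at a point h of
H at which all restricted characters of T are trivial. Then i(h) = 1, so h = 1 by injectivity of i
on points, a contradiction. -/
lemma IsExactSeq.res_surjective [IsMonHom i] (hex : IsExactSeq i π) (hH : IsTorus H)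
    (hT : IsTorus T) :
    Function.Surjective (Characters.res i) := by
  rw [← MonoidHom.range_eq_top]
  by_contra hne
  obtain ⟨χ, hχ⟩ : ∃ χ, χ ∉ (Characters.res i).range := by
    by_contra! h
    exact hne (eq_top_iff.2 fun x _ => h x)
  obtain ⟨c, hc⟩ := exists_hom_units_ne_one
    (a := (QuotientGroup.mk χ : Characters H ⧸ (Characters.res i).range))
    (by rwa [Ne, QuotientGroup.eq_one_iff])
  obtain ⟨h, hh⟩ := hH.exists_pt_eval (c.comp (QuotientGroup.mk' _))
  have h1 : h = 1 := by
    apply hex.pt_injective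
    apply hT.pt_ext
    intro ψ
    rw [← res_apply, ← res_apply, map_one, hh]
    have : (QuotientGroup.mk (Characters.res i ψ) : Characters H ⧸ (Characters.res i).range) = 1 :=
      (QuotientGroup.eq_one_iff _).2 ⟨ψ, rfl⟩
    change c (QuotientGroup.mk (Characters.res i ψ)) = 1
    rw [this, map_one]
  apply hc
  have := hh χ
  rw [h1, map_one] at this
  exact this.symm

/-- If ψ differs from 1 at q, it differs from 1 on a neighbourhood V of q. Surjectivity of π as a
morphism of schemes makes the preimage of V nonempty, so it contains a complex point; it is not
necessary to lift q itself. -/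
lemma IsExactSeq.res_injective [IsMonHom π] (hex : IsExactSeq i π) (hT : IsTorus T) :
    Function.Injective (Characters.res π) := by
  rw [injective_iff_map_eq_one]
  intro ψ hψ
  refine coe_char_injective fun q => ?_
  by_contra hq
  have hreg : RegularOn (X := Q) ⊤ (fun q _ => (ψ.1 q : ℂ) - 1) :=
    (character_regular ψ).sub (RegularOn.constC ⊤ 1)
  obtain ⟨V, -, hqV, hne, -⟩ := hreg.exists_inv q (In.top q) (sub_ne_zero.2 hq)
  have := hT.locallyOfFiniteType
  have := hex.surjective
  obtain ⟨x, hx⟩ := π.left.surjective (q.left basePoint)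
  obtain ⟨t, ht⟩ := exists_pt (π.left ⁻¹ᵁ V) ⟨x, by
    change π.left x ∈ V
    rw [hx]
    exact in_iff.1 hqV⟩
  refine hne (t ≫ π) ((in_comp_iff π t V).2 ht) ?_
  rw [sub_eq_zero, ← res_apply, hψ]
  rfl

/-- The same duality, at the middle term. A point t of T separating χ from the characters of Q maps
to 1 in Q, so it comes from H, where χ is trivial. -/
lemma IsExactSeq.mem_range_res [IsMonHom i] [IsMonHom π] (hex : IsExactSeq i π)
    (hT : IsTorus T) (hQ : IsTorus Q)
    {χ : Characters T} (hχ : Characters.res i χ = 1) : χ ∈ (Characters.res π).range := by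
  by_contra hne
  obtain ⟨c, hc⟩ := exists_hom_units_ne_one
    (a := (QuotientGroup.mk χ : Characters T ⧸ (Characters.res π).range))
    (by rwa [Ne, QuotientGroup.eq_one_iff])
  obtain ⟨t, ht⟩ := hT.exists_pt_eval (c.comp (QuotientGroup.mk' _))
  have h1 : t ≫ π = 1 := by
    apply hQ.pt_ext
    intro ψ
    rw [← res_apply, map_one, ht]
    have : (QuotientGroup.mk (Characters.res π ψ) : Characters T ⧸ (Characters.res π).range) = 1 :=
      (QuotientGroup.eq_one_iff _).2 ⟨ψ, rfl⟩
    change c (QuotientGroup.mk (Characters.res π ψ)) = 1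
    rw [this, map_one]
  obtain ⟨h, rfl⟩ := hex.exists_of_eq_one h1
  apply hc
  have := ht χ
  rw [← res_apply, hχ] at this
  exact this.symm

/-- The character group of H is free, hence projective, and restriction to it is surjective. -/
lemma IsExactSeq.exists_splitting [IsMonHom i] (hex : IsExactSeq i π) (hH : IsTorus H)
    (hT : IsTorus T) :
    ∃ s : Characters H →* Characters T, ∀ χ, Characters.res i (s χ) = χ := by
  obtain ⟨n, ⟨κ⟩⟩ := hH.exists_lattice
  have : Module.Free ℤ (Additive (Characters H)) :=
    Module.Free.of_equiv (MulEquiv.toAdditive κ : (Fin n → ℤ) ≃+ _).toIntLinearEquiv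
  obtain ⟨s, hs⟩ := Module.projective_lifting_property
    (MonoidHom.toAdditive (Characters.res i)).toIntLinearMap
    (LinearMap.id (R := ℤ) (M := Additive (Characters H))) (hex.res_surjective hH hT)
  exact ⟨MonoidHom.toAdditive.symm s.toAddMonoidHom, fun χ => LinearMap.congr_fun hs χ⟩

/-- A splitting of the restriction of characters comes from a decomposition `T ≅ H × Q`: there are
homomorphisms `r : T ⟶ H` and `σ : Q ⟶ T` of tori such that `r` induces the splitting, `σ` is a
section of `π` whose image is the kernel of `r`, and `t = σ(π(t)) i(r(t))`. -/
theorem IsExactSeq.exists_decomposition [IsMonHom i] [IsMonHom π] (hex : IsExactSeq i π)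
    (hH : IsTorus H) (hT : IsTorus T) (hQ : IsTorus Q) (s : Characters H →* Characters T)
    (hs : ∀ χ, Characters.res i (s χ) = χ) :
    ∃ (r : T ⟶ H) (_ : IsMonHom r) (σ : Q ⟶ T) (_ : IsMonHom σ),
      (∀ χ, Characters.res r χ = s χ) ∧ σ ≫ π = 𝟙 Q ∧ (∀ χ, Characters.res σ (s χ) = 1) ∧
      ∀ t : Pt T, (t ≫ π ≫ σ) * (t ≫ r ≫ i) = t := by
  have hπi : ∀ ψ, Characters.res i (Characters.res π ψ) = 1 := by
    intro ψ
    refine coe_char_injective fun h => ?_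
    rw [res_apply, res_apply, Category.assoc, hex.comp_eq_one, map_one]
    rfl
  have hinj := hex.res_injective hT
  -- The complementary projection to s ∘ i^*. It takes values in the characters trivial on H, that
  -- is, in the characters of Q, and the resulting map ρ to the characters of Q is the one that σ
  -- has to induce.
  let δ : Characters T →* Characters T :=
    { toFun χ := χ * (s (Characters.res i χ))⁻¹
      map_one' := by simp
      map_mul' χ χ' := by
        rw [map_mul, map_mul, mul_inv]
        exact mul_mul_mul_comm _ _ _ _ }
  have hδ : ∀ χ, δ χ ∈ (Characters.res π).range := by
    intro χ
    apply hex.mem_range_res hT hQ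
    change Characters.res i (χ * (s (Characters.res i χ))⁻¹) = 1
    rw [map_mul, map_inv, hs, mul_inv_cancel]
  let ρ : Characters T →* Characters Q :=
    (MonoidHom.ofInjective hinj).symm.toMonoidHom.comp (δ.codRestrict _ hδ)
  have hρ : ∀ χ, Characters.res π (ρ χ) = χ * (s (Characters.res i χ))⁻¹ := fun χ =>
    congrArg Subtype.val ((MonoidHom.ofInjective hinj).apply_symm_apply (δ.codRestrict _ hδ χ))
  obtain ⟨r, hr, hrs⟩ := hT.exists_hom hH s
  obtain ⟨σ, hσ, hσρ⟩ := hQ.exists_hom hT ρ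
  refine ⟨r, hr, σ, hσ, hrs, ?_, fun χ => ?_, fun t => ?_⟩
  · refine hQ.hom_ext hQ fun q => hQ.pt_ext fun ψ => ?_
    have h1 : ρ (Characters.res π ψ) = ψ := hinj (by rw [hρ, hπi, map_one, inv_one, _root_.mul_one])
    rw [← Category.assoc, ← res_apply, ← res_apply, hσρ, h1, Category.comp_id]
  · rw [hσρ]
    exact hinj (by rw [hρ, hs, mul_inv_cancel, map_one])
  · refine hT.pt_ext fun χ => ?_
    have h1 : (Characters.res π (ρ χ)).1 t = χ.1 t * ((s (Characters.res i χ)).1 t)⁻¹ := by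
      rw [hρ]; rfl
    rw [map_mul, ← Category.assoc, ← Category.assoc, ← res_apply σ, ← res_apply i, hσρ,
      ← res_apply π, ← res_apply r, hrs, h1, inv_mul_cancel_right]

end exact

/-! ### Regular families of linear maps -/

section LinRegMore

variable {X : Over Base} {W : X.left.Opens} {A B : Pt X → Type}
    [∀ x, AddCommGroup (A x)] [∀ x, Module ℂ (A x)]
    [∀ x, AddCommGroup (B x)] [∀ x, Module ℂ (B x)] {I J : Type}
    {a : ∀ x, In x W → Module.Basis I ℂ (A x)} {b : ∀ x, In x W → Module.Basis J ℂ (B x)}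
    {φ ψ : ∀ x, A x →ₗ[ℂ] B x}

lemma LinReg.add (h : LinReg W a b φ) (h' : LinReg W a b ψ) :
    LinReg W a b (fun x => φ x + ψ x) := fun i j =>
  ((h i j).add (h' i j)).congr fun x hx => by simp

lemma LinReg.smul (z : ℂ) (h : LinReg W a b φ) : LinReg W a b (fun x => z • φ x) := fun i j =>
  ((RegularOn.constC W z).mul (h i j)).congr fun x hx => by simp

lemma LinReg.zero : LinReg W a b (fun _ => 0) := fun _ _ =>
  (RegularOn.constC W 0).congr fun x hx => by simp

lemma LinReg.pullback {X' : Over Base} (f : X' ⟶ X) (h : LinReg W a b φ) :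
    LinReg (A := fun x => A (x ≫ f)) (B := fun x => B (x ≫ f)) (f.left ⁻¹ᵁ W)
      (fun x hx => a (x ≫ f) ((in_comp_iff f x W).2 hx))
      (fun x hx => b (x ≫ f) ((in_comp_iff f x W).2 hx)) (fun x => φ (x ≫ f)) :=
  fun i j => (h i j).comp f

lemma LinReg.of_local
    (h : ∀ (x : Pt X) (_ : In x W), ∃ (V : X.left.Opens) (_ : In x V),
      LinReg (W ⊓ V) (fun z hz => a z hz.left) (fun z hz => b z hz.left) φ) :
    LinReg W a b φ := fun i j => RegularOn.of_local fun x hx => by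
  obtain ⟨V, hxV, hV⟩ := h x hx
  exact ⟨V, hxV, hV i j⟩

lemma RegularOn.det {n : Type} [Fintype n] [DecidableEq n] {M : ∀ x : Pt X, In x W → Matrix n n ℂ}
    (h : ∀ i j, RegularOn W (fun x hx => M x hx i j)) :
    RegularOn W (fun x hx => (M x hx).det) := by
  refine RegularOn.congr (F := fun x hx => ∑ σ ∈ (Finset.univ : Finset (Equiv.Perm n)),
    ((Equiv.Perm.sign σ : ℤ) : ℂ) * ∏ k ∈ (Finset.univ : Finset n), M x hx (σ k) k)
    (RegularOn.sum _ fun σ => (RegularOn.const W _).mul (RegularOn.prod _ fun k _ => h (σ k) k))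
    fun x hx => ?_
  rw [Matrix.det_apply']

/-- The entries are determinants of the matrix with one row replaced by a constant vector. Together
with a regular inverse of the determinant this makes the entries of an inverse matrix regular. -/
lemma RegularOn.adjugate {n : Type} [Fintype n] [DecidableEq n]
    {M : ∀ x : Pt X, In x W → Matrix n n ℂ}
    (h : ∀ i j, RegularOn W (fun x hx => M x hx i j)) (i j : n) :
    RegularOn W (fun x hx => (M x hx).adjugate i j) := by
  refine RegularOn.congr (RegularOn.det (M := fun x hx => (M x hx).updateRow j (Pi.single i 1))
    fun k l => ?_) fun x hx => Matrix.adjugate_apply _ _ _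
  by_cases hk : k = j
  · subst hk
    exact (RegularOn.constC W ((Pi.single i 1 : n → ℂ) l)).congr fun x hx => by
      rw [Matrix.updateRow_self]
  · exact (h k l).congr fun x hx => by rw [Matrix.updateRow_ne hk]

lemma RegularOn.mulMatrix {l m n : Type} [Fintype m] {M : ∀ x : Pt X, In x W → Matrix l m ℂ}
    {N : ∀ x : Pt X, In x W → Matrix m n ℂ}
    (h : ∀ i j, RegularOn W (fun x hx => M x hx i j))
    (h' : ∀ i j, RegularOn W (fun x hx => N x hx i j)) (i : l) (j : n) :
    RegularOn W (fun x hx => (M x hx * N x hx) i j) :=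
  (RegularOn.sum Finset.univ fun k => (h i k).mul (h' k j)).congr fun _ _ =>
    Matrix.mul_apply

end LinRegMore

/-! ### Images of idempotent endomorphisms -/

section image

variable {G Y : Over Base} [GrpObj G] [ModObj G Y]

lemma IsHom.add {E F : EqBundle G Y} {φ ψ : ∀ y, E.fiber y →ₗ[ℂ] F.fiber y}
    (h : IsHom E F φ) (h' : IsHom E F ψ) : IsHom E F (fun y => φ y + ψ y) :=
  ⟨fun b hb c hc => (h.regular b hb c hc).add (h'.regular b hb c hc), fun g y z hh v => by
    simp [h.equivariant g hh, h'.equivariant g hh]⟩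

lemma IsHom.smul {E F : EqBundle G Y} {φ : ∀ y, E.fiber y →ₗ[ℂ] F.fiber y}
    (a : ℂ) (h : IsHom E F φ) : IsHom E F (fun y => a • φ y) :=
  ⟨fun b hb c hc => (h.regular b hb c hc).smul a, fun g y z hh v => by
    simp [h.equivariant g hh]⟩

lemma IsHom.zero (E F : EqBundle G Y) : IsHom E F (fun _ => 0) :=
  ⟨fun _ _ _ _ => LinReg.zero, fun _ _ _ _ _ => by simp⟩

lemma IsHom.sum {E F : EqBundle G Y} {K : Type*} (s : Finset K)
    {φ : K → ∀ y, E.fiber y →ₗ[ℂ] F.fiber y} (h : ∀ k ∈ s, IsHom E F (φ k)) :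
    IsHom E F (fun y => ∑ k ∈ s, φ k y) := by
  classical
  induction s using Finset.induction_on with
  | empty => simpa using IsHom.zero E F
  | insert a s ha ih =>
    simp only [Finset.sum_insert ha]
    exact (h a (Finset.mem_insert_self _ _)).add
      (ih fun k hk => h k (Finset.mem_insert_of_mem hk))

/-- `p` is an idempotent endomorphism of `E`. -/
structure IsIdem (E : EqBundle G Y) (p : ∀ y, E.fiber y →ₗ[ℂ] E.fiber y) : Prop where
  isHom : IsHom E E p
  idem : ∀ y v, p y (p y v) = p y v

variable {E : EqBundle G Y} {p : ∀ y, E.fiber y →ₗ[ℂ] E.fiber y}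

/-- A frame `b` of the images of `p` is regular if the inclusion into `E` and the projection from
`E` are regular. -/
def IsImageFrame (E : EqBundle G Y) (p : ∀ y, E.fiber y →ₗ[ℂ] E.fiber y)
    (b : Frame Y (fun y => LinearMap.range (p y))) : Prop :=
  ∀ c ∈ E.atlas,
    LinReg (b.dom ⊓ c.dom) (fun y hy => b.basis y hy.left) (fun y hy => c.basis y hy.right)
      (fun y => (LinearMap.range (p y)).subtype) ∧
    LinReg (c.dom ⊓ b.dom) (fun y hy => c.basis y hy.left) (fun y hy => b.basis y hy.right)
      (fun y => (p y).rangeRestrict)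

/-- The images of an idempotent endomorphism have regular frames: the endomorphism is locally
conjugate to a constant one. -/
lemma IsIdem.exists_frame (hp : IsIdem E p) (y₀ : Pt Y) :
    ∃ b, IsImageFrame E p b ∧ In y₀ b.dom := by
  classical
  obtain ⟨c, hc, hy₀⟩ := E.cover y₀
  let m : ∀ y, In y c.dom → Matrix c.I c.I ℂ := fun y hy =>
    LinearMap.toMatrix (c.basis y hy) (c.basis y hy) (p y)
  have hmreg : ∀ i j, RegularOn c.dom (fun y hy => m y hy i j) := fun i j =>
    ((hp.isHom.regular c hc c hc j i).mono (le_inf le_rfl le_rfl)).congr fun y hy =>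
      LinearMap.toMatrix_apply _ _ _ _ _
  have hmid : ∀ y hy, m y hy * m y hy = m y hy := fun y hy => by
    rw [← LinearMap.toMatrix_mul]
    congr 1
    exact LinearMap.ext fun v => hp.idem y v
  let P := m y₀ hy₀
  have hP : P * P = P := hmid y₀ hy₀
  -- The standard matrix intertwining two nearby idempotents: m B = B P, and B is the identity at
  -- y₀. Where its determinant is nonzero, B conjugates m(y) to the constant idempotent P.
  let B : ∀ y, In y c.dom → Matrix c.I c.I ℂ := fun y hy => m y hy * P + (1 - m y hy) * (1 - P)
  have hBreg : ∀ i j, RegularOn c.dom (fun y hy => B y hy i j) := fun i j =>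
    (RegularOn.mulMatrix hmreg (fun i j => RegularOn.constC _ (P i j)) i j).add
      (RegularOn.mulMatrix (fun i j => (RegularOn.constC _ ((1 : Matrix c.I c.I ℂ) i j)).sub
        (hmreg i j)) (fun i j => RegularOn.constC _ ((1 - P) i j)) i j)
  have hB₀ : B y₀ hy₀ = 1 := by
    change P * P + (1 - P) * (1 - P) = 1
    rw [mul_sub, sub_mul, sub_mul, hP]
    simp
  have hcomm : ∀ y hy, m y hy * B y hy = B y hy * P := by
    intro y hy
    have h1 : m y hy * (1 - m y hy) = 0 := by rw [mul_sub, hmid, _root_.mul_one, sub_self]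
    have h2 : (1 - P) * P = 0 := by rw [sub_mul, hP, _root_.one_mul, sub_self]
    simp only [B, mul_add, add_mul]
    rw [← _root_.mul_assoc, ← _root_.mul_assoc, hmid, h1, _root_.mul_assoc, hP,
      _root_.mul_assoc (1 - m y hy), h2, Matrix.zero_mul, Matrix.mul_zero]
  obtain ⟨V, hV, hyV, hdet, hinv⟩ := (RegularOn.det hBreg).exists_inv y₀ hy₀ (by
    rw [hB₀, Matrix.det_one]; exact one_ne_zero)
  let e : ∀ y, In y V → ((c.I → ℂ) ≃ₗ[ℂ] E.fiber y) := fun y hy =>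
    (Matrix.toLin'OfInv (Matrix.nonsing_inv_mul (B y (hy.mono hV)) (Ne.isUnit (hdet y hy)))
      (Matrix.mul_nonsing_inv (B y (hy.mono hV)) (Ne.isUnit (hdet y hy)))).trans
      (c.basis y (hy.mono hV)).equivFun.symm
  have he' : ∀ y hy v, e y hy v =
      (c.basis y (hy.mono hV)).equivFun.symm ((B y (hy.mono hV)).mulVec v) := fun _ _ _ => rfl
  have hsymm : ∀ y hy v, (e y hy).symm v =
      ((B y (hy.mono hV))⁻¹).mulVec ((c.basis y (hy.mono hV)).equivFun v) := fun _ _ _ => rfl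
  have he : ∀ y hy v, e y hy (P.mulVec v) = p y (e y hy v) := by
    intro y hy v
    apply (c.basis y (hy.mono hV)).equivFun.injective
    rw [he' y hy, he' y hy, LinearEquiv.apply_symm_apply, Matrix.mulVec_mulVec, ← hcomm,
      ← Matrix.mulVec_mulVec]
    have := LinearMap.toMatrix_mulVec_repr (c.basis y (hy.mono hV)) (c.basis y (hy.mono hV)) (p y)
      ((c.basis y (hy.mono hV)).equivFun.symm ((B y (hy.mono hV)).mulVec v))
    refine Eq.trans ?_ this
    congr 1
    exact ((c.basis y (hy.mono hV)).equivFun.apply_symm_apply _).symm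
  let R := LinearMap.range (Matrix.toLin' P)
  let β : Module.Basis _ ℂ R := Module.finBasis ℂ R
  have hR : ∀ y hy, Submodule.map (e y hy).toLinearMap R = LinearMap.range (p y) := by
    intro y hy
    apply le_antisymm
    · rintro _ ⟨_, ⟨v, rfl⟩, rfl⟩
      refine ⟨e y hy v, ?_⟩
      rw [← he y hy]
      rfl
    · rintro _ ⟨v, rfl⟩
      refine ⟨_, ⟨(e y hy).symm v, rfl⟩, ?_⟩
      rw [Matrix.toLin'_apply]
      change e y hy _ = _
      rw [he y hy, LinearEquiv.apply_symm_apply]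
  -- A fixed basis of the image of P, transported by B(y), is the frame of the images of p.
  let L : ∀ y, In y V → (R ≃ₗ[ℂ] LinearMap.range (p y)) := fun y hy =>
    ((e y hy).submoduleMap R).trans (LinearEquiv.ofEq _ _ (hR y hy))
  let b : Frame Y (fun y => LinearMap.range (p y)) :=
    { dom := V
      I := Fin (Module.finrank ℂ R)
      basis y hy := β.map (L y hy) }
  refine ⟨b, ?_, hyV⟩
  have hincl : LinReg b.dom (fun y hy => b.basis y hy) (fun y hy => c.basis y (hy.mono hV))
      (fun y => (LinearMap.range (p y)).subtype) := by
    intro i j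
    refine (RegularOn.sum Finset.univ fun k => ((hBreg j k).mono hV).mul
      (RegularOn.constC V ((β i : c.I → ℂ) k))).congr fun y hy => ?_
    have h1 : (LinearMap.range (p y)).subtype (b.basis y hy i) = e y hy (β i) := by
      change (L y hy (β i) : E.fiber y) = _
      rfl
    rw [h1, he' y hy]
    change (c.basis y (hy.mono hV)).equivFun _ j = _
    rw [LinearEquiv.apply_symm_apply]
    rfl
  have hproj : LinReg b.dom (fun y hy => c.basis y (hy.mono hV)) (fun y hy => b.basis y hy)
      (fun y => (p y).rangeRestrict) := by
    intro i j
    let u : c.I → R := fun k => ⟨P.mulVec (Pi.single k 1), _, rfl⟩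
    -- Coordinates of p(v) in the new frame: apply the inverse of B, written as the inverse
    -- determinant times the adjugate, then P, then take coordinates in the fixed basis β.
    refine (RegularOn.sum Finset.univ fun k => (hinv.mul
      (RegularOn.adjugate (fun i j => (hBreg i j).mono hV) k i)).mul
      (RegularOn.constC V (β.repr (u k) j))).congr fun y hy => ?_
    let w : c.I → ℂ := fun k => (B y (hy.mono hV))⁻¹ k i
    have h1 : (p y).rangeRestrict (c.basis y (hy.mono hV) i) = L y hy (∑ k, w k • u k) := by
      apply Subtype.ext
      have h2 : (∑ k, w k • u k : R) = P.mulVec w := by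
        have h3 : w = ∑ k, w k • (Pi.single k 1 : c.I → ℂ) := by
          simp [← Pi.single_smul, Finset.univ_sum_single]
        conv_rhs => rw [h3]
        rw [Matrix.mulVec_sum]
        simp only [Matrix.mulVec_smul, Submodule.coe_sum, Submodule.coe_smul]
        rfl
      have h3 : e y hy w = c.basis y (hy.mono hV) i := by
        rw [← LinearEquiv.eq_symm_apply, hsymm y hy]
        ext k
        simp [w, Matrix.mulVec, dotProduct]
      change p y _ = e y hy (∑ k, w k • u k : R)
      rw [h2, he y hy, h3]
    have h4 : (b.basis y hy).repr ((p y).rangeRestrict (c.basis y (hy.mono hV) i)) j =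
        β.repr (∑ k, w k • u k) j := by
      rw [h1]
      change β.repr ((L y hy).symm (L y hy _)) j = _
      rw [LinearEquiv.symm_apply_apply]
    rw [h4]
    simp [w, Matrix.inv_def]
  intro c' hc'
  constructor
  · exact (hincl.mono inf_le_left).comp
      ((E.transition c hc c' hc').mono (V := b.dom ⊓ c'.dom) (inf_le_inf hV le_rfl))
  · exact ((E.transition c' hc' c hc).mono (V := c'.dom ⊓ b.dom) (inf_le_inf le_rfl hV)).comp
      (hproj.mono inf_le_right)

end image

/-! ### Image bundles and their classes in the Grothendieck group. -/

section image

variable {G Y : Over Base} [GrpObj G] [ModObj G Y]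
variable {E : EqBundle G Y} {p : ∀ y, E.fiber y →ₗ[ℂ] E.fiber y}

lemma IsIdem.apply_of_mem (hp : IsIdem E p) {y : Pt Y} {v : E.fiber y}
    (hv : v ∈ LinearMap.range (p y)) : p y v = v := by
  obtain ⟨w, rfl⟩ := hv
  exact hp.idem y w

lemma IsIdem.act_mem (hp : IsIdem E p) (g : Pt G) {y z : Pt Y} (h : g • y = z) :
    ∀ v ∈ LinearMap.range (p y), E.act g h v ∈ LinearMap.range (p z) := by
  rintro _ ⟨w, rfl⟩
  exact ⟨E.act g h w, hp.isHom.equivariant g h w⟩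

/-- The image of an idempotent endomorphism of an equivariant vector bundle. -/
def EqBundle.image (E : EqBundle G Y) (p : ∀ y, E.fiber y →ₗ[ℂ] E.fiber y) (hp : IsIdem E p) :
    EqBundle G Y where
  fiber y := LinearMap.range (p y)
  atlas := {b | IsImageFrame E p b}
  cover := hp.exists_frame
  transition b hb b' hb' := by
    -- Locally, the identity between two frames of the image factors as the inclusion into E
    -- followed by the projection p, and both are regular in a frame of E.
    refine LinReg.of_local fun x hx => ?_
    obtain ⟨c, hc, hxc⟩ := E.cover x
    refine ⟨c.dom, hxc, ?_⟩
    have h1 := (hb c hc).1.mono (V := (b.dom ⊓ b'.dom) ⊓ c.dom) (fun _ h => ⟨h.1.1, h.2⟩)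
    have h2 := (hb' c hc).2.mono (V := (b.dom ⊓ b'.dom) ⊓ c.dom) (fun _ h => ⟨h.2, h.1.2⟩)
    intro i j
    refine (h1.comp h2 i j).congr fun y hy => ?_
    congr 2
    exact Subtype.ext (hp.apply_of_mem (Subtype.mem _)).symm
  act g y z h := (E.act g h).restrict (hp.act_mem g h)
  act_one y h v := Subtype.ext (E.act_one y h v)
  act_mul g g' x y z h' h hh v := Subtype.ext (E.act_mul g g' h' h hh v)
  act_regular b hb b' hb' := by
    -- The action on the image is inclusion, action on E, projection; frames of E are needed both at
    -- the point y and at its translate.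
    refine LinReg.of_local fun x hx => ?_
    obtain ⟨c, hc, hxc⟩ := E.cover (x ≫ snd G Y)
    obtain ⟨c', hc', hxc'⟩ := E.cover (x ≫ γ[G, Y])
    let V : (G ⊗ Y).left.Opens :=
      (snd G Y).left ⁻¹ᵁ c.dom ⊓ (γ[G, Y] : G ⊗ Y ⟶ Y).left ⁻¹ᵁ c'.dom
    let U : (G ⊗ Y).left.Opens :=
      (snd G Y).left ⁻¹ᵁ b.dom ⊓ (γ[G, Y] : G ⊗ Y ⟶ Y).left ⁻¹ᵁ b'.dom
    refine ⟨V, ((in_comp_iff _ _ _).1 hxc).inf ((in_comp_iff (X := G ⊗ Y) _ _ _).1 hxc'), ?_⟩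
    have h1 := ((hb c hc).1.pullback (snd G Y)).mono (V := U ⊓ V) (fun _ h => ⟨h.1.1, h.2.1⟩)
    have h2 := (E.act_regular c hc c' hc').mono (V := U ⊓ V) (fun _ h => ⟨h.2.1, h.2.2⟩)
    have h3 := ((hb' c' hc').2.pullback (X' := G ⊗ Y) γ[G, Y]).mono (V := U ⊓ V)
      (fun _ h => ⟨h.2.2, h.1.2⟩)
    intro i j
    refine ((h1.comp h2).comp h3 i j).congr fun y hy => ?_
    congr 2
    exact Subtype.ext (hp.apply_of_mem (hp.act_mem _ _ _ (Subtype.mem _))).symm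

lemma IsIdem.isHom_subtype (hp : IsIdem E p) :
    IsHom (E.image p hp) E (fun y => (LinearMap.range (p y)).subtype) :=
  ⟨fun _ hb c hc => (hb c hc).1, fun _ _ _ _ _ => rfl⟩

lemma IsIdem.isHom_rangeRestrict (hp : IsIdem E p) :
    IsHom E (E.image p hp) (fun y => (p y).rangeRestrict) :=
  ⟨fun c hc _ hb => (hb c hc).2, fun g _ _ h v => Subtype.ext (hp.isHom.equivariant g h v)⟩

lemma isIsom_of_inverse {E F : EqBundle G Y} {φ : ∀ y, E.fiber y →ₗ[ℂ] F.fiber y}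
    {ψ : ∀ y, F.fiber y →ₗ[ℂ] E.fiber y} (hφ : IsHom E F φ) (hψ : IsHom F E ψ)
    (h : ∀ y v, ψ y (φ y v) = v) (h' : ∀ y v, φ y (ψ y v) = v) : IsIsom E F :=
  ⟨fun y => LinearEquiv.ofLinearMap (φ y) (ψ y) (LinearMap.ext (h' y)) (LinearMap.ext (h y)), hφ, hψ⟩

lemma EqBundle.cl_eq {E F : EqBundle G Y} (h : IsIsom E F) : E.cl = F.cl := by
  rw [EqBundle.cl, EqBundle.cl, isoClass_eq h]

lemma EqBundle.cl_exact {E' E E'' : EqBundle G Y} (h : IsShortExact E' E E'') :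
    E.cl = E'.cl + E''.cl := by
  rw [← sub_eq_zero, ← sub_sub]
  exact Ideal.Quotient.eq_zero_iff_mem.2 (AddSubgroup.subset_closure ⟨E', E, E'', h, rfl⟩)

lemma EqBundle.cl_mul (E F : EqBundle G Y) : E.cl * F.cl = (E.tensor F).cl := by
  change Ideal.Quotient.mk (exactIdeal G Y) (FreeAbelianGroup.of E.isoClass) *
    Ideal.Quotient.mk (exactIdeal G Y) (FreeAbelianGroup.of F.isoClass) = _
  rw [← map_mul, FreeAbelianGroup.of_mul_of]
  rfl

lemma EqBundle.cl_unit : (EqBundle.unit G Y).cl = 1 := rfl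

/-- A zero bundle is an extension of itself by itself, so [E] = [E] + [E]. -/
lemma EqBundle.cl_eq_zero {E : EqBundle G Y} (h : ∀ y (v : E.fiber y), v = 0) : E.cl = 0 := by
  have : IsShortExact E E E := by
    refine ⟨fun _ => LinearMap.id, fun _ => LinearMap.id, IsHom.id E, IsHom.id E, fun y =>
      ⟨Function.injective_id, fun v => ?_, Function.surjective_id⟩⟩
    rw [h y v]
    simp
  simpa using EqBundle.cl_exact this

lemma KRing.induction {P : KRing G Y → Prop} (x : KRing G Y) (cl : ∀ E : EqBundle G Y, P E.cl)
    (zero : P 0) (neg : ∀ x, P x → P (-x)) (add : ∀ x y, P x → P y → P (x + y)) : P x := by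
  obtain ⟨x, rfl⟩ := Ideal.Quotient.mk_surjective x
  induction x using FreeAbelianGroup.induction_on with
  | zero => rwa [map_zero]
  | of c =>
    obtain ⟨E, rfl⟩ : ∃ E : EqBundle G Y, E.isoClass = c := Quotient.exists_rep c
    exact cl E
  | neg c h => rw [map_neg]; exact neg _ h
  | add x y hx hy => rw [map_add]; exact add _ _ hx hy

/-- Additive maps out of `K_G(Y)` are determined by their values at classes of bundles. -/
lemma KRing.addHom_ext {A : Type*} [AddCommGroup A] {f g : KRing G Y →+ A}
    (h : ∀ E : EqBundle G Y, f E.cl = g E.cl) : f = g := by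
  ext x
  induction x using KRing.induction with
  | cl E => exact h E
  | zero => rw [map_zero, map_zero]
  | neg x hx => rw [map_neg, map_neg, hx]
  | add x y hx hy => rw [map_add, map_add, hx, hy]

/-- The additive map out of `K_G(Y)` given by an invariant of bundles that is additive on short
exact sequences. -/
lemma KRing.exists_addHom {A : Type*} [AddCommGroup A] (f : EqBundle G Y → A)
    (hiso : ∀ E F, IsIsom E F → f E = f F)
    (hexact : ∀ E' E E'', IsShortExact E' E E'' → f E = f E' + f E'') :
    ∃ F : KRing G Y →+ A, ∀ E : EqBundle G Y, F E.cl = f E := by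
  let F₀ : FreeAbelianGroup (BundleClass G Y) →+ A :=
    FreeAbelianGroup.lift (Quotient.lift f hiso)
  have h0 : ∀ E : EqBundle G Y, F₀ (FreeAbelianGroup.of E.isoClass) = f E := fun E =>
    FreeAbelianGroup.lift_apply_of _ _
  refine ⟨QuotientAddGroup.lift (exactIdeal G Y).toAddSubgroup F₀ ?_, h0⟩
  change AddSubgroup.closure (exactRelations G Y) ≤ F₀.ker
  rw [AddSubgroup.closure_le]
  rintro _ ⟨E', E, E'', h, rfl⟩
  change F₀ _ = 0
  rw [map_sub, map_sub, h0, h0, h0, hexact _ _ _ h]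
  abel

lemma IsIdem.isIsom_of_eq_id (hp : IsIdem E p) (h : ∀ y v, p y v = v) :
    IsIsom (E.image p hp) E :=
  isIsom_of_inverse hp.isHom_subtype hp.isHom_rangeRestrict
    (fun y v => Subtype.ext (h y v.1)) (fun y v => h y v)

lemma IsIdem.cl_eq_zero (hp : IsIdem E p) (h : ∀ y v, p y v = 0) : (E.image p hp).cl = 0 := by
  apply EqBundle.cl_eq_zero
  rintro y ⟨_, w, rfl⟩
  exact Subtype.ext (h y w)

/-- Orthogonality makes the image of p + q the direct sum of the two images; the maps of the
sequence are the inclusion of the first summand and the projection q onto the second. -/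
lemma IsIdem.isShortExact_add {q : ∀ y, E.fiber y →ₗ[ℂ] E.fiber y} (hp : IsIdem E p)
    (hq : IsIdem E q) (hpq : IsIdem E (fun y => p y + q y)) (h : ∀ y v, p y (q y v) = 0)
    (h' : ∀ y v, q y (p y v) = 0) :
    IsShortExact (E.image p hp) (E.image _ hpq) (E.image q hq) := by
  refine ⟨_, _, hp.isHom_subtype.comp hpq.isHom_rangeRestrict,
    hpq.isHom_subtype.comp hq.isHom_rangeRestrict, fun y => ⟨?_, ?_, ?_⟩⟩
  · rintro ⟨_, v, rfl⟩ ⟨_, w, rfl⟩ hvw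
    have hvw' : p y (p y v) + q y (p y v) = p y (p y w) + q y (p y w) :=
      congrArg Subtype.val hvw
    rw [hp.idem, hp.idem, h', h', add_zero, add_zero] at hvw'
    exact Subtype.ext hvw'
  · rintro ⟨_, v, rfl⟩
    constructor
    · intro hv
      have : q y (p y v + q y v) = 0 := congrArg Subtype.val hv
      rw [map_add, h', hq.idem, zero_add] at this
      refine ⟨⟨p y v, v, rfl⟩, Subtype.ext ?_⟩
      change p y (p y v) + q y (p y v) = p y v + q y v
      rw [hp.idem, h', this]
    · rintro ⟨⟨_, w, rfl⟩, hw⟩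
      have hw' : p y (p y w) + q y (p y w) = p y v + q y v := congrArg Subtype.val hw
      apply Subtype.ext
      change q y (p y v + q y v) = 0
      rw [← hw', h', add_zero, hp.idem, h']
  · rintro ⟨_, v, rfl⟩
    refine ⟨⟨_, q y v, rfl⟩, Subtype.ext ?_⟩
    change q y (p y (q y v) + q y (q y v)) = q y v
    rw [h, zero_add, hq.idem, hq.idem]

/-- The class of a bundle decomposed by orthogonal idempotents. -/
lemma cl_eq_sum_image {K : Type*} [DecidableEq K] (s : Finset K)
    (p : K → ∀ y, E.fiber y →ₗ[ℂ] E.fiber y) (hp : ∀ k, IsIdem E (p k))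
    (horth : ∀ k ∈ s, ∀ l ∈ s, k ≠ l → ∀ y v, p k y (p l y v) = 0)
    (hsum : ∀ y v, ∑ k ∈ s, p k y v = v) : E.cl = ∑ k ∈ s, (E.image (p k) (hp k)).cl := by
  -- Partial sums of orthogonal idempotents are idempotent, so the summands can be split off one at
  -- a time by induction on a subset t of s.
  have hidem : ∀ t ⊆ s, IsIdem E (fun y => ∑ k ∈ t, p k y) := by
    intro t ht
    refine ⟨IsHom.sum t fun k _ => (hp k).isHom, fun y v => ?_⟩
    simp only [LinearMap.sum_apply, map_sum]
    refine Finset.sum_congr rfl fun k hk => ?_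
    rw [Finset.sum_eq_single k (fun l hl hlk => horth l (ht hl) k (ht hk) hlk y v)
      (fun h => (h hk).elim), (hp k).idem]
  have key : ∀ t (ht : t ⊆ s),
      (E.image _ (hidem t ht)).cl = ∑ k ∈ t, (E.image (p k) (hp k)).cl := by
    intro t
    induction t using Finset.induction_on with
    | empty =>
      intro ht
      rw [Finset.sum_empty]
      exact IsIdem.cl_eq_zero _ fun y v => by simp
    | insert a t ha ih =>
      intro ht
      have ht' : t ⊆ s := (Finset.subset_insert a t).trans ht
      have has : a ∈ s := ht (Finset.mem_insert_self a t)
      rw [Finset.sum_insert ha, ← ih ht']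
      have hadd : IsIdem E (fun y => p a y + ∑ k ∈ t, p k y) := by
        simpa only [Finset.sum_insert ha] using hidem _ ht
      have hne : ∀ k ∈ t, k ≠ a := fun k hk hka => ha (hka ▸ hk)
      rw [← EqBundle.cl_exact ((hp a).isShortExact_add (hidem t ht') hadd ?_ ?_)]
      · simp only [Finset.sum_insert ha]
      · intro y v
        rw [LinearMap.sum_apply, map_sum]
        exact Finset.sum_eq_zero fun k hk => horth a has k (ht' hk) (hne k hk).symm y v
      · intro y v
        rw [LinearMap.sum_apply]
        exact Finset.sum_eq_zero fun k hk => horth k (ht' hk) a has (hne k hk) y v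
  rw [← key s le_rfl]
  exact (EqBundle.cl_eq (IsIdem.isIsom_of_eq_id _ fun y v => by
    rw [LinearMap.sum_apply, hsum])).symm

end image

/-! ### Functoriality of pullback -/

section functoriality

variable {G Z : Over Base} [GrpObj G] [ModObj G Z]

/-- Fibres over equal points are identified. -/
def EqBundle.cast (E : EqBundle G Z) {y y' : Pt Z} (h : y = y') : E.fiber y ≃ₗ[ℂ] E.fiber y' :=
  h ▸ LinearEquiv.refl ℂ _

lemma EqBundle.repr_cast (E : EqBundle G Z) (b c : Frame Z E.fiber) {y y' : Pt Z} (h : y = y')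
    (hb : In y b.dom) (hb' : In y' b.dom) (hc : In y' c.dom) (i : b.I) (j : c.I) :
    (c.basis y' hc).repr (E.cast h (b.basis y hb i)) j =
      (c.basis y' hc).repr (b.basis y' hb' i) j := by
  subst h; rfl

lemma EqBundle.repr_cast_symm (E : EqBundle G Z) (b c : Frame Z E.fiber) {y y' : Pt Z}
    (h : y' = y) (hb : In y b.dom) (hb' : In y' b.dom) (hc : In y' c.dom) (i : b.I) (j : c.I) :
    (c.basis y' hc).repr ((E.cast h).symm (b.basis y hb i)) j =
      (c.basis y' hc).repr (b.basis y' hb' i) j := by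
  subst h; rfl

lemma EqBundle.cast_act (E : EqBundle G Z) {g g' : Pt G} {y y' z z' : Pt Z} (hg : g = g')
    (hy : y = y') (hz : z = z') (h : g • y = z) (h' : g' • y' = z') (v : E.fiber y) :
    E.cast hz (E.act g h v) = E.act g' h' (E.cast hy v) := by
  subst hg hy hz; rfl

lemma EqBundle.cast_symm (E : EqBundle G Z) {y y' : Pt Z} (h : y = y') (v : E.fiber y') :
    (E.cast h).symm v = E.cast h.symm v := by
  subst h; rfl

variable {H Y : Over Base} [GrpObj H] [ModObj H Y] {K W : Over Base} [GrpObj K] [ModObj K W]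
  {ρ : H ⟶ G} {f : Y ⟶ Z} {ρ' : K ⟶ H} {f' : W ⟶ Y}

lemma IsEquivariant.comp (hf : IsEquivariant ρ f) (hf' : IsEquivariant ρ' f') :
    IsEquivariant (ρ' ≫ ρ) (f' ≫ f) := by
  rw [IsEquivariant, ← tensorHom_comp_tensorHom, Category.assoc]
  erw [hf]
  rw [← Category.assoc]
  erw [hf']
  rw [Category.assoc]

/-- The two bundles have the same fibres up to associativity of composition of points. Transport
along that equality is the isomorphism, and in frames it reads as a transition matrix of E. -/
lemma isIsom_pull_pull [IsMonHom ρ] [IsMonHom ρ'] (hf : IsEquivariant ρ f)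
    (hf' : IsEquivariant ρ' f') (E : EqBundle G Z) :
    IsIsom ((E.pull hf).pull hf') (E.pull (hf.comp hf')) := by
  have hassoc : ∀ w : Pt W, (w ≫ f') ≫ f = w ≫ f' ≫ f := fun w => Category.assoc _ _ _
  refine ⟨fun w => E.cast (hassoc w), ⟨?_, fun g y z h v => ?_⟩, ⟨?_, fun g y z h v => ?_⟩⟩
  · rintro _ ⟨_, ⟨b, hb, rfl⟩, rfl⟩ _ ⟨c, hc, rfl⟩ i j
    refine (((E.transition b hb c hc i j).comp (f' ≫ f)).mono fun _ h => h).congr fun w hw => ?_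
    exact E.repr_cast b c (hassoc w) _ _ _ i j
  · exact E.cast_act (Category.assoc _ _ _) (hassoc y) (hassoc z) _ _ v
  · rintro _ ⟨c, hc, rfl⟩ _ ⟨_, ⟨b, hb, rfl⟩, rfl⟩ i j
    refine ((((E.transition c hc b hb i j).comp f).comp f').mono fun _ h => h).congr fun w hw => ?_
    exact E.repr_cast_symm c b (hassoc w) _ _ _ i j
  · refine (E.cast_symm _ _).trans (Eq.trans ?_ (congrArg _ (E.cast_symm _ _).symm))
    exact E.cast_act (Category.assoc _ _ _).symm (hassoc y).symm (hassoc z).symm _ _ v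

lemma isEquivariant_id (G Z : Over Base) [GrpObj G] [ModObj G Z] :
    IsEquivariant (𝟙 G) (𝟙 Z) := by
  rw [IsEquivariant, id_tensorHom_id, Category.id_comp, Category.comp_id]

lemma isIsom_pull_id (E : EqBundle G Z) : IsIsom (E.pull (isEquivariant_id G Z)) E := by
  have hid : ∀ w : Pt Z, w ≫ 𝟙 Z = w := fun w => Category.comp_id _
  refine ⟨fun w => E.cast (hid w), ⟨?_, fun g y z h v => ?_⟩, ⟨?_, fun g y z h v => ?_⟩⟩
  · rintro _ ⟨b, hb, rfl⟩ c hc i j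
    refine ((E.transition b hb c hc i j).mono fun _ h => h).congr fun w hw => ?_
    exact E.repr_cast b c (hid w) _ _ _ i j
  · exact E.cast_act (Category.comp_id _) (hid y) (hid z) _ _ v
  · rintro c hc _ ⟨b, hb, rfl⟩ i j
    refine (((E.transition c hc b hb i j).comp (𝟙 Z)).mono fun _ h => h).congr fun w hw => ?_
    exact E.repr_cast_symm c b (hid w) _ _ _ i j
  · refine (E.cast_symm _ _).trans (Eq.trans ?_ (congrArg _ (E.cast_symm _ _).symm))
    exact E.cast_act (Category.comp_id _).symm (hid y).symm (hid z).symm _ _ v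

lemma pullK_pullK [IsMonHom ρ] [IsMonHom ρ'] (hf : IsEquivariant ρ f)
    (hf' : IsEquivariant ρ' f') (x : KRing G Z) :
    pullK hf' (pullK hf x) = pullK (hf.comp hf') x := by
  refine DFunLike.congr_fun (KRing.addHom_ext (f := ((pullK hf').comp (pullK hf)).toAddMonoidHom)
    (g := (pullK (hf.comp hf')).toAddMonoidHom) fun E => ?_) x
  change pullK hf' (pullK hf E.cl) = pullK (hf.comp hf') E.cl
  rw [pullK_cl, pullK_cl, pullK_cl]
  exact EqBundle.cl_eq (isIsom_pull_pull hf hf' E)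

lemma pullK_id (x : KRing G Z) : pullK (isEquivariant_id G Z) x = x := by
  refine DFunLike.congr_fun (KRing.addHom_ext
    (f := (pullK (isEquivariant_id G Z)).toAddMonoidHom) (g := AddMonoidHom.id _) fun E => ?_) x
  change pullK _ E.cl = E.cl
  rw [pullK_cl]
  exact EqBundle.cl_eq (isIsom_pull_id E)

lemma pullK_congr {ρ₂ : H ⟶ G} {f₂ : Y ⟶ Z} [IsMonHom ρ] [IsMonHom ρ₂] (hf : IsEquivariant ρ f)
    (hf₂ : IsEquivariant ρ₂ f₂) (h : ρ = ρ₂) (h' : f = f₂) (x : KRing G Z) :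
    pullK hf x = pullK hf₂ x := by
  subst h h'; rfl

lemma pullK_eq_self {ρ : G ⟶ G} {f : Z ⟶ Z} [IsMonHom ρ] (hf : IsEquivariant ρ f)
    (h : ρ = 𝟙 G) (h' : f = 𝟙 Z) (x : KRing G Z) : pullK hf x = x :=
  (pullK_congr hf (isEquivariant_id G Z) h h' x).trans (pullK_id x)

end functoriality

/-! ### Classes of characters under restriction. -/

section characters

variable {G H : Over Base} [GrpObj G] [GrpObj H] (ρ : H ⟶ G) [IsMonHom ρ]

/-- The underlying line is unchanged by restriction and both actions are multiplication by χ(ρ(g)),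
so the identity is an isomorphism. -/
lemma resRep_expChar (χ : Characters G) :
    resRep ρ (expChar χ) = expChar (Characters.res ρ χ) := by
  rw [resRep, expChar, pullK_cl]
  refine EqBundle.cl_eq ⟨fun _ => LinearEquiv.refl ℂ ℂ, ⟨?_, fun _ _ _ _ _ => rfl⟩,
    ⟨?_, fun _ _ _ _ _ => rfl⟩⟩
  · rintro _ ⟨_, rfl, rfl⟩ _ rfl i j
    exact (RegularOn.const _ 1).congr fun y hy => (one_entry i j).symm
  · rintro _ rfl _ ⟨_, rfl, rfl⟩ i j
    exact (RegularOn.const _ 1).congr fun y hy => (one_entry i j).symm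

lemma expChar_one : expChar (1 : Characters G) = 1 := by
  rw [← EqBundle.cl_unit, expChar]
  refine EqBundle.cl_eq ⟨fun _ => LinearEquiv.refl ℂ ℂ, ⟨?_, fun _ _ _ _ v => ?_⟩,
    ⟨?_, fun _ _ _ _ v => ?_⟩⟩
  · rintro _ rfl _ rfl i j
    exact (RegularOn.const _ 1).congr fun y hy => (one_entry i j).symm
  · change ((1 : ℂˣ) : ℂ) • v = v
    simp
  · rintro _ rfl _ rfl i j
    exact (RegularOn.const _ 1).congr fun y hy => (one_entry i j).symm
  · change v = ((1 : ℂˣ) : ℂ) • v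
    simp

end characters

/-! ### Diagonalisable actions on a vector space -/

section eigenbasis

variable {H : Over Base} [GrpObj H]

/-- A finite set of characters has a dual family of linear combinations of points. -/
lemma exists_dual_points [DecidableEq (Characters H)] (S : Finset (Characters H)) :
    ∃ c : Characters H → Pt H →₀ ℂ, ∀ χ ∈ S, ∀ ψ ∈ S,
      ((c χ).sum fun t a => a * ψ.1 t) = if ψ = χ then 1 else 0 := by
  let Λ : (Pt H →₀ ℂ) →ₗ[ℂ] (S → ℂ) :=
    Finsupp.linearCombination ℂ (fun (t : Pt H) (ψ : S) => (ψ.1.1 t : ℂ))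
  have hΛ : ∀ c ψ, Λ c ψ = c.sum fun t a => a * ψ.1.1 t := by
    intro c ψ
    simp [Λ, Finsupp.linearCombination_apply, Finsupp.sum]
  -- A linear functional vanishing on all evaluation vectors (ψ(t))_ψ would be a linear relation
  -- between the characters in S.
  have hsurj : LinearMap.range Λ = ⊤ := by
    by_contra hne
    obtain ⟨f, hf0, hf⟩ := Submodule.exists_le_ker_of_lt_top _ (lt_top_iff_ne_top.2 hne)
    apply hf0
    have h1 : ∀ t, ∑ ψ : S, f (Pi.single ψ 1) * (ψ.1.1 t : ℂ) = 0 := by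
      intro t
      have h2 : f (Λ (Finsupp.single t 1)) = 0 := hf ⟨_, rfl⟩
      rw [← Finset.univ_sum_single (Λ (Finsupp.single t 1)), map_sum] at h2
      rw [← h2]
      refine Finset.sum_congr rfl fun ψ _ => ?_
      have h3 : Pi.single ψ (Λ (Finsupp.single t 1) ψ) =
          (ψ.1.1 t : ℂ) • (Pi.single ψ 1 : S → ℂ) := by
        rw [hΛ, Finsupp.sum_single_index (by simp), ← Pi.single_smul]
        simp
      rw [h3, map_smul, smul_eq_mul, mul_comm]
    have h2 := (linearIndependent_characters H).comp (fun ψ : S => ψ.1) Subtype.val_injective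
    rw [Fintype.linearIndependent_iff] at h2
    have h3 := h2 (fun ψ => f (Pi.single ψ 1)) (by
      ext t
      simpa using h1 t)
    refine LinearMap.pi_ext' fun ψ => LinearMap.ext_ring ?_
    simpa using h3 ψ
  have : ∀ χ : Characters H, ∃ c : Pt H →₀ ℂ, ∀ ψ : S, Λ c ψ = if ψ.1 = χ then 1 else 0 := by
    intro χ
    obtain ⟨c, hc⟩ : (fun ψ : S => if ψ.1 = χ then (1 : ℂ) else 0) ∈ LinearMap.range Λ := by
      rw [hsurj]; trivial
    exact ⟨c, fun ψ => congrFun hc ψ⟩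
  choose c hc using this
  exact ⟨c, fun χ _ ψ hψ => by rw [← hΛ _ ⟨ψ, hψ⟩, hc]⟩

variable {V : Type} [AddCommGroup V] [Module ℂ V]

/-- A representation of a group whose matrix coefficients are linear combinations of characters has
a basis of eigenvectors. -/
lemma exists_eigenbasis (ρ : Pt H → V →ₗ[ℂ] V) (h1 : ρ 1 = LinearMap.id)
    (hmul : ∀ s t, ρ (s * t) = ρ s ∘ₗ ρ t) {I : Type} [Fintype I] (β : Module.Basis I ℂ V)
    (hreg : ∀ i j, ∃ a : Characters H →₀ ℂ, ∀ t, β.repr (ρ t (β i)) j =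
      a.sum fun χ c => c * χ.1 t) :
    ∃ (J : Type) (_ : Fintype J) (w : Module.Basis J ℂ V) (χ : J → Characters H),
      ∀ j t, ρ t (w j) = ((χ j).1 t : ℂ) • w j := by
  classical
  choose a ha using hreg
  let S : Finset (Characters H) := Finset.univ.biUnion fun i => Finset.univ.biUnion fun j =>
    (a i j).support
  have ha' : ∀ i j t, β.repr (ρ t (β i)) j = ∑ χ ∈ S, a i j χ * χ.1 t := by
    intro i j t
    rw [ha, Finsupp.sum]
    refine Finset.sum_subset (fun χ hχ => ?_) (fun χ _ hχ => ?_)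
    · exact Finset.mem_biUnion.2 ⟨i, Finset.mem_univ _, Finset.mem_biUnion.2
        ⟨j, Finset.mem_univ _, hχ⟩⟩
    · rw [Finsupp.notMem_support_iff.1 hχ, zero_mul]
  -- The vector coefficient of χ in the expansion of t ↦ ρ(t)β_i as a combination of characters.
  let w : I → Characters H → V := fun i χ => ∑ j, a i j χ • β j
  have hw : ∀ i t, ρ t (β i) = ∑ χ ∈ S, (χ.1 t : ℂ) • w i χ := by
    intro i t
    rw [← β.sum_repr (ρ t (β i))]
    simp only [ha', Finset.sum_smul, w, Finset.smul_sum]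
    rw [Finset.sum_comm]
    refine Finset.sum_congr rfl fun χ _ => Finset.sum_congr rfl fun j _ => ?_
    rw [smul_smul, mul_comm]
  -- Expand ρ(s)ρ(t)β_i = ρ(st)β_i in t and compare the coefficients of χ(t), using linear
  -- independence of characters.
  have heig : ∀ i, ∀ χ ∈ S, ∀ s, ρ s (w i χ) = (χ.1 s : ℂ) • w i χ := by
    intro i χ hχ s
    rw [← sub_eq_zero]
    apply β.repr.injective
    ext j
    rw [map_zero, Finsupp.zero_apply]
    refine linearIndependent_iff'.1 (linearIndependent_characters H) S
      (fun χ => β.repr (ρ s (w i χ) - (χ.1 s : ℂ) • w i χ) j) ?_ χ hχ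
    ext t
    have h2 : ∑ χ ∈ S, (χ.1 t : ℂ) • (ρ s (w i χ) - (χ.1 s : ℂ) • w i χ) = 0 := by
      have h3 : ρ s (ρ t (β i)) = ρ (s * t) (β i) := by rw [hmul]; rfl
      rw [hw, hw, map_sum, ← sub_eq_zero, ← Finset.sum_sub_distrib] at h3
      rw [← h3]
      refine Finset.sum_congr rfl fun χ _ => ?_
      rw [map_smul, smul_sub, smul_smul, map_mul, Units.val_mul, mul_comm (χ.1 t : ℂ)]
    have h4 := congrArg (fun v => β.repr v j) h2
    simp only [map_sum, map_smul, Finsupp.coe_finsetSum, Finset.sum_apply, Finsupp.smul_apply,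
      map_zero, Finsupp.zero_apply, smul_eq_mul] at h4
    rw [Finset.sum_apply, Pi.zero_apply, ← h4]
    exact Finset.sum_congr rfl fun χ _ => mul_comm _ _
  let R : Set V := {v | ∃ χ : Characters H, ∀ t, ρ t v = (χ.1 t : ℂ) • v}
  have hR : ⊤ ≤ Submodule.span ℂ R := by
    rw [← β.span_eq, Submodule.span_le]
    rintro _ ⟨i, rfl⟩
    -- At t = 1 the expansion expresses each basis vector through eigenvectors, so the eigenvectors
    -- span and a basis can be extracted from them.
    have h2 : β i = ∑ χ ∈ S, (χ.1 1 : ℂ) • w i χ := by rw [← hw, h1]; rfl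
    rw [SetLike.mem_coe, h2]
    exact Submodule.sum_mem _ fun χ hχ => Submodule.smul_mem _ _
      (Submodule.subset_span ⟨χ, heig i χ hχ⟩)
  let b := Module.Basis.ofSpan hR
  have hb : ∀ j, ∃ χ : Characters H, ∀ t, ρ t (b j) = (χ.1 t : ℂ) • b j := fun j =>
    Module.Basis.ofSpan_subset hR ⟨j, rfl⟩
  choose χ hχ using hb
  have : Module.Finite ℂ V := Module.Finite.of_basis β
  exact ⟨_, FiniteDimensional.fintypeBasisIndex b, b, χ, hχ⟩

end eigenbasis

/-! ### Isotypic decomposition -/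

section isotypic

variable {H G Y : Over Base} [GrpObj G] [ModObj G Y]

/-- The group `H` acts trivially on `Y` through `i`. -/
def ActsTrivially (i : H ⟶ G) (Y : Over Base) [ModObj G Y] : Prop :=
  (i ⊗ₘ 𝟙 Y) ≫ γ[G, Y] = snd H Y

variable {i : H ⟶ G}

lemma ActsTrivially.smul (ht : ActsTrivially i Y) (t : Pt H) (y : Pt Y) : (t ≫ i) • y = y := by
  have h1 : lift (t ≫ i) y = lift t y ≫ (i ⊗ₘ 𝟙 Y) := by
    rw [lift_map, Category.comp_id]
  rw [Hom.smul_def, h1, Category.assoc]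
  erw [ht]
  rw [lift_snd]

/-- The action of a point of `H` on the fibres. -/
def fibAct (ht : ActsTrivially i Y) (E : EqBundle G Y) (t : Pt H) (y : Pt Y) :
    E.fiber y →ₗ[ℂ] E.fiber y := E.act (t ≫ i) (ht.smul t y)

lemma IsHom.fibAct (ht : ActsTrivially i Y) {E F : EqBundle G Y}
    {φ : ∀ y, E.fiber y →ₗ[ℂ] F.fiber y} (h : IsHom E F φ) (t : Pt H) (y : Pt Y) (v : E.fiber y) :
    φ y (fibAct ht E t y v) = EquivariantK.fibAct ht F t y (φ y v) :=
  h.equivariant _ _ v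

/-- Equivariance is commutativity of G. Combinations of these endomorphisms will be the isotypic
projections. -/
lemma isHom_fibAct (ht : ActsTrivially i Y) (hG : ∀ g g' : Pt G, g * g' = g' * g)
    (E : EqBundle G Y) (t : Pt H) : IsHom E E (fun y => fibAct ht E t y) := by
  constructor
  · intro b hb c hc k l
    -- Regularity in y comes from restricting the action matrix to the slice y ↦ (i(t), y), on which
    -- both projection and action are the identity of Y.
    let f : Y ⟶ G ⊗ Y := lift (toUnit Y ≫ t ≫ i) (𝟙 Y)
    have hf2 : f ≫ snd G Y = 𝟙 Y := lift_snd _ _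
    have hf3 : f ≫ (γ[G, Y] : G ⊗ Y ⟶ Y) = 𝟙 Y := by
      have h1 : f = lift (toUnit Y ≫ t) (𝟙 Y) ≫ (i ⊗ₘ 𝟙 Y) := by
        rw [lift_map, Category.comp_id, Category.assoc]
      rw [h1, Category.assoc]
      erw [ht]
      rw [lift_snd]
    have h1 := (E.act_regular b hb c hc k l).comp f
    refine (h1.mono (V := b.dom ⊓ c.dom) ?_).congr fun y hy => ?_
    · intro p hp
      refine ⟨?_, ?_⟩
      · change (f ≫ snd G Y).left p ∈ b.dom
        rw [hf2]; exact hp.1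
      · change (f ≫ (γ[G, Y] : G ⊗ Y ⟶ Y)).left p ∈ c.dom
        rw [hf3]; exact hp.2
    · apply EqBundle.entry_congr
      · rw [Category.assoc, lift_fst, ← Category.assoc, toUnit_unique (y ≫ toUnit Y) (𝟙 _),
          Category.id_comp]
      · rw [Category.assoc, hf2, Category.comp_id]
      · rw [Category.assoc]
        erw [hf3]
        rw [Category.comp_id]
  · intro g y z h v
    have aux : ∀ (k k' : Pt G) (hk : k • y = z) (hk' : k' • y = z), k = k' →
        E.act k hk v = E.act k' hk' v := by
      rintro k _ hk hk' rfl; rfl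
    have h1 : ((t ≫ i) * g) • y = z := by rw [mul_smul, h, ht.smul]
    have h2 : (g * (t ≫ i)) • y = z := by rw [mul_smul, ht.smul, h]
    have e1 := E.act_mul (t ≫ i) g h (ht.smul t z) h1 v
    have e2 := E.act_mul g (t ≫ i) (ht.smul t y) h h2 v
    exact e1.symm.trans ((aux _ _ _ _ (hG _ _)).trans e2)

/-- The matrix coefficients of the action of `H` on a fibre are regular functions. -/
lemma regularOn_fibAct (ht : ActsTrivially i Y) (E : EqBundle G Y) {b : Frame Y E.fiber}
    (hb : b ∈ E.atlas) {y : Pt Y} (hy : In y b.dom) (k l : b.I) :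
    RegularOn (X := H) ⊤
      (fun t _ => (b.basis y hy).repr (fibAct ht E t y (b.basis y hy k)) l) := by
  -- The other slice, t ↦ (i(t), y), on which the base point stays fixed.
  let f : H ⟶ G ⊗ Y := lift i (toUnit H ≫ y)
  have hf2 : f ≫ snd G Y = toUnit H ≫ y := lift_snd _ _
  have hf3 : f ≫ (γ[G, Y] : G ⊗ Y ⟶ Y) = toUnit H ≫ y := by
    have h1 : f = lift (𝟙 H) (toUnit H ≫ y) ≫ (i ⊗ₘ 𝟙 Y) := by
      rw [lift_map, Category.comp_id, Category.id_comp]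
    rw [h1, Category.assoc]
    erw [ht]
    rw [lift_snd]
  have hdom : ∀ p : H.left, (toUnit H ≫ y).left p ∈ b.dom := by
    intro p
    rw [Over.comp_left]
    exact hy (show (toUnit H).left p ∈ (⊤ : Base.Opens) from trivial)
  have hpt : ∀ t : Pt H, t ≫ toUnit H ≫ y = y := by
    intro t
    rw [← Category.assoc, toUnit_unique (t ≫ toUnit H) (𝟙 _), Category.id_comp]
  have h1 := (E.act_regular b hb b hb k l).comp f
  refine (h1.mono (V := ⊤) ?_).congr fun t _ => ?_
  · intro p _
    refine ⟨?_, ?_⟩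
    · change (f ≫ snd G Y).left p ∈ b.dom
      rw [hf2]; exact hdom p
    · change (f ≫ (γ[G, Y] : G ⊗ Y ⟶ Y)).left p ∈ b.dom
      rw [hf3]; exact hdom p
  · apply EqBundle.entry_congr
    · rw [Category.assoc, lift_fst]
    · rw [Category.assoc, hf2, hpt]
    · rw [Category.assoc]
      erw [hf3]
      rw [hpt]

variable [GrpObj H]

lemma mem_isotypic (ht : ActsTrivially i Y) (E : EqBundle G Y) {χ : Characters H} {y : Pt Y}
    {v : E.fiber y} : v ∈ isotypic i E χ y ↔ ∀ t, fibAct ht E t y v = (χ.1 t : ℂ) • v :=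
  ⟨fun h t => h t _, fun h t _ => h t⟩

lemma IsHom.mem_isotypic (ht : ActsTrivially i Y) {E F : EqBundle G Y}
    {φ : ∀ y, E.fiber y →ₗ[ℂ] F.fiber y} (h : IsHom E F φ) {χ : Characters H} {y : Pt Y}
    {v : E.fiber y} (hv : v ∈ isotypic i E χ y) : φ y v ∈ isotypic i F χ y := by
  rw [EquivariantK.mem_isotypic ht] at hv ⊢
  intro t
  rw [← h.fibAct ht, hv, map_smul]

variable [IsMonHom i]

lemma fibAct_one (ht : ActsTrivially i Y) (E : EqBundle G Y) (y : Pt Y) :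
    fibAct ht E 1 y = LinearMap.id := by
  have aux : ∀ (g : Pt G) (hg : g • y = y), g = 1 → E.act g hg = LinearMap.id := by
    rintro g hg rfl
    exact LinearMap.ext (E.act_one _ _)
  exact aux _ _ (MonObj.one_comp i)

lemma fibAct_mul (ht : ActsTrivially i Y) (E : EqBundle G Y) (s t : Pt H) (y : Pt Y) :
    fibAct ht E (s * t) y = fibAct ht E s y ∘ₗ fibAct ht E t y := by
  have aux : ∀ (g : Pt G) (hg : g • y = y), g = (s ≫ i) * (t ≫ i) →
      E.act g hg = fibAct ht E s y ∘ₗ fibAct ht E t y := by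
    rintro g hg rfl
    exact LinearMap.ext (E.act_mul _ _ _ _ _)
  exact aux _ _ (MonObj.mul_comp _ _ i)

/-- Matrix coefficients of the action on a fibre are regular on the torus H, hence combinations of
characters, so `exists_eigenbasis` applies. -/
lemma exists_fiber_eigenbasis (hH : IsTorus H) (ht : ActsTrivially i Y) (E : EqBundle G Y)
    (y : Pt Y) :
    ∃ (J : Type) (_ : Fintype J) (w : Module.Basis J ℂ (E.fiber y)) (χ : J → Characters H),
      ∀ j t, fibAct ht E t y (w j) = ((χ j).1 t : ℂ) • w j := by
  obtain ⟨b, hb, hy⟩ := E.cover y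
  exact exists_eigenbasis (fun t => fibAct ht E t y) (fibAct_one ht E y)
    (fun s t => fibAct_mul ht E s t y) (b.basis y hy)
    fun k l => hH.exists_sum_characters (regularOn_fibAct ht E hb hy k l)

end isotypic

/-! ### The isotypic projections -/

lemma IsTorus.mul_comm_pt {T : Over Base} [GrpObj T] (hT : IsTorus T) (t t' : Pt T) :
    t * t' = t' * t :=
  hT.pt_ext fun χ => by rw [map_mul, map_mul, mul_comm]

/-- Characters of a torus are linearly independent on the points of finite order. -/
lemma IsTorus.finsupp_ext {T : Over Base} [GrpObj T] (hT : IsTorus T) {a a' : Characters T →₀ ℂ}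
    (h : ∀ t : Pt T, (∃ N, 0 < N ∧ t ^ N = 1) →
      (a.sum fun χ c => c * χ.1 t) = a'.sum fun χ c => c * χ.1 t) : a = a' := by
  let tors : Submonoid (Pt T) :=
    { carrier := {t | ∃ N, 0 < N ∧ t ^ N = 1}
      one_mem' := ⟨1, one_pos, one_pow 1⟩
      mul_mem' := by
        rintro t t' ⟨N, hN, ht⟩ ⟨N', hN', ht'⟩
        refine ⟨N * N', Nat.mul_pos hN hN', ?_⟩
        rw [(show Commute t t' from hT.mul_comm_pt t t').mul_pow, pow_mul, ht, one_pow,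
          Nat.mul_comm, pow_mul, ht', one_pow, _root_.mul_one] }
  -- Distinct characters remain distinct on the points of finite order, so independence of
  -- characters can be applied to that monoid in place of the whole torus.
  have hinj : Function.Injective (fun χ : Characters T =>
      ((Units.coeHom ℂ).comp χ.1).comp tors.subtype) := by
    intro χ ψ hχψ
    by_contra hne
    obtain ⟨t, ht, ht1⟩ := hT.exists_torsion (χ := χ * ψ⁻¹)
      fun h0 => hne (mul_inv_eq_one.1 h0)
    apply ht1
    have h1 : (χ.1 t : ℂ) = ψ.1 t := DFunLike.congr_fun hχψ (⟨t, ht⟩ : tors)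
    have h2 : χ.1 t = ψ.1 t := Units.ext h1
    change χ.1 t * (ψ.1 t)⁻¹ = 1
    rw [h2, mul_inv_cancel]
  have hli := (linearIndependent_monoidHom tors ℂ).comp _ hinj
  apply hli
  ext t
  have := h t.1 t.2
  simpa [Finsupp.linearCombination_apply, Finsupp.sum, Finset.sum_apply] using this

section isotypic

variable {H G Y : Over Base} [GrpObj H] [GrpObj G] [ModObj G Y] {i : H ⟶ G}

/-- The projections onto the isotypic subspaces of an equivariant vector bundle. -/
structure IsIsotypicProj (i : H ⟶ G) (E : EqBundle G Y)
    (p : Characters H → ∀ y, E.fiber y →ₗ[ℂ] E.fiber y) : Prop where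
  isHom : ∀ χ, IsHom E E (p χ)
  mem : ∀ χ y v, p χ y v ∈ isotypic i E χ y
  apply_of_mem : ∀ χ y, ∀ v ∈ isotypic i E χ y, p χ y v = v
  apply_of_mem_ne : ∀ χ χ' y, χ ≠ χ' → ∀ v ∈ isotypic i E χ' y, p χ y v = 0
  exists_finset : ∃ S : Finset (Characters H),
    (∀ y v, ∑ χ ∈ S, p χ y v = v) ∧ ∀ χ ∉ S, ∀ y v, p χ y v = 0

lemma IsIsotypicProj.isIdem {E : EqBundle G Y}
    {p : Characters H → ∀ y, E.fiber y →ₗ[ℂ] E.fiber y} (hp : IsIsotypicProj i E p)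
    (χ : Characters H) : IsIdem E (p χ) :=
  ⟨hp.isHom χ, fun y v => hp.apply_of_mem χ y _ (hp.mem χ y v)⟩

lemma IsIsotypicProj.range {E : EqBundle G Y}
    {p : Characters H → ∀ y, E.fiber y →ₗ[ℂ] E.fiber y} (hp : IsIsotypicProj i E p)
    (χ : Characters H) (y : Pt Y) : LinearMap.range (p χ y) = isotypic i E χ y := by
  ext v
  constructor
  · rintro ⟨w, rfl⟩
    exact hp.mem χ y w
  · exact fun hv => ⟨v, hp.apply_of_mem χ y v hv⟩

/-- Morphisms of equivariant vector bundles commute with the isotypic projections. -/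
lemma IsIsotypicProj.naturality (ht : ActsTrivially i Y) {E F : EqBundle G Y}
    {p : Characters H → ∀ y, E.fiber y →ₗ[ℂ] E.fiber y}
    {q : Characters H → ∀ y, F.fiber y →ₗ[ℂ] F.fiber y} (hp : IsIsotypicProj i E p)
    (hq : IsIsotypicProj i F q) {φ : ∀ y, E.fiber y →ₗ[ℂ] F.fiber y} (hφ : IsHom E F φ)
    (χ : Characters H) (y : Pt Y) (v : E.fiber y) : φ y (p χ y v) = q χ y (φ y v) := by
  obtain ⟨S, hS, hS'⟩ := hp.exists_finset
  -- Split v into isotypic components. An equivariant map sends each to a vector of the same type,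
  -- so q_χ retains only the image of the χ-component.
  conv_rhs => rw [← hS y v, map_sum, map_sum]
  by_cases hχ : χ ∈ S
  · rw [Finset.sum_eq_single χ (fun ψ _ hψ => hq.apply_of_mem_ne χ ψ y hψ.symm _
      (hφ.mem_isotypic ht (hp.mem ψ y v))) fun h => (h hχ).elim]
    exact (hq.apply_of_mem χ y _ (hφ.mem_isotypic ht (hp.mem χ y v))).symm
  · rw [hS' χ hχ, map_zero]
    refine (Finset.sum_eq_zero fun ψ hψ => hq.apply_of_mem_ne χ ψ y ?_ _
      (hφ.mem_isotypic ht (hp.mem ψ y v))).symm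
    rintro rfl
    exact hχ hψ

lemma IsIsotypicProj.iSupIndep {E : EqBundle G Y}
    {p : Characters H → ∀ y, E.fiber y →ₗ[ℂ] E.fiber y} (hp : IsIsotypicProj i E p)
    (S : Finset (Characters H)) (y : Pt Y) : iSupIndep (fun χ : S => isotypic i E χ y) := by
  rw [iSupIndep_def]
  intro χ
  rw [Submodule.disjoint_def]
  intro v hv hv'
  have hle : ⨆ ψ, ⨆ (_ : ψ ≠ χ), isotypic i E (ψ : S).1 y ≤ LinearMap.ker (p χ y) := by
    refine iSup₂_le fun ψ hψ w hw => ?_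
    exact hp.apply_of_mem_ne χ ψ y (fun h => hψ (Subtype.ext h.symm)) w hw
  rw [← hp.apply_of_mem χ y v hv]
  exact hle hv'

/-- An eigenvector is a combination of basis eigenvectors with the same character. -/
lemma exists_eq_of_mem_isotypic (ht : ActsTrivially i Y) {E : EqBundle G Y} {y : Pt Y} {J : Type}
    (w : Module.Basis J ℂ (E.fiber y)) {χ : J → Characters H}
    (hw : ∀ j t, fibAct ht E t y (w j) = ((χ j).1 t : ℂ) • w j) {ψ : Characters H}
    {v : E.fiber y} (hv : v ∈ isotypic i E ψ y) (h0 : v ≠ 0) : ∃ j, χ j = ψ := by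
  obtain ⟨j, hj⟩ : ∃ j, w.repr v j ≠ 0 := by
    by_contra! h
    exact h0 (w.repr.map_eq_zero_iff.1 (Finsupp.ext h))
  refine ⟨j, coe_char_injective fun t => ?_⟩
  have h1 : w.repr (fibAct ht E t y v) j = (χ j).1 t * w.repr v j := by
    have h2 : (Finsupp.lapply j ∘ₗ w.repr.toLinearMap ∘ₗ fibAct ht E t y) =
        ((χ j).1 t : ℂ) • (Finsupp.lapply j ∘ₗ w.repr.toLinearMap) := by
      refine w.ext fun k => ?_
      rcases eq_or_ne k j with rfl | hk
      · simp [hw]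
      · simp [hw, hk]
    exact LinearMap.congr_fun h2 v
  rw [(mem_isotypic ht E).1 hv, map_smul, Finsupp.smul_apply, smul_eq_mul] at h1
  exact (mul_right_cancel₀ hj h1).symm

variable [IsMonHom i]

/-- The action of a point of finite order has the same trace in all fibres. -/
lemma trace_fibAct_eq [LocallyOfFiniteType Y.hom] [IrreducibleSpace Y.left] (hH : IsTorus H)
    (hG : ∀ g g' : Pt G, g * g' = g' * g) (ht : ActsTrivially i Y) (E : EqBundle G Y) {t : Pt H}
    {N : ℕ} (hN : 0 < N) (htN : t ^ N = 1) (y y' : Pt Y) :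
    LinearMap.trace ℂ _ (fibAct ht E t y) = LinearMap.trace ℂ _ (fibAct ht E t y') := by
  classical
  have key : ∀ y, ∃ V : Y.left.Opens, In y V ∧ ∀ z, In z V →
      LinearMap.trace ℂ _ (fibAct ht E t z) = LinearMap.trace ℂ _ (fibAct ht E t y) := by
    intro y
    obtain ⟨b, hb, hy⟩ := E.cover y
    -- The eigenvalues of t are N-th roots of unity, so over one frame the trace is a sum of a fixed
    -- number of elements of a finite set.
    let R : Set ℂ := {z | z ^ N = 1}
    have hR : R.Finite := by
      refine ((Polynomial.nthRoots N (1 : ℂ)).toFinset.finite_toSet).subset fun z hz => ?_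
      rw [Finset.mem_coe, Multiset.mem_toFinset, Polynomial.mem_nthRoots hN]
      exact hz
    have hfin : ((fun f : b.I → ℂ => ∑ k, f k) '' Set.pi Set.univ fun _ => R).Finite :=
      (Set.Finite.pi fun _ => hR).image _
    have hreg : RegularOn b.dom (fun z _ => LinearMap.trace ℂ _ (fibAct ht E t z)) := by
      refine (RegularOn.sum Finset.univ fun k =>
        (((isHom_fibAct ht hG E t).regular b hb b hb).mono (V := b.dom)
          (le_inf le_rfl le_rfl) k k)).congr fun z hz => ?_
      rw [LinearMap.trace_eq_matrix_trace ℂ (b.basis z hz), Matrix.trace]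
      simp [LinearMap.toMatrix_apply]
    obtain ⟨V, hV, hyV, h⟩ := hreg.locally_constant hfin (fun z hz => by
      obtain ⟨J, _, w, χ, hw⟩ := exists_fiber_eigenbasis hH ht E z
      let e := (b.basis z hz).indexEquiv w
      refine ⟨fun k => (χ (e k)).1 t, fun k _ => ?_, ?_⟩
      · change ((χ (e k)).1 t : ℂ) ^ N = 1
        rw [← Units.val_pow_eq_pow_val, ← map_pow, htN, map_one, Units.val_one]
      · rw [LinearMap.trace_eq_matrix_trace ℂ w, Matrix.trace]
        refine (Equiv.sum_comp e fun j => ((χ j).1 t : ℂ)).trans ?_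
        simp [LinearMap.toMatrix_apply, hw]) y hy
    exact ⟨V, hyV, fun z hz => h z hz⟩
  obtain ⟨V, hyV, h⟩ := key y
  obtain ⟨V', hyV', h'⟩ := key y'
  -- Irreducibility turns local constancy into constancy: the two neighbourhoods share a complex
  -- point.
  obtain ⟨z, hz, hz'⟩ := exists_in_of_in hyV hyV'
  rw [← h z hz, ← h' z hz']

/-- The characters that occur in the fibres of an equivariant vector bundle on an irreducible
variety form a finite set. -/
lemma exists_finset_characters [LocallyOfFiniteType Y.hom] [IrreducibleSpace Y.left]
    (hH : IsTorus H) (hG : ∀ g g' : Pt G, g * g' = g' * g) (ht : ActsTrivially i Y)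
    (E : EqBundle G Y) : ∃ S : Finset (Characters H), ∀ y, ∃ (J : Type) (_ : Fintype J)
      (w : Module.Basis J ℂ (E.fiber y)) (χ : J → Characters H),
      (∀ j t, fibAct ht E t y (w j) = ((χ j).1 t : ℂ) • w j) ∧ ∀ j, χ j ∈ S := by
  classical
  choose J fJ w χ hw using exists_fiber_eigenbasis hH ht E
  obtain hemp | ⟨⟨y₀⟩⟩ := isEmpty_or_nonempty (Pt Y)
  · exact ⟨∅, fun y => (hemp.false y).elim⟩
  -- The multiplicities of the characters in the fibre over y. The traces at points of finite order
  -- determine m(y), so it does not depend on y, and the characters occurring over a single point y₀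
  -- suffice.
  let m : Pt Y → Characters H →₀ ℂ := fun y => ∑ j, Finsupp.single (χ y j) 1
  have hm : ∀ y, m y = m y₀ := by
    intro y
    refine hH.finsupp_ext fun t ⟨N, hN, htN⟩ => ?_
    have hsum : ∀ y, ((m y).sum fun ψ c => c * ψ.1 t) =
        LinearMap.trace ℂ _ (fibAct ht E t y) := by
      intro y
      rw [LinearMap.trace_eq_matrix_trace ℂ (w y), Matrix.trace,
        ← Finsupp.sum_finsetSum_index (by simp) (by intros; ring)]
      simp [LinearMap.toMatrix_apply, hw]
    rw [hsum, hsum]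
    exact trace_fibAct_eq hH hG ht E hN htN y y₀
  refine ⟨Finset.univ.image (χ y₀), fun y => ⟨J y, fJ y, w y, χ y, hw y, fun j => ?_⟩⟩
  by_contra hj
  have h1 : m y (χ y j) ≠ 0 := by
    have h2 : m y (χ y j) = ((Finset.univ.filter fun k => χ y k = χ y j).card : ℂ) := by
      simp [m, Finsupp.finsetSum_apply, Finsupp.single_apply, Finset.sum_boole]
    rw [h2, Nat.cast_ne_zero, Finset.card_ne_zero]
    exact ⟨j, by simp⟩
  apply h1
  rw [hm, Finsupp.finsetSum_apply]
  refine Finset.sum_eq_zero fun k _ => ?_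
  rw [Finsupp.single_apply, if_neg]
  rintro hk
  exact hj (hk ▸ Finset.mem_image_of_mem _ (Finset.mem_univ k))

/-- The projection onto the χ-part is a fixed combination of actions of points of H, with
coefficients dual to the characters in S. As S is common to all fibres, the combination does not
depend on y, which gives regularity without any argument on ranks of eigenspaces. -/
lemma exists_isotypicProj [LocallyOfFiniteType Y.hom] [IrreducibleSpace Y.left]
    (hH : IsTorus H) (hG : ∀ g g' : Pt G, g * g' = g' * g) (ht : ActsTrivially i Y)
    (E : EqBundle G Y) : ∃ p, IsIsotypicProj i E p := by
  classical
  obtain ⟨S, hS⟩ := exists_finset_characters hH hG ht E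
  obtain ⟨c, hc⟩ := exists_dual_points S
  let p : Characters H → ∀ y, E.fiber y →ₗ[ℂ] E.fiber y := fun χ y =>
    if χ ∈ S then ∑ t ∈ (c χ).support, c χ t • fibAct ht E t y else 0
  have hp : ∀ χ ψ y, ψ ∈ S → ∀ v ∈ isotypic i E ψ y, p χ y v = if χ = ψ then v else 0 := by
    intro χ ψ y hψ v hv
    by_cases hχ : χ ∈ S
    · have h1 : p χ y v = ((c χ).sum fun t a => a * ψ.1 t) • v := by
        simp only [p, if_pos hχ, LinearMap.sum_apply, LinearMap.smul_apply,
          (mem_isotypic ht E).1 hv, smul_smul, Finsupp.sum, Finset.sum_smul]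
      rw [h1, hc χ hχ ψ hψ, ite_smul, one_smul, zero_smul]
      simp only [eq_comm]
    · rw [if_neg (fun h : χ = ψ => hχ (h ▸ hψ))]
      simp [p, hχ]
  -- The restriction ψ ∈ S can be dropped, since a nonzero eigenvector has a character occurring in
  -- the fibre, and these all lie in S.
  have hp' : ∀ χ ψ y, ∀ v ∈ isotypic i E ψ y, p χ y v = if χ = ψ then v else 0 := by
    intro χ ψ y v hv
    by_cases h0 : v = 0
    · simp [h0]
    obtain ⟨J, _, w, κ, hw, hκ⟩ := hS y
    obtain ⟨j, rfl⟩ := exists_eq_of_mem_isotypic ht w hw hv h0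
    exact hp χ _ y (hκ j) v hv
  refine ⟨p, fun χ => ?_, fun χ y v => ?_, fun χ y v hv => by simp [hp' χ χ y v hv],
    fun χ ψ y hne v hv => by simp [hp' χ ψ y v hv, hne], S, fun y v => ?_,
    fun χ hχ y v => by simp [p, hχ]⟩
  · by_cases hχ : χ ∈ S
    · simp only [p, if_pos hχ]
      exact IsHom.sum _ fun t _ => (isHom_fibAct ht hG E t).smul _
    · simp only [p, if_neg hχ]
      exact IsHom.zero E E
  · obtain ⟨J, _, w, κ, hw, hκ⟩ := hS y
    rw [← w.sum_repr v, map_sum]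
    refine Submodule.sum_mem _ fun j _ => ?_
    have hj : w j ∈ isotypic i E (κ j) y := (mem_isotypic ht E).2 (hw j)
    rw [map_smul, hp' χ _ y _ hj]
    refine Submodule.smul_mem _ _ ?_
    split_ifs with h
    · exact h ▸ hj
    · exact Submodule.zero_mem _
  · obtain ⟨J, _, w, κ, hw, hκ⟩ := hS y
    have : ∑ χ ∈ S, p χ y = LinearMap.id := by
      refine w.ext fun j => ?_
      have hj : w j ∈ isotypic i E (κ j) y := (mem_isotypic ht E).2 (hw j)
      simp [hp' _ _ y _ hj, hκ]
    rw [← LinearMap.sum_apply, this, LinearMap.id_apply]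

end isotypic

/-! ### Isotypic parts of classes -/

section isotypicPart

variable {H G Y : Over Base} [GrpObj H] [GrpObj G] [ModObj G Y] {i : H ⟶ G}

/-- By naturality an isomorphism and its inverse restrict to the isotypic parts. Applied to the
identity of E, this shows that the part does not depend on the chosen projections. -/
lemma IsIsotypicProj.isIsom_image (ht : ActsTrivially i Y) {E F : EqBundle G Y}
    {p : Characters H → ∀ y, E.fiber y →ₗ[ℂ] E.fiber y}
    {q : Characters H → ∀ y, F.fiber y →ₗ[ℂ] F.fiber y} (hp : IsIsotypicProj i E p)
    (hq : IsIsotypicProj i F q) (h : IsIsom E F) (χ : Characters H) :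
    IsIsom (E.image (p χ) (hp.isIdem χ)) (F.image (q χ) (hq.isIdem χ)) := by
  obtain ⟨e, h1, h2⟩ := h
  refine isIsom_of_inverse
    (((hp.isIdem χ).isHom_subtype.comp h1).comp (hq.isIdem χ).isHom_rangeRestrict)
    (((hq.isIdem χ).isHom_subtype.comp h2).comp (hp.isIdem χ).isHom_rangeRestrict)
    (fun y v => Subtype.ext ?_) (fun y v => Subtype.ext ?_)
  · change p χ y ((e y).symm (q χ y (e y v.1))) = v.1
    have h3 := hp.naturality ht hq h1 χ y v.1
    rw [LinearEquiv.coe_coe] at h3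
    rw [← h3, LinearEquiv.symm_apply_apply, (hp.isIdem χ).idem,
      (hp.isIdem χ).apply_of_mem v.2]
  · change q χ y (e y (p χ y ((e y).symm v.1))) = v.1
    have h3 := hq.naturality ht hp h2 χ y v.1
    rw [LinearEquiv.coe_coe] at h3
    rw [← h3, LinearEquiv.apply_symm_apply, (hq.isIdem χ).idem,
      (hq.isIdem χ).apply_of_mem v.2]

/-- The parts are images of idempotents natural in the bundle: a preimage in the full sequence
becomes one in the χ-parts after applying the projection. -/
lemma IsIsotypicProj.isShortExact_image (ht : ActsTrivially i Y) {E' E E'' : EqBundle G Y}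
    {p' : Characters H → ∀ y, E'.fiber y →ₗ[ℂ] E'.fiber y}
    {p : Characters H → ∀ y, E.fiber y →ₗ[ℂ] E.fiber y}
    {p'' : Characters H → ∀ y, E''.fiber y →ₗ[ℂ] E''.fiber y} (hp' : IsIsotypicProj i E' p')
    (hp : IsIsotypicProj i E p) (hp'' : IsIsotypicProj i E'' p'') (h : IsShortExact E' E E'')
    (χ : Characters H) : IsShortExact (E'.image (p' χ) (hp'.isIdem χ))
      (E.image (p χ) (hp.isIdem χ)) (E''.image (p'' χ) (hp''.isIdem χ)) := by
  obtain ⟨a, b, ha, hb, hex⟩ := h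
  have ha' := fun y v => hp'.naturality ht hp ha χ y v
  have hb' := fun y v => hp.naturality ht hp'' hb χ y v
  refine ⟨_, _, ((hp'.isIdem χ).isHom_subtype.comp ha).comp (hp.isIdem χ).isHom_rangeRestrict,
    ((hp.isIdem χ).isHom_subtype.comp hb).comp (hp''.isIdem χ).isHom_rangeRestrict,
    fun y => ⟨?_, fun v => ⟨fun hv => ?_, ?_⟩, ?_⟩⟩
  · intro v w hvw
    have h1 : p χ y (a y v.1) = p χ y (a y w.1) := congrArg Subtype.val hvw
    rw [← ha', ← ha', (hp'.isIdem χ).apply_of_mem v.2, (hp'.isIdem χ).apply_of_mem w.2] at h1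
    exact Subtype.ext ((hex y).1 h1)
  · have h1 : p'' χ y (b y v.1) = 0 := congrArg Subtype.val hv
    rw [← hb', (hp.isIdem χ).apply_of_mem v.2] at h1
    obtain ⟨w, hw⟩ := ((hex y).2.1 v.1).1 h1
    refine ⟨⟨p' χ y w, w, rfl⟩, Subtype.ext ?_⟩
    change p χ y (a y (p' χ y w)) = v.1
    rw [ha', hw, (hp.isIdem χ).idem, (hp.isIdem χ).apply_of_mem v.2]
  · rintro ⟨w, rfl⟩
    apply Subtype.ext
    change p'' χ y (b y (p χ y (a y w.1))) = 0
    rw [← ha', ((hex y).2.1 _).2 ⟨_, rfl⟩, map_zero]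
  · rintro ⟨_, v, rfl⟩
    obtain ⟨w, rfl⟩ := (hex y).2.2 v
    refine ⟨⟨p χ y w, w, rfl⟩, Subtype.ext ?_⟩
    change p'' χ y (b y (p χ y w)) = p'' χ y (b y w)
    rw [hb', (hp''.isIdem χ).idem]

/-- Taking isotypic parts is well defined on `K_G(Y)`. -/
lemma exists_isotypicPart [IsMonHom i] [LocallyOfFiniteType Y.hom] [IrreducibleSpace Y.left]
    (hH : IsTorus H) (hG : ∀ g g' : Pt G, g * g' = g' * g) (ht : ActsTrivially i Y)
    (χ : Characters H) : ∃ P : KRing G Y →+ KRing G Y, ∀ (E : EqBundle G Y)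
      (p : Characters H → ∀ y, E.fiber y →ₗ[ℂ] E.fiber y) (hp : IsIsotypicProj i E p),
      P E.cl = (E.image (p χ) (hp.isIdem χ)).cl := by
  choose p hp using fun E : EqBundle G Y => exists_isotypicProj hH hG ht E
  obtain ⟨P, hP⟩ := KRing.exists_addHom (fun E => (E.image (p E χ) ((hp E).isIdem χ)).cl)
    (fun E F h => EqBundle.cl_eq ((hp E).isIsom_image ht (hp F) h χ))
    (fun E' E E'' h => EqBundle.cl_exact ((hp E').isShortExact_image ht (hp E) (hp E'') h χ))
  exact ⟨P, fun E q hq => (hP E).trans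
    (EqBundle.cl_eq ((hp E).isIsom_image ht hq (IsIsom.refl E) χ))⟩

end isotypicPart

/-! ### Twists of pullbacks along a quotient -/

section lid

variable {A A' B B' : Type} [AddCommGroup A] [Module ℂ A] [AddCommGroup A'] [Module ℂ A']
  [AddCommGroup B] [Module ℂ B] [AddCommGroup B'] [Module ℂ B'] {I J : Type}

lemma map_smul_id_apply {c c' : ℂ} (hc : c = c') {φ : A →ₗ[ℂ] A} (hφ : φ = LinearMap.id)
    (v : ℂ ⊗[ℂ] A) : TensorProduct.map (c • LinearMap.id) φ v = c' • v := by
  rw [hc, hφ, TensorProduct.map_smul_left, TensorProduct.map_id]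
  rfl

lemma lid_trans_map_smul {c : ℂ} {φ : A →ₗ[ℂ] A'} {ψ : B →ₗ[ℂ] B'} {e : A ≃ₗ[ℂ] B}
    {e' : A' ≃ₗ[ℂ] B'} (h : ∀ a, c • e' (φ a) = ψ (e a)) (v : ℂ ⊗[ℂ] A) :
    (TensorProduct.lid ℂ A' ≪≫ₗ e') (TensorProduct.map (c • LinearMap.id) φ v) =
      ψ ((TensorProduct.lid ℂ A ≪≫ₗ e) v) := by
  rw [TensorProduct.map_smul_left, LinearMap.smul_apply, LinearEquiv.trans_apply, map_smul,
    map_smul, lid_act, h, LinearEquiv.trans_apply]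

lemma lid_trans_entry (a : Module.Basis I ℂ A) (b : Module.Basis J ℂ B) (e : A ≃ₗ[ℂ] B)
    (u : Unit) (k : I) (l : J) :
    b.repr ((TensorProduct.lid ℂ A ≪≫ₗ e)
      ((Module.Basis.singleton Unit ℂ).tensorProduct a (u, k))) l = b.repr (e (a k)) l := by
  simp [Module.Basis.tensorProduct_apply]

lemma lid_trans_symm_entry (a : Module.Basis I ℂ A) (b : Module.Basis J ℂ B) (e : A ≃ₗ[ℂ] B)
    (u : Unit) (k : I) (l : J) :
    ((Module.Basis.singleton Unit ℂ).tensorProduct a).repr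
      ((TensorProduct.lid ℂ A ≪≫ₗ e).symm (b l)) (u, k) = a.repr (e.symm (b l)) k := by
  simp

end lid

lemma actsTrivially_point {H T : Over Base} [GrpObj T] (i : H ⟶ T) :
    ActsTrivially i (𝟙_ (Over Base)) :=
  toUnit_unique _ _

section twist

variable {H T Q Y : Over Base} [GrpObj H] [GrpObj T] [GrpObj Q] {i : H ⟶ T} {π : T ⟶ Q}
  {σ : Q ⟶ T} [ModObj Q Y] [ModObj T Y]

/-- T acts on Y through π, and π ∘ i is trivial. -/
lemma IsExactSeq.actsTrivially (hex : IsExactSeq i π) (hY : IsEquivariant π (𝟙 Y)) :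
    ActsTrivially i Y := by
  have h1 : (γ[T, Y] : T ⊗ Y ⟶ Y) = (π ⊗ₘ 𝟙 Y) ≫ γ[Q, Y] := by
    refine Eq.trans ?_ hY.symm
    rw [Category.comp_id]
  rw [ActsTrivially, h1, ← Category.assoc, tensorHom_comp_tensorHom, hex.kernel.w,
    ← tensorHom_comp_tensorHom, Category.assoc]
  have h2 : (η[Q] ⊗ₘ 𝟙 Y) ≫ γ[Q, Y] = snd _ _ := by
    rw [tensorHom_id, ← leftUnitor_hom]
    exact ModObj.one_smul (M := Q) Y
  erw [h2]
  simp

/-- Restricting the T-action along σ gives back the Q-action because σ is a section of π. This is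
what allows a T-bundle on Y to be restricted along σ to a Q-bundle on the same Y. -/
lemma IsEquivariant.of_section (hY : IsEquivariant π (𝟙 Y)) (hσ : σ ≫ π = 𝟙 Q) :
    IsEquivariant σ (𝟙 Y) := by
  have h1 : (γ[T, Y] : T ⊗ Y ⟶ Y) = (π ⊗ₘ 𝟙 Y) ≫ γ[Q, Y] := by
    refine Eq.trans ?_ hY.symm
    rw [Category.comp_id]
  rw [IsEquivariant, h1, ← Category.assoc, tensorHom_comp_tensorHom, hσ, Category.comp_id,
    id_tensorHom_id, Category.id_comp, Category.comp_id]

variable [IsMonHom π]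

/-- The pullback of a bundle along the quotient `π`, twisted by a character. -/
abbrev EqBundle.twist (hY : IsEquivariant π (𝟙 Y)) (ψ : Characters T) (F : EqBundle Q Y) :
    EqBundle T Y :=
  ((charBundle ψ).pull (isEquivariant_toUnit T Y)).tensor (F.pull hY)

lemma EqBundle.cl_twist (hY : IsEquivariant π (𝟙 Y)) (ψ : Characters T) (F : EqBundle Q Y) :
    (F.twist hY ψ).cl = structureHom T Y (expChar ψ) * pullK hY F.cl := by
  rw [← EqBundle.cl_mul, structureHom, expChar, pullK_cl, pullK_cl]

/-- H acts trivially on a pullback along π, so on the twist it acts only through the restriction of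
ψ. -/
lemma IsExactSeq.mem_isotypic_twist [IsMonHom i] (hex : IsExactSeq i π)
    (hY : IsEquivariant π (𝟙 Y)) {ψ : Characters T} {χ : Characters H}
    (hψ : Characters.res i ψ = χ) (F : EqBundle Q Y) (y : Pt Y) (v : (F.twist hY ψ).fiber y) :
    v ∈ isotypic i (F.twist hY ψ) χ y := by
  intro t h
  have h1 : ∀ (k : Pt Q) (hk : k • (y ≫ 𝟙 Y) = y ≫ 𝟙 Y), k = 1 → F.act k hk = LinearMap.id := by
    rintro k hk rfl
    exact LinearMap.ext (F.act_one _ _)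
  have h2 : (ψ.1 ((t ≫ i) ≫ 𝟙 T) : ℂ) = χ.1 t := by
    rw [Category.comp_id, ← hψ]
    rfl
  exact map_smul_id_apply h2
    (h1 _ (hY.smul h) (by rw [Category.assoc]; exact hex.comp_eq_one t)) v

/-- A bundle on which the kernel acts by a character is a twist of a pullback. -/
lemma isIsom_twist [IsMonHom i] {r : T ⟶ H} [IsMonHom r] [IsMonHom σ]
    (ht : ActsTrivially i Y)
    (hY : IsEquivariant π (𝟙 Y)) (hσ : IsEquivariant σ (𝟙 Y)) {χ : Characters H}
    (hdec : ∀ t : Pt T, (t ≫ π ≫ σ) * (t ≫ r ≫ i) = t) (E : EqBundle T Y)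
    (hE : ∀ y v, v ∈ isotypic i E χ y) :
    IsIsom ((E.pull hσ).twist hY (Characters.res r χ)) E := by
  have hid : ∀ y : Pt Y, (y ≫ 𝟙 Y) ≫ 𝟙 Y = y := fun y => by
    rw [Category.comp_id, Category.comp_id]
  let e : ∀ y : Pt Y, ℂ ⊗[ℂ] E.fiber ((y ≫ 𝟙 Y) ≫ 𝟙 Y) ≃ₗ[ℂ] E.fiber y := fun y =>
    TensorProduct.lid ℂ _ ≪≫ₗ E.cast (hid y)
  have hequiv : ∀ (g : Pt T) {y z : Pt Y} (h : g • y = z)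
      (v : ℂ ⊗[ℂ] E.fiber ((y ≫ 𝟙 Y) ≫ 𝟙 Y)),
      e z (((E.pull hσ).twist hY (Characters.res r χ)).act g h v) = E.act g h (e y v) := by
    intro g y z h v
    refine lid_trans_map_smul (φ := E.act ((g ≫ π) ≫ σ) (hσ.smul (hY.smul h)))
      (e := E.cast (hid y)) (e' := E.cast (hid z)) (ψ := E.act g h) (fun w => ?_) v
    have h3 : ((g ≫ π) ≫ σ) • y = z := by
      have := hσ.smul (hY.smul h)
      rwa [hid, hid] at this
    have h4 : ∀ (k : Pt T) (hk : k • y = z) (w : E.fiber y), k = g →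
        E.act k hk w = E.act g h w := by
      rintro k hk w rfl; rfl
    -- In g = σ(π(g)) i(r(g)) the second factor acts on E by χ(r(g)), which is exactly the twisting
    -- character; the first gives the action on the pullback along π of the restriction along σ.
    have h5 : (((g ≫ π) ≫ σ) * ((g ≫ r) ≫ i)) = g := by
      rw [Category.assoc, Category.assoc, hdec]
    have h7 : (((g ≫ π) ≫ σ) * ((g ≫ r) ≫ i)) • y = z := by rw [h5, h]
    rw [E.cast_act rfl (hid y) (hid z) _ h3, ← h4 _ h7 _ h5,
      E.act_mul _ _ (ht.smul (g ≫ r) y) h3 h7, hE y _ (g ≫ r), map_smul, Category.comp_id]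
    rfl
  refine ⟨e, ⟨?_, hequiv⟩, ⟨?_, fun g y z h v => ?_⟩⟩
  · rintro _ ⟨_, ⟨_, rfl, rfl⟩, _, ⟨_, ⟨b, hb, rfl⟩, rfl⟩, rfl⟩ c hc ⟨u, k⟩ l
    refine ((E.transition b hb c hc k l).mono ?_).congr fun y hy => ?_
    · exact fun _ h => ⟨h.1.2, h.2⟩
    · exact (lid_trans_entry _ _ _ u k l).trans (E.repr_cast b c (hid y) _ _ _ k l)
  · rintro c hc _ ⟨_, ⟨_, rfl, rfl⟩, _, ⟨_, ⟨b, hb, rfl⟩, rfl⟩, rfl⟩ k ⟨u, l⟩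
    refine ((((E.transition c hc b hb k l).comp (𝟙 Y)).comp (𝟙 Y)).mono ?_).congr fun y hy => ?_
    · exact fun _ h => ⟨h.1, h.2.2⟩
    · exact (lid_trans_symm_entry _ _ _ u l k).trans (E.repr_cast_symm c b (hid y) _ _ _ k l)
  · exact (LinearEquiv.symm_apply_eq (e z)).2
      ((congrArg (E.act g h) ((e y).apply_symm_apply v)).symm.trans (hequiv g h _).symm)

end twist

/-! ### Decomposition of classes -/

section decomposition

variable {H T Q Y : Over Base} [GrpObj H] [GrpObj T] [GrpObj Q] {i : H ⟶ T} {π : T ⟶ Q}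
  {σ : Q ⟶ T} [ModObj Q Y] [ModObj T Y]

lemma IsIsotypicProj.mem_isotypic_image {E : EqBundle T Y}
    {p : Characters H → ∀ y, E.fiber y →ₗ[ℂ] E.fiber y} (hp : IsIsotypicProj i E p)
    (χ : Characters H) (y : Pt Y) (v : (E.image (p χ) (hp.isIdem χ)).fiber y) :
    v ∈ isotypic i (E.image (p χ) (hp.isIdem χ)) χ y := by
  intro t h
  have h1 : v.1 ∈ isotypic i E χ y := hp.range χ y ▸ v.2
  exact Subtype.ext (h1 t h)

variable [IsMonHom i] [IsMonHom π] [IsMonHom σ] {r : T ⟶ H} [IsMonHom r]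

lemma IsIsotypicProj.isIsom_twist_image (ht : ActsTrivially i Y) (hY : IsEquivariant π (𝟙 Y))
    (hσ : IsEquivariant σ (𝟙 Y)) (hdec : ∀ t : Pt T, (t ≫ π ≫ σ) * (t ≫ r ≫ i) = t)
    {E : EqBundle T Y} {p : Characters H → ∀ y, E.fiber y →ₗ[ℂ] E.fiber y}
    (hp : IsIsotypicProj i E p) (χ : Characters H) :
    IsIsom (((E.image (p χ) (hp.isIdem χ)).pull hσ).twist hY (Characters.res r χ))
      (E.image (p χ) (hp.isIdem χ)) :=
  isIsom_twist ht hY hσ hdec _ (hp.mem_isotypic_image χ)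

/-- The orthogonal idempotents split the class of E, and each summand is a twist of a pullback along
π. -/
lemma IsIsotypicProj.cl_eq_sum (ht : ActsTrivially i Y) (hY : IsEquivariant π (𝟙 Y))
    (hσ : IsEquivariant σ (𝟙 Y)) (hdec : ∀ t : Pt T, (t ≫ π ≫ σ) * (t ≫ r ≫ i) = t)
    {E : EqBundle T Y} {p : Characters H → ∀ y, E.fiber y →ₗ[ℂ] E.fiber y}
    (hp : IsIsotypicProj i E p) {S : Finset (Characters H)}
    (hS : ∀ y v, ∑ χ ∈ S, p χ y v = v) :
    E.cl = ∑ χ ∈ S, pullK hY ((E.image (p χ) (hp.isIdem χ)).pull hσ).cl *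
      structureHom T Y (expChar (Characters.res r χ)) := by
  classical
  rw [cl_eq_sum_image S p hp.isIdem
    (fun χ _ ψ _ hne y v => hp.apply_of_mem_ne χ ψ y hne _ (hp.mem ψ y v)) hS]
  refine Finset.sum_congr rfl fun χ _ => ?_
  rw [← EqBundle.cl_eq (hp.isIsom_twist_image ht hY hσ hdec χ), EqBundle.cl_twist, mul_comm]

/-- `K_T(Y)` is generated by the products of classes pulled back along `π` and characters. -/
lemma mem_closure_pullK_mul_expChar [LocallyOfFiniteType Y.hom] [IrreducibleSpace Y.left]
    (hH : IsTorus H) (hT : IsTorus T) (ht : ActsTrivially i Y) (hY : IsEquivariant π (𝟙 Y))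
    (hσ : IsEquivariant σ (𝟙 Y)) (hdec : ∀ t : Pt T, (t ≫ π ≫ σ) * (t ≫ r ≫ i) = t)
    (x : KRing T Y) : x ∈ AddSubgroup.closure {z | ∃ (a : KRing Q Y) (χ : Characters H),
      z = pullK hY a * structureHom T Y (expChar (Characters.res r χ))} := by
  induction x using KRing.induction with
  | cl E =>
    obtain ⟨p, hp⟩ := exists_isotypicProj hH hT.mul_comm_pt ht E
    obtain ⟨S, hS, -⟩ := hp.exists_finset
    rw [hp.cl_eq_sum ht hY hσ hdec hS]
    exact sum_mem fun χ _ => AddSubgroup.subset_closure ⟨_, χ, rfl⟩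
  | zero => exact zero_mem _
  | neg x hx => exact neg_mem hx
  | add x y hx hy => exact add_mem hx hy

/-- The coefficient maps of the isotypic decomposition. -/
lemma exists_coefficient [LocallyOfFiniteType Y.hom] [IrreducibleSpace Y.left]
    (hex : IsExactSeq i π) (hH : IsTorus H) (hT : IsTorus T) (hY : IsEquivariant π (𝟙 Y))
    {s : Characters H →* Characters T} (hs : ∀ χ, Characters.res i (s χ) = χ)
    (hσπ : σ ≫ π = 𝟙 Q) (hσs : ∀ χ, Characters.res σ (s χ) = 1) (χ : Characters H) :
    ∃ Ψ : KRing T Y →+ KRing Q Y,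
      (∀ a, Ψ (pullK hY a * structureHom T Y (expChar (s χ))) = a) ∧
      ∀ a ψ, ψ ≠ χ → Ψ (pullK hY a * structureHom T Y (expChar (s ψ))) = 0 := by
  have ht := hex.actsTrivially hY
  have hσ := hY.of_section hσπ
  obtain ⟨P, hP⟩ := exists_isotypicPart hH hT.mul_comm_pt ht χ
  have hprod : ∀ (F : EqBundle Q Y) ψ, pullK hY F.cl * structureHom T Y (expChar (s ψ)) =
      (F.twist hY (s ψ)).cl := fun F ψ => by rw [EqBundle.cl_twist, mul_comm]
  -- Restriction along σ undoes both factors: σ^*π^* is the identity, and s(χ) becomes trivial on Q.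
  have h1 : ∀ a, pullK hσ (pullK hY a * structureHom T Y (expChar (s χ))) = a := by
    intro a
    have h2 : pullK hσ (structureHom T Y (expChar (s χ))) = 1 := by
      have h3 : pullK hσ (structureHom T Y (expChar (s χ))) =
          structureHom Q Y (resRep σ (expChar (s χ))) := by
        rw [structureHom, structureHom, resRep, pullK_pullK, pullK_pullK]
        exact pullK_congr _ _ (by rw [Category.id_comp, Category.comp_id]) (toUnit_unique _ _) _
      rw [h3, resRep_expChar, hσs, expChar_one, map_one]
    rw [map_mul, h2, _root_.mul_one, pullK_pullK]
    exact pullK_eq_self _ hσπ (Category.comp_id _) a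
  -- The χ-part leaves products with e^{s(χ)} unchanged and kills those with e^{s(ψ)} for ψ ≠ χ; σ^*
  -- then extracts the coefficient.
  refine ⟨(pullK hσ).toAddMonoidHom.comp P, fun a => ?_, fun a ψ hψ => ?_⟩
  · change pullK hσ (P _) = a
    have h2 : P (pullK hY a * structureHom T Y (expChar (s χ))) =
        pullK hY a * structureHom T Y (expChar (s χ)) := by
      induction a using KRing.induction with
      | cl F =>
        rw [hprod]
        obtain ⟨p, hp⟩ := exists_isotypicProj hH hT.mul_comm_pt ht (F.twist hY (s χ))
        rw [hP _ p hp]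
        exact EqBundle.cl_eq ((hp.isIdem χ).isIsom_of_eq_id fun y v =>
          hp.apply_of_mem χ y v (hex.mem_isotypic_twist hY (hs χ) F y v))
      | zero => rw [map_zero, zero_mul, map_zero]
      | neg x hx => rw [map_neg, neg_mul, map_neg, hx]
      | add x y hx hy => rw [map_add, add_mul, map_add, hx, hy]
    rw [h2, h1]
  · change pullK hσ (P _) = 0
    have h2 : P (pullK hY a * structureHom T Y (expChar (s ψ))) = 0 := by
      induction a using KRing.induction with
      | cl F =>
        rw [hprod]
        obtain ⟨p, hp⟩ := exists_isotypicProj hH hT.mul_comm_pt ht (F.twist hY (s ψ))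
        rw [hP _ p hp]
        exact (hp.isIdem χ).cl_eq_zero fun y v =>
          hp.apply_of_mem_ne χ ψ y hψ.symm v (hex.mem_isotypic_twist hY (hs ψ) F y v)
      | zero => rw [map_zero, zero_mul, map_zero]
      | neg x hx => rw [map_neg, neg_mul, map_neg, hx, neg_zero]
      | add x y hx hy => rw [map_add, add_mul, map_add, hx, hy, add_zero]
    rw [h2, map_zero]

end decomposition

/-! ### The representation ring of a torus -/

section point

variable {G : Over Base} [GrpObj G]

lemma RegularOn.point {U : (𝟙_ (Over Base)).left.Opens}
    (F : ∀ x : Pt (𝟙_ (Over Base)), In x U → ℂ) : RegularOn U F := by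
  intro x hx
  refine ((RegularOn.constC U (F x hx)).congr fun z hz => ?_) x hx
  obtain rfl : z = x := toUnit_unique _ _
  rfl

lemma isHom_of_point {E F : EqBundle G (𝟙_ (Over Base))}
    {φ : ∀ y, E.fiber y →ₗ[ℂ] F.fiber y}
    (h : ∀ (g : Pt G) (hg : g • 𝟙 (𝟙_ (Over Base)) = 𝟙 (𝟙_ (Over Base))) v,
      φ _ (E.act g hg v) = F.act g hg (φ _ v)) : IsHom E F φ := by
  refine ⟨fun _ _ _ _ _ _ => RegularOn.point _, fun g y z hg v => ?_⟩
  obtain rfl : y = 𝟙 _ := toUnit_unique _ _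
  obtain rfl : z = 𝟙 _ := toUnit_unique _ _
  exact h g hg v

variable {Y : Over Base} [ModObj G Y] {E F : EqBundle G Y} {φ : ∀ y, F.fiber y →ₗ[ℂ] E.fiber y}
  {ψ : ∀ y, E.fiber y →ₗ[ℂ] F.fiber y}

lemma isIdem_of_retract (hφ : IsHom F E φ) (hψ : IsHom E F ψ) (h : ∀ y v, ψ y (φ y v) = v) :
    IsIdem E (fun y => φ y ∘ₗ ψ y) :=
  ⟨hψ.comp hφ, fun y _ => congrArg (φ y) (h y _)⟩

lemma isIsom_image_retract (hφ : IsHom F E φ) (hψ : IsHom E F ψ) (h : ∀ y v, ψ y (φ y v) = v) :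
    IsIsom (E.image _ (isIdem_of_retract hφ hψ h)) F := by
  have hp := isIdem_of_retract hφ hψ h
  refine isIsom_of_inverse (hp.isHom_subtype.comp hψ) (hφ.comp hp.isHom_rangeRestrict)
    (fun y v => Subtype.ext ?_) (fun y v => ?_)
  · change φ y (ψ y (φ y (ψ y v.1))) = v.1
    rw [h]
    exact hp.apply_of_mem v.2
  · change ψ y (φ y (ψ y (φ y v))) = v
    rw [h, h]

/-- The representation ring of a torus is generated by the characters. -/
lemma IsTorus.mem_closure_expChar (hG : IsTorus G) (x : RepRing G) :
    x ∈ AddSubgroup.closure (Set.range (expChar (G := G))) := by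
  classical
  induction x using KRing.induction with
  | zero => exact zero_mem _
  | neg x hx => exact neg_mem hx
  | add x y hx hy => exact add_mem hx hy
  | cl E =>
    have hpt : ∀ y : Pt (𝟙_ (Over Base)), 𝟙 (𝟙_ (Over Base)) = y := fun y => toUnit_unique _ _
    obtain ⟨J, _, w, χ, hw⟩ :=
      exists_fiber_eigenbasis hG (actsTrivially_point (𝟙 G)) E (𝟙 (𝟙_ (Over Base)))
    have hact : ∀ (g : Pt G) (hg : g • 𝟙 (𝟙_ (Over Base)) = 𝟙 (𝟙_ (Over Base))) j,
        E.act g hg (w j) = ((χ j).1 g : ℂ) • w j := by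
      intro g hg j
      rw [← hw j g, fibAct]
      simp only [Category.comp_id]
    -- Each eigenvector w_j spans a line which is a retract of E, with retraction the j-th
    -- coordinate ψ_j. The idempotents φ_j ψ_j are orthogonal with sum the identity, so [E] is the
    -- sum of the classes of the lines.
    let φ : ∀ j y, (charBundle (χ j)).fiber y →ₗ[ℂ] E.fiber y := fun j y =>
      (E.cast (hpt y)).toLinearMap ∘ₗ LinearMap.toSpanSingleton ℂ _ (w j)
    let ψ : ∀ j y, E.fiber y →ₗ[ℂ] (charBundle (χ j)).fiber y := fun j y =>
      w.coord j ∘ₗ (E.cast (hpt y)).symm.toLinearMap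
    have hφ : ∀ j, IsHom (charBundle (χ j)) E (φ j) := by
      intro j
      have h1 : ∀ (g : Pt G) (hg : g • 𝟙 (𝟙_ (Over Base)) = 𝟙 (𝟙_ (Over Base))) (a : ℂ),
          (((χ j).1 g : ℂ) • a) • w j = E.act g hg (a • w j) := by
        intro g hg a
        rw [map_smul, hact, smul_smul, smul_eq_mul, mul_comm]
      exact isHom_of_point h1
    have hψ : ∀ j, IsHom E (charBundle (χ j)) (ψ j) := by
      intro j
      refine isHom_of_point fun g hg v => ?_
      change w.coord j (E.act g hg v) = ((χ j).1 g : ℂ) • w.coord j v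
      have h2 : w.coord j ∘ₗ E.act g hg = ((χ j).1 g : ℂ) • w.coord j := by
        refine w.ext fun k => ?_
        rcases eq_or_ne k j with rfl | hk
        · simp [hact]
        · simp [hact, hk]
      exact LinearMap.congr_fun h2 v
    have hψφ : ∀ j k y (a : ℂ), ψ j y (φ k y a) = if k = j then a else (0 : ℂ) := by
      intro j k y a
      change w.coord j ((E.cast (hpt y)).symm (E.cast (hpt y) (a • w k))) = _
      rw [LinearEquiv.symm_apply_apply, map_smul, w.coord_apply, w.repr_self,
        Finsupp.single_apply]
      split_ifs <;> simp
    have hret : ∀ j y v, ψ j y (φ j y v) = v := fun j y v => (hψφ j j y v).trans (if_pos rfl)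
    rw [cl_eq_sum_image Finset.univ (fun j y => φ j y ∘ₗ ψ j y)
      (fun j => isIdem_of_retract (hφ j) (hψ j) (hret j))]
    · refine sum_mem fun j _ => AddSubgroup.subset_closure ⟨χ j, ?_⟩
      exact (EqBundle.cl_eq (isIsom_image_retract (hφ j) (hψ j) (hret j))).symm
    · intro j _ k _ hjk y v
      have h1 : ψ j y (φ k y (ψ k y v)) = (0 : ℂ) := (hψφ j k y _).trans (if_neg hjk.symm)
      exact (congrArg (φ j y) h1).trans (map_zero _)
    · intro y v
      obtain ⟨v, rfl⟩ := (E.cast (hpt y)).surjective v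
      have h1 : ∀ j, (φ j y ∘ₗ ψ j y) (E.cast (hpt y) v) =
          E.cast (hpt y) (w.repr v j • w j) := by
        intro j
        change E.cast (hpt y) (w.coord j ((E.cast (hpt y)).symm (E.cast (hpt y) v)) • w j) = _
        rw [LinearEquiv.symm_apply_apply, w.coord_apply]
      simp only [h1]
      rw [← map_sum, w.sum_repr]

end point

/-! ### Tensor products of rings -/

section tensor

/-- A criterion for a ring `C` to be the tensor product of two algebras `A` and `B`, given a
generating family of the module `B` and the coefficient maps `C → A`. -/
lemma exists_tensor_ringEquiv {R A B C X : Type*} [CommRing R] [CommRing A] [CommRing B]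
    [CommRing C] [Algebra R A] [Algebra R B] (f : A →+* C) (g : B →+* C)
    (hfg : ∀ x : R, f (algebraMap R A x) = g (algebraMap R B x)) (e : X → B)
    (hspan : ∀ b, b ∈ Submodule.span R (Set.range e))
    (hgen : ∀ c, c ∈ AddSubgroup.closure {z | ∃ a x, z = f a * g (e x)})
    (hcoeff : ∀ x, ∃ Ψ : C →+ A, (∀ a, Ψ (f a * g (e x)) = a) ∧
      ∀ a y, y ≠ x → Ψ (f a * g (e y)) = 0) :
    ∃ Φ : A ⊗[R] B ≃+* C, ∀ a b, Φ (a ⊗ₜ b) = f a * g b := by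
  classical
  let : Algebra R C := (f.comp (algebraMap R A)).toAlgebra
  let f' : A →ₐ[R] C := { f with commutes' := fun _ => rfl }
  let g' : B →ₐ[R] C := { g with commutes' := fun x => (hfg x).symm }
  let Φ : A ⊗[R] B →ₐ[R] C := Algebra.TensorProduct.productMap f' g'
  have hΦ : ∀ a b, Φ (a ⊗ₜ b) = f a * g b := fun a b =>
    Algebra.TensorProduct.productMap_apply_tmul f' g' a b
  have hsurj : Function.Surjective Φ := by
    intro c
    have h1 : AddSubgroup.closure {z | ∃ a x, z = f a * g (e x)} ≤
        Φ.toRingHom.toAddMonoidHom.range := by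
      rw [AddSubgroup.closure_le]
      rintro _ ⟨a, x, rfl⟩
      exact ⟨a ⊗ₜ e x, hΦ a (e x)⟩
    exact h1 (hgen c)
  -- Every tensor is a finite sum of a_x ⊗ e_x because the e_x span B over R. Linear independence of
  -- the e_x is not assumed: injectivity of Φ follows since the coefficient maps recover each a_x
  -- from the image in C.
  let L : (X →₀ A) →ₗ[R] A ⊗[R] B :=
    Finsupp.lsum R fun x => (TensorProduct.mk R A B).flip (e x)
  have hL : LinearMap.range L = ⊤ := by
    rw [eq_top_iff]
    rintro z -
    induction z using TensorProduct.induction_on with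
    | zero => exact zero_mem _
    | add z w hz hw => exact add_mem hz hw
    | tmul a b =>
      induction hspan b using Submodule.span_induction with
      | mem b hb =>
        obtain ⟨x, rfl⟩ := hb
        exact ⟨Finsupp.single x a, by simp [L]⟩
      | zero => rw [TensorProduct.tmul_zero]; exact zero_mem _
      | add b b' _ _ h h' => rw [TensorProduct.tmul_add]; exact add_mem h h'
      | smul c b _ h => rw [TensorProduct.tmul_smul]; exact Submodule.smul_mem _ _ h
  have hinj : Function.Injective Φ := by
    rw [injective_iff_map_eq_zero]
    intro z hz
    obtain ⟨c, rfl⟩ : z ∈ LinearMap.range L := hL ▸ trivial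
    have h1 : Φ (L c) = ∑ x ∈ c.support, f (c x) * g (e x) := by
      simp [L, Finsupp.sum, hΦ]
    rw [h1] at hz
    have h2 : c = 0 := by
      ext x
      obtain ⟨Ψ, h3, h4⟩ := hcoeff x
      have h5 := congrArg Ψ hz
      rw [map_sum, map_zero] at h5
      by_cases hx : x ∈ c.support
      · rw [Finset.sum_eq_single x (fun y _ hy => h4 _ _ hy) fun h => (h hx).elim, h3] at h5
        exact h5
      · exact Finsupp.notMem_support_iff.1 hx
    rw [h2, map_zero]
  exact ⟨RingEquiv.ofBijective Φ ⟨hinj, hsurj⟩, hΦ⟩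

end tensor

/-! ### The two isomorphisms -/

section main

variable {H T Q Y : Over Base} [GrpObj H] [GrpObj T] [GrpObj Q] {i : H ⟶ T} {π : T ⟶ Q}
  [ModObj Q Y] [ModObj T Y] [IsMonHom π]

lemma pullK_structureHom (hY : IsEquivariant π (𝟙 Y)) (x : RepRing Q) :
    pullK hY (structureHom Q Y x) = structureHom T Y (resRep π x) := by
  rw [structureHom, structureHom, resRep, pullK_pullK, pullK_pullK]
  exact pullK_congr _ _ (by rw [Category.id_comp, Category.comp_id]) (toUnit_unique _ _) x

instance : IrreducibleSpace (𝟙_ (Over Base)).left :=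
  inferInstanceAs (IrreducibleSpace (Spec (.of ℂ)))

instance : LocallyOfFiniteType (𝟙_ (Over Base)).hom :=
  inferInstanceAs (LocallyOfFiniteType (𝟙 Base))

variable [IsMonHom i] [LocallyOfFiniteType Y.hom] [IrreducibleSpace Y.left]

/-- The tensor criterion over `ℤ`, with R(H) mapped to K_T(Y) through the retraction r; since r
induces s, the class e^χ goes to e^{s(χ)}. -/
lemma exists_ringEquiv_int (hex : IsExactSeq i π) (hH : IsTorus H) (hT : IsTorus T)
    (hY : IsEquivariant π (𝟙 Y)) {s : Characters H →* Characters T}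
    (hs : ∀ χ, Characters.res i (s χ) = χ) {r : T ⟶ H} [IsMonHom r] {σ : Q ⟶ T} [IsMonHom σ]
    (hr : ∀ χ, Characters.res r χ = s χ) (hσπ : σ ≫ π = 𝟙 Q)
    (hσs : ∀ χ, Characters.res σ (s χ) = 1)
    (hdec : ∀ t : Pt T, (t ≫ π ≫ σ) * (t ≫ r ≫ i) = t) :
    ∃ Φ : KRing Q Y ⊗[ℤ] RepRing H ≃+* KRing T Y, ∀ x z,
      Φ (x ⊗ₜ z) = pullK hY x * structureHom T Y (resRep r z) := by
  have he : ∀ χ, resRep r (expChar χ) = expChar (s χ) := fun χ => by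
    rw [resRep_expChar, hr]
  refine exists_tensor_ringEquiv (pullK hY) ((structureHom T Y).comp (resRep r))
    (fun x => by simp) (expChar (G := H)) (fun z => ?_) (fun c => ?_) (fun χ => ?_)
  · rw [← Submodule.mem_toAddSubgroup, Submodule.span_int_eq_addSubgroupClosure]
    exact hH.mem_closure_expChar z
  · simp only [RingHom.comp_apply, resRep_expChar]
    exact mem_closure_pullK_mul_expChar hH hT (hex.actsTrivially hY) hY (hY.of_section hσπ) hdec c
  · simp only [RingHom.comp_apply, he]
    exact exists_coefficient hex hH hT hY hs hσπ hσs χ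

/-- The tensor criterion over R(Q), with the same coefficient maps. That the e^{s(χ)} span R(T) over
R(Q) is the generation statement for bundles on a point. -/
lemma exists_ringEquiv_rep (hex : IsExactSeq i π) (hH : IsTorus H) (hT : IsTorus T)
    (hY : IsEquivariant π (𝟙 Y)) {s : Characters H →* Characters T}
    (hs : ∀ χ, Characters.res i (s χ) = χ) {r : T ⟶ H} [IsMonHom r] {σ : Q ⟶ T} [IsMonHom σ]
    (hr : ∀ χ, Characters.res r χ = s χ) (hσπ : σ ≫ π = 𝟙 Q)
    (hσs : ∀ χ, Characters.res σ (s χ) = 1)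
    (hdec : ∀ t : Pt T, (t ≫ π ≫ σ) * (t ≫ r ≫ i) = t) :
    letI : Algebra (RepRing Q) (KRing Q Y) := (structureHom Q Y).toAlgebra
    letI : Algebra (RepRing Q) (RepRing T) := (resRep π).toAlgebra
    ∃ Φ : KRing Q Y ⊗[RepRing Q] RepRing T ≃+* KRing T Y,
      ∀ (x : KRing Q Y) (z : RepRing T), Φ (x ⊗ₜ z) = pullK hY x * structureHom T Y z := by
  let : Algebra (RepRing Q) (KRing Q Y) := (structureHom Q Y).toAlgebra
  let : Algebra (RepRing Q) (RepRing T) := (resRep π).toAlgebra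
  refine exists_tensor_ringEquiv (pullK hY) (structureHom T Y)
    (fun x => pullK_structureHom hY x) (fun χ => expChar (s χ)) (fun z => ?_) (fun c => ?_)
    (fun χ => exists_coefficient hex hH hT hY hs hσπ hσs χ)
  · have h1 := mem_closure_pullK_mul_expChar hH hT (actsTrivially_point i)
      (isEquivariant_point π) (isEquivariant_point σ) hdec z
    refine (AddSubgroup.closure_le
      (Submodule.span (RepRing Q) (Set.range fun χ => expChar (s χ))).toAddSubgroup).2 ?_ h1
    rintro _ ⟨a, χ, rfl⟩
    have h2 : structureHom T (𝟙_ (Over Base)) (expChar (Characters.res r χ)) =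
        expChar (s χ) := by
      rw [hr]
      exact pullK_eq_self _ rfl (toUnit_unique _ _) _
    rw [h2]
    exact Submodule.smul_mem _ a (Submodule.subset_span ⟨χ, rfl⟩)
  · simp only [← hr]
    exact mem_closure_pullK_mul_expChar hH hT (hex.actsTrivially hY) hY (hY.of_section hσπ) hdec c

/-- The isotypic subbundles of an equivariant bundle, as twists of pullbacks. -/
lemma exists_isotypic_decomposition (hex : IsExactSeq i π) (hH : IsTorus H) (hT : IsTorus T)
    (hY : IsEquivariant π (𝟙 Y)) {s : Characters H →* Characters T} {r : T ⟶ H} [IsMonHom r]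
    {σ : Q ⟶ T} [IsMonHom σ] (hr : ∀ χ, Characters.res r χ = s χ) (hσπ : σ ≫ π = 𝟙 Q)
    (hdec : ∀ t : Pt T, (t ≫ π ≫ σ) * (t ≫ r ≫ i) = t) (E : EqBundle T Y) :
    ∃ (S : Finset (Characters H)) (F : Characters H → EqBundle Q Y),
      (∀ y : Pt Y, iSupIndep (fun χ : S => isotypic i E χ y) ∧
        ⨆ χ : S, isotypic i E χ y = ⊤) ∧
      (∀ χ ∈ S, ∃ f, IsHom ((F χ).twist hY (s χ)) E f ∧
        ∀ y : Pt Y, Function.Injective (f y) ∧ LinearMap.range (f y) = isotypic i E χ y) ∧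
      E.cl = ∑ χ ∈ S, pullK hY (F χ).cl * structureHom T Y (expChar (s χ)) := by
  have ht := hex.actsTrivially hY
  have hσ := hY.of_section hσπ
  obtain ⟨p, hp⟩ := exists_isotypicProj hH hT.mul_comm_pt ht E
  obtain ⟨S, hS, -⟩ := hp.exists_finset
  refine ⟨S, fun χ => (E.image (p χ) (hp.isIdem χ)).pull hσ, fun y => ⟨hp.iSupIndep S y, ?_⟩,
    fun χ _ => ?_, ?_⟩
  · rw [eq_top_iff]
    rintro v -
    rw [← hS y v]
    exact Submodule.sum_mem _ fun χ hχ =>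
      Submodule.mem_iSup_of_mem (⟨χ, hχ⟩ : S) (hp.mem χ y v)
  · have hiso := hp.isIsom_twist_image ht hY hσ hdec χ
    rw [hr] at hiso
    obtain ⟨e, he, -⟩ := hiso
    have key : ∀ {A B : Type} [AddCommGroup A] [Module ℂ A] [AddCommGroup B] [Module ℂ B]
        {W : Submodule ℂ B} (e : A ≃ₗ[ℂ] W), Function.Injective (W.subtype ∘ₗ e.toLinearMap) ∧
          LinearMap.range (W.subtype ∘ₗ e.toLinearMap) = W := fun {A B} _ _ _ _ {W} e =>
      ⟨Subtype.val_injective.comp e.injective, by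
        rw [LinearMap.range_comp, LinearEquiv.range, Submodule.map_top, Submodule.range_subtype]⟩
    exact ⟨_, he.comp (hp.isIdem χ).isHom_subtype, fun y =>
      ⟨(key (e y)).1, (key (e y)).2.trans (hp.range χ y)⟩⟩
  · simp only [← hr]
    exact hp.cl_eq_sum ht hY hσ hdec hS

end main

end EquivariantK

end

/-! ### The proposition. -/

theorem mainTheorem12 {TH T Q : Over Base} [GrpObj TH] [GrpObj T] [GrpObj Q]
    (hTH : IsTorus TH) (hT : IsTorus T) (hQ : IsTorus Q)
    (i : TH ⟶ T) [IsMonHom i] (π : T ⟶ Q) [IsMonHom π] (hex : IsExactSeq i π)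
    (Y : Over Base) [AlgebraicGeometry.IsIntegral Y.left] [IsSeparated Y.hom]
    [LocallyOfFiniteType Y.hom] [QuasiCompact Y.hom]
    [ModObj Q Y] [ModObj T Y] (hY : IsEquivariant π (𝟙 Y)) :
    (∃ s : Characters TH →* Characters T, ∀ χ, Characters.res i (s χ) = χ) ∧
    (∀ s : Characters TH →* Characters T, (∀ χ, Characters.res i (s χ) = χ) →
      ∃ Φ : KRing Q Y ⊗[ℤ] RepRing TH ≃+* KRing T Y,
        (∀ x : KRing Q Y, Φ (x ⊗ₜ 1) = pullK hY x) ∧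
        (∀ χ : Characters TH, Φ (1 ⊗ₜ expChar χ) = structureHom T Y (expChar (s χ))) ∧
        (∀ E : EqBundle T Y, ∃ (S : Finset (Characters TH)) (F : Characters TH → EqBundle Q Y),
          (∀ y : Pt Y, iSupIndep (fun χ : S => isotypic i E χ y) ∧
            ⨆ χ : S, isotypic i E χ y = ⊤) ∧
          (∀ χ ∈ S, ∃ f, IsHom (((charBundle (s χ)).pull (isEquivariant_toUnit T Y)).tensor
              ((F χ).pull hY)) E f ∧
            ∀ y : Pt Y, Function.Injective (f y) ∧ LinearMap.range (f y) = isotypic i E χ y) ∧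
          Φ.symm E.cl = ∑ χ ∈ S, (F χ).cl ⊗ₜ expChar χ)) ∧
    (letI : Algebra (RepRing Q) (KRing Q Y) := (structureHom Q Y).toAlgebra
     letI : Algebra (RepRing Q) (RepRing T) := (resRep π).toAlgebra
     ∃ Φ : KRing Q Y ⊗[RepRing Q] RepRing T ≃+* KRing T Y,
        ∀ (x : KRing Q Y) (r : RepRing T), Φ (x ⊗ₜ r) = pullK hY x * structureHom T Y r) := by
  refine ⟨hex.exists_splitting hTH hT, fun s hs => ?_, ?_⟩
  · obtain ⟨r, hr, σ, hσ, hrs, hσπ, hσs, hdec⟩ := hex.exists_decomposition hTH hT hQ s hs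
    obtain ⟨Φ, hΦ⟩ := exists_ringEquiv_int hex hTH hT hY hs hrs hσπ hσs hdec
    have hΦe : ∀ x χ, Φ (x ⊗ₜ expChar χ) = pullK hY x * structureHom T Y (expChar (s χ)) :=
      fun x χ => by rw [hΦ, resRep_expChar, hrs]
    refine ⟨Φ, fun x => by rw [hΦ, map_one, map_one, _root_.mul_one],
      fun χ => by rw [hΦe, map_one, _root_.one_mul], fun E => ?_⟩
    obtain ⟨S, F, h1, h2, h3⟩ := exists_isotypic_decomposition hex hTH hT hY hrs hσπ hdec E
    refine ⟨S, F, h1, h2, ?_⟩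
    -- The inverse is checked by applying Φ to the proposed sum, which gives back the decomposition
    -- of [E] into twists.
    rw [RingEquiv.symm_apply_eq, map_sum, h3]
    exact Finset.sum_congr rfl fun χ _ => (hΦe _ _).symm
  -- The isomorphism over R(Q) does not refer to a splitting; any one serves to produce the
  -- generators e^{s(χ)}.
  · obtain ⟨s, hs⟩ := hex.exists_splitting hTH hT
    obtain ⟨r, hr, σ, hσ, hrs, hσπ, hσs, hdec⟩ := hex.exists_decomposition hTH hT hQ s hs
    exact exists_ringEquiv_rep hex hTH hT hY hs hrs hσπ hσs hdec
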